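/- Let $R$ be a finite (not necessarily crystallographic) root system, $F\subseteq\mathbb R$ a subfield containing all $\langle\beta,\alpha^\vee\rangle$ $(\alpha,\beta\in R)$, and $\Lambda$ a totally ordered abelian group which is an ordered $F$-module (nonnegative scalars preserve nonnegative elements). Let $\mathbb A=\mathrm{span}_F(R)\otimes_F\Lambda$ with the induced action of the spherical Weyl group $\overline W$. Fix a basis of $R$, with positive roots $R^+$ and fundamental Weyl chamber $\mathcal C_f=\{x\in\mathbb A:\langle x,\alpha^\vee\rangle\ge 0\ \forall\alpha\in R^+\}$. Weyl chambers of $\mathbb A$ are the images $g(\mathcal C_f)$ under maps $g$ in the full affine Weyl group $\overline W\ltimes\mathbb A$, such a chamber being based at $g(0)$; put $d(x,y)=\sum_{\alpha\in R^+}|\langle y-x,\alpha^\vee\rangle|\in\Lambda$ on $\mathbb A$. Half-apartments of $\mathbb A$ are the sets $\{x:\langle x,\alpha^\vee\rangle\ge k\}$ with $\alpha\in R$, $k\in\Lambda$. Let $T\neq 0$ be a group of translations of $\mathbb A$ normalized by $\overline W$ and $\overline WT=\overline W\ltimes T$. A half-apartment is special if its bounding hyperplane is the fixed point set of an affine reflection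 $x\mapsto r_\alpha(x)+k\alpha$ lying in $\overline WT$. A subset of $\mathbb A$ is convex if it is an intersection of finitely many special half-apartments. A set $X$ with a collection $\mathcal A$ of injective charts $f:\mathbb A\to X$ is a generalized affine building if the following hold. Here apartments are the sets $f(\mathbb A)$, $f\in\mathcal A$; Weyl chambers (with their base points) and half-apartments of $X$ are the images under charts of those of $\mathbb A$; and the distance $d$ on $X$ is computed in any chart whose apartment contains both points. * (A1) $f\circ w\in\mathcal A$ for all $f\in\mathcal A$, $w\in\overline WT$. * (A2) If $f,g\in\mathcal A$ and $f(\mathbb A)\cap g(\mathbb A)\ne\emptyset$, then $f^{-1}(g(\mathbb A))$ is convex and $f=g\circ w$ on it for some $w\in\overline WT$. * (A3) Any two points lie in a common apartment. * (A4) Any two Weyl chambers $S_1,S_2$ contain Weyl chambers $S_1'\subseteq S_1$, $S_2'\subseteq S_2$ lying in a common apartment. * (A5) For every apartment $A$ and $x\in A$ there is a retraction $r:X\to A$ which does not increase distances and satisfies $r^{-1}(x)=\{x\}$. * (A6) If three apartments pairwise intersect in half-apartments, then their common intersection is nonempty. Two subsets of $X$ are parallel if they are at bounded distance: for some $N\in\Lambda$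 every point of either set has distance at most $N$ from some point of the other. A chamber at infinity is a parallel class $c$ of Weyl chambers, and an apartment contains $c$ at infinity if it contains a Weyl chamber belonging to $c$. An apartment contains the germ at $z$ of a Weyl chamber $S$ based at $z$ if it contains $S\cap B_\varepsilon(z)$ for some $\varepsilon>0$ in $\Lambda$. Put $\mathrm{seg}(x,y)=\{p\in X: d(x,y)=d(x,p)+d(p,y)\}$. Let $(X,\mathcal A)$ be a generalized affine building and $x,y\in X$. Then: * (FC) For every chamber $c$ at infinity, $\mathrm{seg}(x,y)$ is contained in a finite union of apartments containing $c$ at infinity. * (FC') For every $z\in X$, $\mathrm{seg}(x,y)$ is contained in a finite union of Weyl chambers based at $z$. Furthermore, for every germ $\mu$ of a Weyl chamber based at $z$, $\mathrm{seg}(x,y)$ is contained in a finite union of apartments containing $\mu$. -/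

import Mathlib

open scoped TensorProduct

namespace GenAffineBuilding

noncomputable section

section ModelSpace

variable {ι : Type*} {F : Subfield ℝ} {M N Λ : Type*}
  [AddCommGroup M] [Module F M] [AddCommGroup N] [Module F N]

/-- `i` is a nonnegative linear combination of the roots indexed by `s`. -/
def IsNonnegComb (P : RootPairing ι F M N) (s : Finset ι) (i : ι) : Prop :=
  ∃ c : ι → F, (∀ j, 0 ≤ c j) ∧ P.root i = ∑ j ∈ s, c j • P.root j

/-- A basis of a (not necessarily crystallographic) root system: a linearly independent set of
roots such that every root is a linear combination of it with coefficients all `≥ 0` or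
all `≤ 0`. (`RootPairing.Base` asks for integral coefficients and so only fits crystallographic
root systems.) -/
structure RootBasis (P : RootPairing ι F M N) where
  /-- the indices of the simple roots -/
  support : Finset ι
  linearIndepOn_root : LinearIndepOn F P.root (support : Set ι)
  nonneg_or_nonpos : ∀ i, IsNonnegComb P support i ∨
    ∃ c : ι → F, (∀ j, c j ≤ 0) ∧ P.root i = ∑ j ∈ support, c j • P.root j

/-- The positive roots determined by a basis. -/
def RootBasis.IsPos {P : RootPairing ι F M N} (B : RootBasis P) (i : ι) : Prop :=
  IsNonnegComb P B.support i

variable [AddCommGroup Λ] [Module F Λ]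

/-- The evaluation `x ↦ ⟨x, αᵢ^∨⟩` of the `i`-th coroot on the model space `M ⊗[F] Λ`,
with values in `Λ`. -/
def coev (P : RootPairing ι F M N) (Λ : Type*) [AddCommGroup Λ] [Module F Λ] (i : ι) :
    M ⊗[F] Λ →ₗ[F] Λ :=
  (TensorProduct.lid F Λ).toLinearMap ∘ₗ (P.coroot' i).rTensor Λ

/-- The reflection `r_α` of the model space, the extension of `s_α`. -/
def wallRefl (P : RootPairing ι F M N) (Λ : Type*) [AddCommGroup Λ] [Module F Λ] (i : ι) :
    M ⊗[F] Λ ≃ₗ[F] M ⊗[F] Λ :=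
  TensorProduct.congr (P.reflection i) (LinearEquiv.refl F Λ)

/-- The spherical Weyl group, acting on the model space. -/
def sphericalWeyl (P : RootPairing ι F M N) (Λ : Type*) [AddCommGroup Λ] [Module F Λ] :
    Subgroup (M ⊗[F] Λ ≃ₗ[F] M ⊗[F] Λ) :=
  Subgroup.closure (Set.range (wallRefl P Λ))

/-- A nontrivial group of translations of the model space, normalized by the spherical Weyl
group. A translation is identified with the image of the origin. -/
structure IsTranslationGroup (P : RootPairing ι F M N) (T : AddSubgroup (M ⊗[F] Λ)) : Prop where
  nontrivial : T ≠ ⊥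
  normalized : ∀ w ∈ sphericalWeyl P Λ, ∀ t ∈ T, w t ∈ T

/-- The affine Weyl group `W̄T`, as a set of maps of the model space to itself.
For `T = ⊤` this is the full affine Weyl group. -/
def affineWeyl (P : RootPairing ι F M N) (T : AddSubgroup (M ⊗[F] Λ)) :
    Set (M ⊗[F] Λ → M ⊗[F] Λ) :=
  {g | ∃ w ∈ sphericalWeyl P Λ, ∃ t ∈ T, ∀ x, g x = w x + t}

/-- The affine reflection `x ↦ r_α(x) + α ⊗ k`. Its fixed point set is the hyperplane
`{x | ⟨x, α^∨⟩ = k}`. -/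
def affineRefl (P : RootPairing ι F M N) (i : ι) (k : Λ) (x : M ⊗[F] Λ) : M ⊗[F] Λ :=
  wallRefl P Λ i x + P.root i ⊗ₜ[F] k

variable [LinearOrder Λ]

/-- The half-apartment `{x | ⟨x, α^∨⟩ ≥ k}` of the model space. (The opposite half-apartment
`{x | ⟨x, α^∨⟩ ≤ k}` is the one of `-α` and `-k`.) -/
def halfSpace (P : RootPairing ι F M N) (i : ι) (k : Λ) : Set (M ⊗[F] Λ) :=
  {x | k ≤ coev P Λ i x}

/-- `H` is a half-apartment of the model space. -/
def IsHalfSpace (P : RootPairing ι F M N) (H : Set (M ⊗[F] Λ)) : Prop :=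
  ∃ (i : ι) (k : Λ), H = halfSpace P i k

/-- `H` is a half-apartment bounded by a hyperplane that is special with respect to `T`, i.e. the
fixed point set of an affine reflection belonging to `W̄T`. -/
def IsSpecialHalfSpace (P : RootPairing ι F M N) (T : AddSubgroup (M ⊗[F] Λ))
    (H : Set (M ⊗[F] Λ)) : Prop :=
  ∃ (i : ι) (k : Λ), affineRefl P i k ∈ affineWeyl P T ∧ H = halfSpace P i k

/-- `W̄T`-convex subsets: the intersections of finitely many special half-apartments. -/
def IsWTConvex (P : RootPairing ι F M N) (T : AddSubgroup (M ⊗[F] Λ))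
    (Y : Set (M ⊗[F] Λ)) : Prop :=
  ∃ 𝓗 : Set (Set (M ⊗[F] Λ)), 𝓗.Finite ∧ (∀ H ∈ 𝓗, IsSpecialHalfSpace P T H) ∧ Y = ⋂₀ 𝓗

variable {P : RootPairing ι F M N}

/-- The fundamental Weyl chamber with respect to a basis. -/
def fundChamber (B : RootBasis P) (Λ : Type*) [AddCommGroup Λ] [Module F Λ] [LinearOrder Λ] :
    Set (M ⊗[F] Λ) :=
  {x | ∀ i, B.IsPos i → 0 ≤ coev P Λ i x}

/-- `C` is a Weyl chamber of the model space based at `p`: the image of the fundamental Weyl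
chamber (which is based at `0`) under an element of the full affine Weyl group. -/
def IsModelChamber (B : RootBasis P) (C : Set (M ⊗[F] Λ)) (p : M ⊗[F] Λ) : Prop :=
  ∃ g ∈ affineWeyl P (⊤ : AddSubgroup (M ⊗[F] Λ)), C = g '' fundChamber B Λ ∧ p = g 0

open Classical in
/-- The `Λ`-valued distance `∑_{α ∈ R⁺} |⟨y - x, α^∨⟩|` on the model space. -/
def modelDist [Fintype ι] (B : RootBasis P) (x y : M ⊗[F] Λ) : Λ :=
  ∑ i with B.IsPos i, |coev P Λ i (y - x)|

end ModelSpace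

section Building

variable {ι : Type*} {F : Subfield ℝ} {M N Λ : Type*}
  [AddCommGroup M] [Module F M] [AddCommGroup N] [Module F N]
  [AddCommGroup Λ] [Module F Λ] [LinearOrder Λ]
  {P : RootPairing ι F M N} {X : Type*}

/-- Apartments: the images of the charts in the atlas `𝒜`. -/
def IsApartment (𝒜 : Set (M ⊗[F] Λ → X)) (A : Set X) : Prop :=
  ∃ f ∈ 𝒜, A = Set.range f

/-- `S` is a Weyl chamber of `X` based at `x`. -/
def IsChamberAt (B : RootBasis P) (𝒜 : Set (M ⊗[F] Λ → X)) (S : Set X) (x : X) : Prop :=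
  ∃ f ∈ 𝒜, ∃ (C : Set (M ⊗[F] Λ)) (p : M ⊗[F] Λ),
    IsModelChamber B C p ∧ S = f '' C ∧ x = f p

/-- `S` is a Weyl chamber of `X`. -/
def IsChamber (B : RootBasis P) (𝒜 : Set (M ⊗[F] Λ → X)) (S : Set X) : Prop :=
  ∃ x, IsChamberAt B 𝒜 S x

/-- `H` is a half-apartment of `X`. -/
def IsHalfApartment (P : RootPairing ι F M N) (𝒜 : Set (M ⊗[F] Λ → X)) (H : Set X) : Prop :=
  ∃ f ∈ 𝒜, ∃ K : Set (M ⊗[F] Λ), IsHalfSpace P K ∧ H = f '' K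

open Classical in
/-- The distance on `X`: the model distance of the preimages of two points under a chart whose
apartment contains both. (By axioms (A2) and (A3) such a chart exists and the value does not
depend on the choice; the value `0` for points without a common chart plays no role.) -/
def bdist [Fintype ι] (B : RootBasis P) (𝒜 : Set (M ⊗[F] Λ → X)) (x y : X) : Λ :=
  if h : ∃ pq : (M ⊗[F] Λ) × (M ⊗[F] Λ), ∃ f ∈ 𝒜, f pq.1 = x ∧ f pq.2 = y then
    modelDist B h.choose.1 h.choose.2
  else 0

/-- `(X, 𝒜)` is a generalized affine building modelled on the model space
`M ⊗[F] Λ = span_F(R) ⊗ Λ` with affine Weyl group `W̄T`. -/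
structure IsAffineBuilding [Fintype ι] (B : RootBasis P) (T : AddSubgroup (M ⊗[F] Λ))
    (𝒜 : Set (M ⊗[F] Λ → X)) : Prop where
  /-- charts are injective -/
  injective : ∀ f ∈ 𝒜, Function.Injective f
  /-- (A1) -/
  comp_mem : ∀ f ∈ 𝒜, ∀ w ∈ affineWeyl P T, f ∘ w ∈ 𝒜
  /-- (A2) -/
  compatible : ∀ f ∈ 𝒜, ∀ g ∈ 𝒜, (Set.range f ∩ Set.range g).Nonempty →
    IsWTConvex P T (f ⁻¹' Set.range g) ∧
      ∃ w ∈ affineWeyl P T, Set.EqOn f (g ∘ w) (f ⁻¹' Set.range g)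
  /-- (A3) -/
  exists_apartment : ∀ x y : X, ∃ A, IsApartment 𝒜 A ∧ x ∈ A ∧ y ∈ A
  /-- (A4) -/
  exists_subchambers : ∀ S₁ S₂, IsChamber B 𝒜 S₁ → IsChamber B 𝒜 S₂ →
    ∃ S₁' S₂', IsChamber B 𝒜 S₁' ∧ IsChamber B 𝒜 S₂' ∧ S₁' ⊆ S₁ ∧ S₂' ⊆ S₂ ∧
      ∃ f ∈ 𝒜, S₁' ∪ S₂' ⊆ Set.range f
  /-- (A5) -/
  exists_retraction : ∀ A, IsApartment 𝒜 A → ∀ x ∈ A, ∃ r : X → X,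
    (∀ y, r y ∈ A) ∧ (∀ y ∈ A, r y = y) ∧
      (∀ y z, bdist B 𝒜 (r y) (r z) ≤ bdist B 𝒜 y z) ∧ r ⁻¹' {x} = {x}
  /-- (A6) -/
  inter_nonempty : ∀ f ∈ 𝒜, ∀ g ∈ 𝒜, ∀ h ∈ 𝒜,
    IsHalfApartment P 𝒜 (Set.range f ∩ Set.range g) →
    IsHalfApartment P 𝒜 (Set.range g ∩ Set.range h) →
    IsHalfApartment P 𝒜 (Set.range f ∩ Set.range h) →
    (Set.range f ∩ Set.range g ∩ Set.range h).Nonempty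

/-- The segment of `x` and `y`. -/
def seg [Fintype ι] (B : RootBasis P) (𝒜 : Set (M ⊗[F] Λ → X)) (x y : X) : Set X :=
  {z | bdist B 𝒜 x y = bdist B 𝒜 x z + bdist B 𝒜 z y}

/-- Two subsets of `X` are parallel if they are at bounded distance. -/
def Parallel [Fintype ι] (B : RootBasis P) (𝒜 : Set (M ⊗[F] Λ → X)) (S S' : Set X) : Prop :=
  ∃ n : Λ, (∀ x ∈ S, ∃ y ∈ S', bdist B 𝒜 x y ≤ n) ∧ (∀ x ∈ S', ∃ y ∈ S, bdist B 𝒜 x y ≤ n)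

/-- The parallel class `∂S` of a Weyl chamber. -/
def parallelClass [Fintype ι] (B : RootBasis P) (𝒜 : Set (M ⊗[F] Λ → X)) (S : Set X) :
    Set (Set X) :=
  {S' | IsChamber B 𝒜 S' ∧ Parallel B 𝒜 S S'}

/-- The chambers of the building at infinity: the parallel classes of Weyl chambers. -/
def chambersAtInfinity [Fintype ι] (B : RootBasis P) (𝒜 : Set (M ⊗[F] Λ → X)) :
    Set (Set (Set X)) :=
  {c | ∃ S, IsChamber B 𝒜 S ∧ c = parallelClass B 𝒜 S}

/-- The set `A` contains the chamber `c` at infinity: it contains a Weyl chamber of class `c`. -/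
def ContainsAtInfinity (A : Set X) (c : Set (Set X)) : Prop :=
  ∃ S ∈ c, S ⊆ A

/-- The set `Y` contains the germ at `x` of the Weyl chamber `S` based at `x`: it contains the
intersection of `S` with a ball of positive radius about `x`. -/
def ContainsGerm [Fintype ι] (B : RootBasis P) (𝒜 : Set (M ⊗[F] Λ → X)) (Y : Set X)
    (S : Set X) (x : X) : Prop :=
  ∃ ε : Λ, 0 < ε ∧ S ∩ {y | bdist B 𝒜 x y < ε} ⊆ Y

end Building

end

end GenAffineBuilding

/-! ### Abstract apartments and their Weyl group -/

namespace GenAffineBuilding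

/-! Call a sector up to passage to subsectors an end. Everything rests on one covering statement,
`opposite_cover`: given a chart `f`, a point of its apartment and an end `S`, some apartment through
that point contains `S` together with an end of `f` opposite to `S`. Two opposite ends determine an
apartment (`eq_of_agree_opposite`) and `f` has only finitely many ends, so finitely many apartments
with end `S` cover the apartment of `f` (`exists_finite_cover`). Segments lie in every apartment
through their end points (`seg_subset_range`), and (FC) follows.

For (FC'), one sector from `z` towards each end of `f` suffices: if a sector based at a point `x` of
the apartment and containing `z` has end `S`, the apartment given by `opposite_cover` shows `z` and
some end of `f` in opposite directions from `x`, so `x` lies on the way from `z` to that end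
(`exists_finite_sector_cover`). Each of these sectors shares an apartment with any given germ at `z`
(`exists_chart_germ`), because one member of a finite cover by apartments must contain the germ.

The covering statement is proved by induction along a gallery of ends. The inductive step uses
`sundial`: an apartment adjacent to an outside end `S` splits into two halves, each lying in an
apartment with end `S`; this is where (A6) enters. Sundials come from the spherical building at
infinity, with Weyl distance `Rel`. Its essential axiom `rel_step` has a metric proof, by comparing
distances to points far out in an end while moving along a panel. (A5) is needed only for the
triangle inequality.

The argument is carried out over `ApartmentModel`; the root system is then shown to provide one
(`model`). As it need not be crystallographic, the free action of the Weyl group is obtained from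
scalar-valued heights and the exchange condition. -/

/-- The affine space on which apartments are modelled, with its Weyl group `G`, presented by the
coroots `α`, the reflections `r` and a regular dominant vector `o`. -/
structure ApartmentModel (G ι V Λ : Type*) [Group G] [AddCommGroup V] [DistribMulAction G V]
    [AddCommGroup Λ] [LinearOrder Λ] [Fintype ι] where
  /-- the coroots -/
  α : ι → V →+ Λ
  /-- the reflections -/
  r : ι → G
  /-- a regular dominant vector -/
  o : V
  ne : ∀ i, α i o ≠ 0
  perm : ∀ w : G, ∃ σ : Equiv.Perm ι, ∀ i,
    (∀ v, α (σ i) (w • v) = α i v) ∧ r (σ i) = w * r i * w⁻¹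
  cover : ∀ v, ∃ w : G, ∀ i, 0 < α i o → 0 ≤ α i (w • v)
  free : ∀ w : G, (∀ i, 0 < α i o → 0 < α i (w • o)) → w = 1
  deep : ∀ κ, ∃ v, ∀ i, 0 < α i o → κ ≤ α i v
  small : ∀ ε, 0 < ε → ∃ v, (∀ i, 0 < α i o → 0 < α i v) ∧ ∑ i, |α i v| < ε
  -- The middle clause characterizes a simple wall: crossing it makes no positive coroot negative
  -- except those belonging to that wall.
  simple : ∀ w : G, w ≠ 1 → ∃ i, 0 < α i o ∧
    (∀ j, 0 < α j o → r j ≠ r i → 0 < α j (r i • o)) ∧ α i (w • o) < 0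
  refl_sq : ∀ i, r i * r i = 1
  refl_neg : ∀ i v, α i (r i • v) = -α i v
  -- The root system need not be reduced, so one wall may carry several positive coroots. They
  -- differ by a positive scalar, which acts on `Λ` as an ordered automorphism.
  parallel : ∀ i j, r i = r j → 0 < α i o → 0 < α j o →
    ∃ e : Λ ≃+o Λ, ∀ v, α j v = e (α i v)
  nonparallel : ∀ i j, r i ≠ r j → ∀ κ, ∃ v, κ ≤ α i v ∧ α j v ≤ -κ
  -- The vectors `v` range over the common face of the fundamental chamber and its neighbour across
  -- the wall. A bound is assumed instead of equality, since distance comparisons between charts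
  -- only control these functions up to a constant.
  panel : ∀ i, 0 < α i o → (∀ j, 0 < α j o → r j ≠ r i → 0 < α j (r i • o)) → ∀ w w' : G,
    (∃ K, ∀ v, (∀ j, 0 < α j o → 0 ≤ α j v) → (∀ j, 0 < α j (r i • o) → 0 ≤ α j v) →
      |∑ j, (if 0 < α j (w' • o) then α j v else -α j v) -
        ∑ j, (if 0 < α j (w • o) then α j v else -α j v)| ≤ K) →
    w' = w ∨ w' = r i * w

set_option linter.unusedSectionVars false

namespace ApartmentModel

variable {G ι V Λ : Type*} [Group G] [AddCommGroup V] [DistribMulAction G V]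
    [AddCommGroup Λ] [LinearOrder Λ] [Fintype ι]
    (A : ApartmentModel G ι V Λ)

/-- The wall of the fundamental chamber given by a simple root. -/
def IsSimple (i : ι) : Prop :=
  0 < A.α i A.o ∧ ∀ j, 0 < A.α j A.o → A.r j ≠ A.r i → 0 < A.α j (A.r i • A.o)

/-- The chamber based at the origin in direction `w`. -/
def C (w : G) : Set V := {v | ∀ i, 0 < A.α i (w • A.o) → 0 ≤ A.α i v}

/-- The `G`-invariant norm, the sum over all roots. -/
def D (v : V) : Λ := ∑ i, |A.α i v|

/-- The linear function which agrees with `D` on the chamber in direction `w`. -/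
def rho (w : G) (v : V) : Λ := ∑ j, (if 0 < A.α j (w • A.o) then A.α j v else -A.α j v)

lemma perm' (w : G) (i : ι) :
    ∃ j, (∀ v, A.α j v = A.α i (w • v)) ∧ A.r j = w⁻¹ * A.r i * w := by
  obtain ⟨σ, hσ⟩ := A.perm w⁻¹
  refine ⟨σ i, fun v => ?_, by simpa using (hσ i).2⟩
  have := (hσ i).1 (w • v)
  simpa using this

lemma neg (i : ι) : ∃ j, (∀ v, A.α j v = -A.α i v) ∧ A.r j = A.r i := by
  obtain ⟨j, hj, hjr⟩ := A.perm' (A.r i) i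
  exact ⟨j, fun v => by rw [hj, A.refl_neg], by simpa using hjr⟩

lemma ne' (w : G) (i : ι) : A.α i (w • A.o) ≠ 0 := by
  obtain ⟨j, hj, -⟩ := A.perm' w i
  rw [← hj]
  exact A.ne j

lemma zero_mem_C (w : G) : (0 : V) ∈ A.C w := fun i _ => by simp

lemma smul_mem_C (u w : G) (v : V) : u • v ∈ A.C (u * w) ↔ v ∈ A.C w := by
  obtain ⟨σ, hσ⟩ := A.perm u
  constructor
  · intro h i hi
    have := h (σ i)
    rw [mul_smul, (hσ i).1, (hσ i).1] at this
    exact this hi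
  · intro h i hi
    obtain ⟨j, rfl⟩ := σ.surjective i
    rw [mul_smul, (hσ j).1] at hi
    rw [(hσ j).1]
    exact h j hi

lemma D_smul (u : G) (v : V) : A.D (u • v) = A.D v := by
  obtain ⟨σ, hσ⟩ := A.perm u
  unfold D
  rw [← Equiv.sum_comp σ]
  exact Finset.sum_congr rfl fun i _ => by rw [(hσ i).1]

lemma rho_smul (u w : G) (v : V) : A.rho (u * w) (u • v) = A.rho w v := by
  obtain ⟨σ, hσ⟩ := A.perm u
  unfold rho
  rw [← Equiv.sum_comp σ]
  exact Finset.sum_congr rfl fun i _ => by rw [mul_smul, (hσ i).1, (hσ i).1]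

lemma rho_add (w : G) (v v' : V) : A.rho w (v + v') = A.rho w v + A.rho w v' := by
  unfold rho
  rw [← Finset.sum_add_distrib]
  exact Finset.sum_congr rfl fun i _ => by split_ifs <;> simp [add_comm]

lemma rho_sub (w : G) (v v' : V) : A.rho w (v - v') = A.rho w v - A.rho w v' := by
  rw [eq_sub_iff_add_eq, ← rho_add, sub_add_cancel]

variable [IsOrderedAddMonoid Λ]

lemma add_mem_C {w : G} {v v' : V} (h : v ∈ A.C w) (h' : v' ∈ A.C w) : v + v' ∈ A.C w :=
  fun i hi => by rw [map_add]; exact add_nonneg (h i hi) (h' i hi)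

lemma sub_mem_C_trans {w : G} {a b c : V} (h : a - b ∈ A.C w) (h' : b - c ∈ A.C w) :
    a - c ∈ A.C w := by
  simpa using A.add_mem_C h h'

lemma nonpos_of_mem_C {w : G} {v : V} (h : v ∈ A.C w) {i : ι} (hi : ¬ 0 < A.α i (w • A.o)) :
    A.α i v ≤ 0 := by
  obtain ⟨j, hj, -⟩ := A.neg i
  have h1 := A.ne' w i
  have h2 : 0 < A.α j (w • A.o) := by
    rw [hj]; exact neg_pos.2 (lt_of_le_of_ne (not_lt.1 hi) h1)
  have := h j h2
  rw [hj] at this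
  exact neg_nonneg.1 this

lemma D_eq_rho {w : G} {v : V} (h : v ∈ A.C w) : A.D v = A.rho w v := by
  refine Finset.sum_congr rfl fun i _ => ?_
  split_ifs with hi
  · exact abs_of_nonneg (h i hi)
  · exact abs_of_nonpos (A.nonpos_of_mem_C h hi)

lemma D_add_of_mem_C {w : G} {v v' : V} (h : v ∈ A.C w) (h' : v' ∈ A.C w) :
    A.D (v + v') = A.D v + A.D v' := by
  rw [A.D_eq_rho h, A.D_eq_rho h', A.D_eq_rho (A.add_mem_C h h'), rho_add]

lemma D_neg (v : V) : A.D (-v) = A.D v := by simp [D]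

lemma D_sub_comm (a b : V) : A.D (a - b) = A.D (b - a) := by rw [← D_neg, neg_sub]

lemma D_nonneg (v : V) : 0 ≤ A.D v := Finset.sum_nonneg fun _ _ => abs_nonneg _

lemma abs_le_D (i : ι) (v : V) : |A.α i v| ≤ A.D v :=
  Finset.single_le_sum (f := fun i => |A.α i v|) (fun _ _ => abs_nonneg _) (Finset.mem_univ i)

lemma le_D (i : ι) (v : V) : A.α i v ≤ A.D v := (le_abs_self _).trans (A.abs_le_D i v)

lemma self_mem_C (w : G) : w • A.o ∈ A.C w := fun _ hi => hi.le

lemma dir_ext {w v : G} (h : ∀ i, 0 < A.α i (v • A.o) → 0 < A.α i (w • A.o)) : w = v := by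
  have : v⁻¹ * w = 1 := by
    refine A.free _ fun i hi => ?_
    obtain ⟨σ, hσ⟩ := A.perm v
    have h1 := h (σ i)
    rw [(hσ i).1] at h1
    have h2 := h1 hi
    have h3 := (hσ i).1 (v⁻¹ • w • A.o)
    rw [smul_inv_smul] at h3
    rw [mul_smul, ← h3]
    exact h2
  exact (inv_mul_eq_one.1 this).symm

/-- Points far inside the chamber in direction `w`. -/
lemma exists_deep (w : G) (κ : Λ) :
    ∃ v, v ∈ A.C w ∧ ∀ i, 0 < A.α i (w • A.o) → κ < A.α i v := by
  obtain ⟨v, hv⟩ := A.deep |κ|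
  have key : ∀ i, 0 < A.α i (w • A.o) → κ < A.α i (w • (v + A.o)) := by
    intro i hi
    obtain ⟨j, hj, -⟩ := A.perm' w i
    rw [← hj] at hi ⊢
    rw [map_add]
    exact lt_of_le_of_lt ((le_abs_self κ).trans (hv j hi)) (lt_add_of_pos_right _ hi)
  have key0 : ∀ i, 0 < A.α i (w • A.o) → 0 ≤ A.α i (w • (v + A.o)) := by
    intro i hi
    obtain ⟨j, hj, -⟩ := A.perm' w i
    rw [← hj] at hi ⊢
    rw [map_add]
    exact add_nonneg ((abs_nonneg κ).trans (hv j hi)) hi.le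
  exact ⟨w • (v + A.o), key0, key⟩

lemma exists_ge (w : G) (a b : V) : ∃ c, c - a ∈ A.C w ∧ c - b ∈ A.C w := by
  obtain ⟨v, -, hv⟩ := A.exists_deep w (A.D a + A.D b)
  refine ⟨v, fun i hi => ?_, fun i hi => ?_⟩ <;> rw [map_sub, sub_nonneg] <;>
    refine le_trans ?_ (hv i hi).le
  · exact (A.le_D i a).trans (le_add_of_nonneg_right (A.D_nonneg b))
  · exact (A.le_D i b).trans (le_add_of_nonneg_left (A.D_nonneg a))

lemma exists_ge₃ (w : G) (a b c : V) :
    ∃ d, d - a ∈ A.C w ∧ d - b ∈ A.C w ∧ d - c ∈ A.C w := by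
  obtain ⟨e, h1, h2⟩ := A.exists_ge w a b
  obtain ⟨d, h3, h4⟩ := A.exists_ge w e c
  exact ⟨d, A.sub_mem_C_trans h3 h1, A.sub_mem_C_trans h3 h2, h4⟩

/-- Deep inside the cone, a coroot that is negative on its direction falls below any bound. Applied
to the half-spaces of (A2), this turns convexity into information about directions. -/
lemma pos_of_cone_subset {w : G} {p : V} {i : ι} {k : Λ}
    (h : ∀ x, x - p ∈ A.C w → k ≤ A.α i x) : 0 < A.α i (w • A.o) := by
  by_contra hi
  obtain ⟨j, hj, -⟩ := A.neg i
  have h2 : 0 < A.α j (w • A.o) := by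
    rw [hj]; exact neg_pos.2 (lt_of_le_of_ne (not_lt.1 hi) (A.ne' w i))
  obtain ⟨v, hv, hv'⟩ := A.exists_deep w (A.α i p - k)
  have h3 := h (p + v) (by simpa using hv)
  have h4 := hv' j h2
  rw [hj] at h4
  rw [map_add] at h3
  have h5 : A.α i v < k - A.α i p := by simpa using neg_lt_neg h4
  have h6 : A.α i p + A.α i v < k := by simpa using add_lt_add_right h5 (A.α i p)
  exact absurd h3 (not_le.2 h6)

lemma eq_of_cone_subset {w v : G} {p q : V} (h : ∀ x, x - p ∈ A.C w → x - q ∈ A.C v) :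
    w = v := by
  refine A.dir_ext fun i hi => A.pos_of_cone_subset (p := p) (k := A.α i q) fun x hx => ?_
  have := h x hx i hi
  rwa [map_sub, sub_nonneg] at this

lemma eq_one_of_fix {u w : G} (h : u • w • A.o = w • A.o) : u = 1 := by
  have : u * w = w := A.dir_ext fun i hi => by rwa [mul_smul, h]
  simpa using this

/-- A vector which is regular in direction `w` is fixed by no nontrivial element. -/
lemma eq_one_of_fix' {u w : G} {v : V} (hv : ∀ i, 0 < A.α i (w • A.o) → 0 < A.α i v)
    (h : u • v = v) : u = 1 := by
  have hvC : v ∈ A.C w := fun i hi => (hv i hi).le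
  have : w = u * w := A.dir_ext fun i hi => by
    by_contra hi'
    have h1 : v ∈ A.C (u * w) := by rw [← h]; exact (A.smul_mem_C u w v).2 hvC
    have h2 := h1 i hi
    have h3 := A.nonpos_of_mem_C hvC hi'
    obtain ⟨j, hj, -⟩ := A.neg i
    have h4 : 0 < A.α j (w • A.o) := by
      rw [hj]; exact neg_pos.2 (lt_of_le_of_ne (not_lt.1 hi') (A.ne' w i))
    have h5 := hv j h4
    rw [hj] at h5
    exact absurd h2 (not_le.2 (neg_pos.1 h5))
  simpa using this.symm

lemma pos_or_of_ne_pos {w : G} {i : ι} (h : ¬ 0 < A.α i (w • A.o)) : A.α i (w • A.o) < 0 :=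
  lt_of_le_of_ne (not_lt.1 h) (A.ne' w i)

lemma exists_neg_pos {w : G} {i : ι} (h : ¬ 0 < A.α i (w • A.o)) :
    ∃ j, (∀ v, A.α j v = -A.α i v) ∧ 0 < A.α j (w • A.o) := by
  obtain ⟨j, hj, -⟩ := A.neg i
  exact ⟨j, hj, by rw [hj]; exact neg_pos.2 (A.pos_or_of_ne_pos h)⟩

lemma refl_inv (i : ι) : (A.r i)⁻¹ = A.r i := inv_eq_of_mul_eq_one_left (A.refl_sq i)

lemma refl_ne_one (i : ι) : A.r i ≠ 1 := by
  intro h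
  have := A.refl_neg i A.o
  rw [h, one_smul] at this
  exact A.ne i (self_eq_neg.1 this)

lemma refl_smul_smul (i : ι) (v : V) : A.r i • A.r i • v = v := by
  rw [smul_smul, A.refl_sq, one_smul]

/-- If a wall crossing leads towards `d`, it does not leave a half-space containing `d`. -/
lemma cross_stays {w d : G} {k i : ι} (hk : A.IsSimple k) (hw : 0 < A.α i (w • A.o))
    (hd : 0 < A.α i (d • A.o)) (hkd : A.α k ((w⁻¹ * d) • A.o) < 0) :
    0 < A.α i ((w * A.r k) • A.o) := by
  obtain ⟨j, hj, hjr⟩ := A.perm' w i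
  rw [← hj] at hw
  rw [mul_smul, ← hj]
  refine hk.2 j hw fun hr => ?_
  obtain ⟨e, he⟩ := A.parallel j k hr hw hk.1
  have h1 : A.α j ((w⁻¹ * d) • A.o) = A.α i (d • A.o) := by rw [hj, smul_smul]; simp
  rw [he, h1] at hkd
  have h2 : e (A.α i (d • A.o)) < e 0 := by simpa using hkd
  exact absurd hd (not_lt.2 ((map_lt_map_iff e).1 h2).le)

/-- Induction on the number of positive coroots that are negative at `w • A.o`, that is, on the
distance from `w` to the fundamental chamber. -/
lemma gallery_induction (w : G) {Q : G → Prop} (one : Q 1)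
    (step : ∀ w k, A.IsSimple k → A.α k (w • A.o) < 0 → Q (A.r k * w) → Q w) : Q w := by
  classical
  let N : G → Finset ι := fun w => Finset.univ.filter fun i => 0 < A.α i A.o ∧ A.α i (w • A.o) < 0
  induction hn : (N w).card using Nat.strong_induction_on generalizing w with
  | _ n ih =>
    by_cases hw : w = 1
    · rwa [hw]
    obtain ⟨k, hk1, hk2, hk3⟩ := A.simple w hw
    refine step w k ⟨hk1, hk2⟩ hk3 (ih _ ?_ _ rfl)
    rw [← hn]
    obtain ⟨σ, hσ⟩ := A.perm (A.r k)
    -- The permutation induced by `A.r k` injects the separating coroots of `A.r k * w` into those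
    -- of `w`, and it misses `k`.
    have hrel : ∀ i, i ∈ N (A.r k * w) → σ i ∈ (N w).erase k := by
      intro i hi
      simp only [N, Finset.mem_filter, Finset.mem_univ, true_and] at hi
      obtain ⟨hi1, hi2⟩ := hi
      have hlow : A.α (σ i) (w • A.o) < 0 := by
        have := (hσ i).1 (A.r k • w • A.o)
        rw [A.refl_smul_smul] at this
        rw [this, ← mul_smul]
        exact hi2
      have hne : A.r i ≠ A.r k := by
        intro hr
        obtain ⟨e, he⟩ := A.parallel k i hr.symm hk1 hi1
        rw [he, mul_smul, A.refl_neg] at hi2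
        have h2 : e (-A.α k (w • A.o)) < e 0 := by simpa using hi2
        have := (map_lt_map_iff e).1 h2
        exact absurd hk3 (not_lt.2 (neg_neg_iff_pos.1 this).le)
      have hpos : 0 < A.α (σ i) A.o := by
        have := (hσ i).1 (A.r k • A.o)
        rw [A.refl_smul_smul] at this
        rw [this]
        exact hk2 i hi1 hne
      refine Finset.mem_erase.2 ⟨?_, by simp [N, hpos, hlow]⟩
      intro hik
      have := (hσ i).2
      rw [hik, eq_mul_inv_iff_mul_eq] at this
      exact hne (mul_left_cancel this).symm
    calc (N (A.r k * w)).card ≤ ((N w).erase k).card :=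
          Finset.card_le_card_of_injOn σ hrel σ.injective.injOn
      _ < (N w).card := Finset.card_erase_lt_of_mem (by simp [N, hk1, hk3])

/-- The longest element of the Weyl group. -/
lemma exists_longest : ∃ w₀ : G, ∀ i, 0 < A.α i A.o → A.α i (w₀ • A.o) < 0 := by
  obtain ⟨w, hw⟩ := A.cover (-A.o)
  refine ⟨w, fun i hi => lt_of_le_of_ne ?_ (A.ne' w i)⟩
  simpa using hw i hi

/-- The longest element of the Weyl group. -/
noncomputable def w₀ : G := A.exists_longest.choose

lemma w₀_neg {i : ι} (h : 0 < A.α i A.o) : A.α i (A.w₀ • A.o) < 0 :=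
  A.exists_longest.choose_spec i h

lemma pos_mul_w₀ (w : G) (i : ι) : 0 < A.α i ((w * A.w₀) • A.o) ↔ A.α i (w • A.o) < 0 := by
  have key : ∀ i, 0 < A.α i (w • A.o) → A.α i ((w * A.w₀) • A.o) < 0 := by
    intro i hi
    obtain ⟨j, hj, -⟩ := A.perm' w i
    rw [mul_smul, ← hj]
    rw [← hj] at hi
    exact A.w₀_neg hi
  constructor
  · intro h
    by_contra h'
    exact lt_asymm h (key i (lt_of_le_of_ne (not_lt.1 h') (A.ne' w i).symm))
  · intro h
    obtain ⟨j, hj, hj'⟩ := A.exists_neg_pos (not_lt.2 h.le)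
    have := key j hj'
    rw [hj] at this
    exact neg_lt_zero.1 this

lemma w₀_sq : A.w₀ * A.w₀ = 1 := by
  refine A.free _ fun i hi => ?_
  rw [pos_mul_w₀]
  exact A.w₀_neg hi

lemma neg_mem_C_mul_w₀ (w : G) (v : V) : -v ∈ A.C (w * A.w₀) ↔ v ∈ A.C w := by
  constructor
  · intro h i hi
    obtain ⟨j, hj, -⟩ := A.neg i
    have := h j (by rw [pos_mul_w₀, hj]; exact neg_lt_zero.2 hi)
    simpa [hj] using this
  · intro h i hi
    rw [pos_mul_w₀] at hi
    have := A.nonpos_of_mem_C h (not_lt.2 hi.le)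
    simpa using this

lemma exists_mem_C (v : V) : ∃ w : G, v ∈ A.C w := by
  obtain ⟨w, hw⟩ := A.cover v
  refine ⟨w⁻¹, ?_⟩
  rw [← A.smul_mem_C w, mul_inv_cancel]
  exact fun i hi => hw i (by simpa using hi)

/-- Conjugation by the longest element permutes the simple reflections. -/
lemma exists_simple_conj {i : ι} (h : A.IsSimple i) :
    ∃ j, A.IsSimple j ∧ A.r j = A.w₀ * A.r i * A.w₀ := by
  have hinv : A.w₀⁻¹ = A.w₀ := inv_eq_of_mul_eq_one_left A.w₀_sq
  have flip : ∀ i, 0 < A.α i A.o → ∃ j, (∀ v, A.α j v = -A.α i (A.w₀ • v)) ∧ 0 < A.α j A.o ∧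
      A.r j = A.w₀ * A.r i * A.w₀ := by
    intro i hi
    obtain ⟨k, hk, hkr⟩ := A.perm' A.w₀ i
    obtain ⟨j, hj, hjr⟩ := A.neg k
    refine ⟨j, fun v => by rw [hj, hk], ?_, by rw [hjr, hkr, hinv]⟩
    rw [hj, hk]
    exact neg_pos.2 (A.w₀_neg hi)
  obtain ⟨j, hj, hjpos, hjr⟩ := flip i h.1
  refine ⟨j, ⟨hjpos, fun l hl hlj => ?_⟩, hjr⟩
  obtain ⟨l', hl', hl'pos, hl'r⟩ := flip l hl
  have h1 : A.r l' ≠ A.r i := by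
    intro h2
    apply hlj
    rw [hjr, ← h2, hl'r]
    simp only [mul_assoc, A.w₀_sq, mul_one]
    simp only [← mul_assoc, A.w₀_sq, one_mul]
  have h2 := h.2 l' hl'pos h1
  have h3 := hl' (A.r i • A.w₀ • A.o)
  have h4 : A.α l' ((A.r i * A.w₀) • A.o) < 0 :=
    A.pos_or_of_ne_pos fun h5 => lt_asymm h2 ((A.pos_mul_w₀ _ _).1 h5)
  rw [hjr, mul_smul, mul_smul, ← neg_neg (A.α l _), ← h3, ← mul_smul]
  exact neg_pos.2 h4

end ApartmentModel
end GenAffineBuilding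

/-! ### Sectors, ends and overlaps of charts -/

namespace GenAffineBuilding

set_option linter.unusedSectionVars false

open Set

variable {G ι V Λ X : Type*} [Group G] [AddCommGroup V] [DistribMulAction G V]
    [AddCommGroup Λ] [LinearOrder Λ] [Fintype ι]

/-- The sector based at `p` in direction `w`. -/
def ApartmentModel.sector (A : ApartmentModel G ι V Λ) (p : V) (w : G) : Set V :=
  {x | x - p ∈ A.C w}

lemma mem_sector {A : ApartmentModel G ι V Λ} {p x : V} {w : G} : x ∈ A.sector p w ↔ x - p ∈ A.C w := Iff.rfl

/-- A generalized affine building, in terms of an abstract model of its apartments. -/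
structure Building (A : ApartmentModel G ι V Λ) (T : AddSubgroup V) (𝒜 : Set (V → X))
    (d : X → X → Λ) : Prop where
  inj : ∀ f ∈ 𝒜, Function.Injective f
  comp : ∀ f ∈ 𝒜, ∀ (w : G), ∀ t ∈ T, (fun x => f (w • x + t)) ∈ 𝒜
  compat : ∀ f ∈ 𝒜, ∀ g ∈ 𝒜, (range f ∩ range g).Nonempty →
    (∃ s : Set (ι × Λ), s.Finite ∧ f ⁻¹' range g = {x | ∀ p ∈ s, p.2 ≤ A.α p.1 x}) ∧
    ∃ w : G, ∃ t ∈ T, ∀ x, f x ∈ range g → f x = g (w • x + t)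
  exists_chart : ∀ x y, ∃ f ∈ 𝒜, x ∈ range f ∧ y ∈ range f
  exists_chart_sectors : ∀ f ∈ 𝒜, ∀ g ∈ 𝒜, ∀ p q w v, ∃ h ∈ 𝒜, ∃ p' w' q' v',
    h '' A.sector p' w' ⊆ f '' A.sector p w ∧ h '' A.sector q' v' ⊆ g '' A.sector q v
  dist : ∀ f ∈ 𝒜, ∀ a b, d (f a) (f b) = A.D (b - a)
  triangle : ∀ x y z, d x z ≤ d x y + d y z
  inter : ∀ f ∈ 𝒜, ∀ g ∈ 𝒜, ∀ h ∈ 𝒜, ∀ i j l k₁ k₂ k₃,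
    f ⁻¹' range g = {x | k₁ ≤ A.α i x} → g ⁻¹' range h = {x | k₂ ≤ A.α j x} →
    f ⁻¹' range h = {x | k₃ ≤ A.α l x} → (range f ∩ range g ∩ range h).Nonempty

/-- `S` is a sector of `X`. -/
def IsSector (A : ApartmentModel G ι V Λ) (𝒜 : Set (V → X)) (S : Set X) : Prop :=
  ∃ f ∈ 𝒜, ∃ p w, S = f '' A.sector p w

/-- The chart `f` has the end of the sector `S` in direction `w`. -/
def Has (A : ApartmentModel G ι V Λ) (f : V → X) (w : G) (S : Set X) : Prop :=
  ∃ p, ∀ x ∈ A.sector p w, f x ∈ S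

/-- The charts `f` and `g` agree on a sector in direction `w`. -/
def Agree (A : ApartmentModel G ι V Λ) (f g : V → X) (w : G) : Prop :=
  ∃ p, ∀ x ∈ A.sector p w, f x = g x

/-- The sector of the chart `f` in direction `w` based at the origin. -/
def sectorOf (A : ApartmentModel G ι V Λ) (f : V → X) (w : G) : Set X := f '' A.sector 0 w

section

variable [IsOrderedAddMonoid Λ] {A : ApartmentModel G ι V Λ}

lemma self_mem_sector (p : V) (w : G) : p ∈ A.sector p w := by
  rw [mem_sector, sub_self]; exact A.zero_mem_C w

lemma sector_subset {p q : V} {w : G} (h : q ∈ A.sector p w) :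
    A.sector q w ⊆ A.sector p w := fun x (hx : x - q ∈ A.C w) => A.sub_mem_C_trans hx h

lemma exists_sector_subset_inter (p q : V) (w : G) :
    ∃ r, A.sector r w ⊆ A.sector p w ∩ A.sector q w := by
  obtain ⟨r, h1, h2⟩ := A.exists_ge w p q
  exact ⟨r, fun x hx => ⟨sector_subset (A := A) h1 hx, sector_subset (A := A) h2 hx⟩⟩

lemma affine_mem_sector {u w : G} {p x t : V} :
    u • x + t ∈ A.sector (u • p + t) (u * w) ↔ x ∈ A.sector p w := by
  rw [mem_sector, mem_sector, add_sub_add_right_eq_sub, ← smul_sub, A.smul_mem_C]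

lemma eq_of_sector_subset {w v : G} {p q : V} (h : A.sector p w ⊆ A.sector q v) : w = v :=
  A.eq_of_cone_subset h

lemma Agree.symm {f g : V → X} {w : G} (h : Agree A f g w) : Agree A g f w :=
  let ⟨p, hp⟩ := h; ⟨p, fun x hx => (hp x hx).symm⟩

lemma Agree.refl (f : V → X) (w : G) : Agree A f f w := ⟨0, fun _ _ => rfl⟩

lemma Agree.trans {f g h : V → X} {w : G} (h₁ : Agree A f g w) (h₂ : Agree A g h w) :
    Agree A f h w := by
  obtain ⟨p, hp⟩ := h₁
  obtain ⟨q, hq⟩ := h₂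
  obtain ⟨r, hr⟩ := exists_sector_subset_inter (A := A) p q w
  exact ⟨r, fun x hx => (hp x (hr hx).1).trans (hq x (hr hx).2)⟩

lemma Agree.has_iff {f g : V → X} {w : G} (h : Agree A f g w) {S : Set X} :
    Has A f w S ↔ Has A g w S := by
  have key : ∀ {f g : V → X}, Agree A f g w → Has A f w S → Has A g w S := by
    rintro f g ⟨p, hp⟩ ⟨q, hq⟩
    obtain ⟨r, hr⟩ := exists_sector_subset_inter (A := A) p q w
    exact ⟨r, fun x hx => by rw [← hp x (hr hx).1]; exact hq x (hr hx).2⟩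
  exact ⟨key h, key h.symm⟩

lemma has_sectorOf (f : V → X) (w : G) : Has A f w (sectorOf A f w) :=
  ⟨0, fun x hx => ⟨x, hx, rfl⟩⟩

lemma has_comp_iff {g : V → X} {u z : G} {t : V} {S : Set X} :
    Has A (fun x => g (u • x + t)) z S ↔ Has A g (u * z) S := by
  constructor
  · rintro ⟨p, hp⟩
    refine ⟨u • p + t, fun y hy => ?_⟩
    have hy' : y = u • (u⁻¹ • (y - t)) + t := by simp
    rw [hy'] at hy ⊢
    exact hp _ (affine_mem_sector.1 hy)
  · rintro ⟨p, hp⟩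
    refine ⟨u⁻¹ • (p - t), fun x hx => hp _ ?_⟩
    have : p = u • (u⁻¹ • (p - t)) + t := by simp
    rw [this]
    exact affine_mem_sector.2 hx

lemma range_comp_affine (g : V → X) (u : G) (t : V) :
    range (fun x => g (u • x + t)) = range g := by
  ext y
  constructor
  · rintro ⟨x, rfl⟩; exact ⟨_, rfl⟩
  · rintro ⟨x, rfl⟩; exact ⟨u⁻¹ • (x - t), by simp⟩

end

namespace Building

variable [IsOrderedAddMonoid Λ] {A : ApartmentModel G ι V Λ} {T : AddSubgroup V}
  {𝒜 : Set (V → X)} {d : X → X → Λ} (hB : Building A T 𝒜 d)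
include hB

lemma isSector_sectorOf {f : V → X} (hf : f ∈ 𝒜) (w : G) : IsSector A 𝒜 (sectorOf A f w) :=
  ⟨f, hf, 0, w, rfl⟩

/-- The transition map of (A2) fixes a whole sector pointwise. Its linear part therefore fixes a
regular vector and is trivial, and then its translation part vanishes too. -/
lemma agree_eq {f g : V → X} (hf : f ∈ 𝒜) (hg : g ∈ 𝒜) {w : G} (h : Agree A f g w) {x : V}
    (hx : f x ∈ range g) : f x = g x := by
  obtain ⟨p, hp⟩ := h
  obtain ⟨-, u, t, -, hu⟩ := hB.compat f hf g hg ⟨f x, ⟨x, rfl⟩, hx⟩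
  have key : ∀ y ∈ A.sector p w, u • y + t = y := by
    intro y hy
    refine hB.inj g hg ?_
    rw [← hu y ⟨y, (hp y hy).symm⟩, hp y hy]
  have h1 := key p (self_mem_sector p w)
  have h2 := key (p + w • A.o) (by rw [mem_sector, add_sub_cancel_left]; exact A.self_mem_C w)
  have h3 : u • w • A.o = w • A.o := by
    rw [smul_add] at h2
    have : u • p + u • w • A.o + t = (u • p + t) + u • w • A.o := by abel
    rw [this, h1] at h2
    exact add_left_cancel h2
  have hu1 := A.eq_one_of_fix h3
  subst hu1
  have ht : t = 0 := by simpa using h1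
  rw [hu x hx, ht]
  simp

lemma convex {f g : V → X} (hf : f ∈ 𝒜) (hg : g ∈ 𝒜) {x₀ : V} (hx : f x₀ ∈ range g) :
    ∃ s : Set (ι × Λ), s.Finite ∧ ∀ x, f x ∈ range g ↔ ∀ p ∈ s, p.2 ≤ A.α p.1 x := by
  obtain ⟨⟨s, hs, h⟩, -⟩ := hB.compat f hf g hg ⟨f x₀, ⟨x₀, rfl⟩, hx⟩
  refine ⟨s, hs, fun x => ?_⟩
  rw [Set.ext_iff] at h
  exact h x

/-- The intersection of two apartments contains with a point and a subsector also the
sector in this direction based at the point. -/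
lemma sector_subset_range {f g : V → X} (hf : f ∈ 𝒜) (hg : g ∈ 𝒜) {p q : V} {w : G}
    (hp : f p ∈ range g) (hq : ∀ x ∈ A.sector q w, f x ∈ range g) :
    ∀ x ∈ A.sector p w, f x ∈ range g := by
  obtain ⟨s, -, h⟩ := hB.convex hf hg hp
  intro x hx
  rw [h]
  intro e he
  -- Each half-space cutting out the overlap contains a sector in direction `w`, so its coroot can
  -- only grow along that direction.
  have hpos : 0 < A.α e.1 (w • A.o) :=
    A.pos_of_cone_subset (p := q) (k := e.2) fun y hy => (h y).1 (hq y hy) e he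
  have h1 := (h p).1 hp e he
  have h2 := hx e.1 hpos
  rw [map_sub, sub_nonneg] at h2
  exact h1.trans h2

lemma agree_eq_sector {f g : V → X} (hf : f ∈ 𝒜) (hg : g ∈ 𝒜) {w : G} (h : Agree A f g w) {p : V}
    (hp : f p ∈ range g) : ∀ x ∈ A.sector p w, f x = g x := by
  obtain ⟨q, hq⟩ := h
  exact fun x hx => hB.agree_eq hf hg ⟨q, hq⟩
    (hB.sector_subset_range hf hg hp (fun y hy => ⟨y, (hq y hy).symm⟩) x hx)

/-- Both charts are compared with the chart `h` that carries `S`. On a common subsector each is `h`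
composed with an affine map, so the two apartments overlap in a sector and (A2) applies to them
directly. The transition map sends `w` to `v` because a sector contains sectors of its own direction
only. -/
lemma has_has {S : Set X} (hS : IsSector A 𝒜 S) {f g : V → X} (hf : f ∈ 𝒜) (hg : g ∈ 𝒜) {w v : G}
    (hfS : Has A f w S) (hgS : Has A g v S) :
    ∃ u : G, ∃ t ∈ T, u * w = v ∧ (∀ x, f x ∈ range g → f x = g (u • x + t)) ∧
      ∃ p, ∀ x ∈ A.sector p w, f x ∈ range g := by
  obtain ⟨p, hp⟩ := id hfS
  obtain ⟨q, hq⟩ := id hgS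
  obtain ⟨h, hh, b, θ, rfl⟩ := id hS
  have aux : ∀ {f : V → X} {w : G} {p : V}, f ∈ 𝒜 → (∀ x ∈ A.sector p w, f x ∈ h '' A.sector b θ) →
      ∃ (u : G) (t : V), u * w = θ ∧ ∀ x ∈ A.sector p w, f x = h (u • x + t) := by
    intro f w p hf hp
    have hr : ∀ y ∈ h '' A.sector b θ, y ∈ range h := by rintro _ ⟨y, -, rfl⟩; exact ⟨y, rfl⟩
    obtain ⟨-, u, t, -, hu⟩ := hB.compat f hf h hh
      ⟨f p, ⟨p, rfl⟩, hr _ (hp p (self_mem_sector p w))⟩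
    refine ⟨u, t, ?_, fun x hx => hu x (hr _ (hp x hx))⟩
    refine eq_of_sector_subset (p := u • p + t) (q := b) (A := A) fun y hy => ?_
    have hy' : y = u • (u⁻¹ • (y - t)) + t := by simp
    rw [hy'] at hy ⊢
    have hx := affine_mem_sector.1 hy
    have h1 := hu _ (hr _ (hp _ hx))
    obtain ⟨z, hz, hz'⟩ := hp _ hx
    rw [h1] at hz'
    rwa [← hB.inj h hh hz']
  obtain ⟨u₁, t₁, hu₁, h₁⟩ := aux hf hp
  obtain ⟨u₂, t₂, hu₂, h₂⟩ := aux hg hq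
  obtain ⟨c, hc1, hc2⟩ := A.exists_ge θ (u₁ • p + t₁) (u₂ • q + t₂)
  -- on `c + C θ`, both charts are composites of `h`
  have key1 : ∀ y ∈ A.sector c θ, f (u₁⁻¹ • (y - t₁)) = h y := by
    intro y hy
    have : y = u₁ • (u₁⁻¹ • (y - t₁)) + t₁ := by simp
    rw [h₁]
    · rw [← this]
    · have hy' := sector_subset (A := A) hc1 hy
      rw [this, ← hu₁] at hy'
      exact affine_mem_sector.1 hy'
  have key2 : ∀ y ∈ A.sector c θ, g (u₂⁻¹ • (y - t₂)) = h y := by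
    intro y hy
    have : y = u₂ • (u₂⁻¹ • (y - t₂)) + t₂ := by simp
    rw [h₂]
    · rw [← this]
    · have hy' := sector_subset (A := A) hc2 hy
      rw [this, ← hu₂] at hy'
      exact affine_mem_sector.1 hy'
  have hrange : ∀ x ∈ A.sector (u₁⁻¹ • (c - t₁)) w, u₁ • x + t₁ ∈ A.sector c θ := by
    intro x hx
    have : c = u₁ • (u₁⁻¹ • (c - t₁)) + t₁ := by simp
    rw [this, ← hu₁]
    exact affine_mem_sector.2 hx
  have hfg : ∀ x ∈ A.sector (u₁⁻¹ • (c - t₁)) w, f x = g (u₂⁻¹ • (u₁ • x + t₁ - t₂)) := by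
    intro x hx
    rw [key2 _ (hrange x hx), ← key1 _ (hrange x hx)]
    simp
  obtain ⟨-, u, t, ht, hu⟩ := hB.compat f hf g hg
    ⟨_, ⟨_, rfl⟩, ⟨_, (hfg _ (self_mem_sector _ w)).symm⟩⟩
  refine ⟨u, t, ht, ?_, hu, _, fun x hx => ⟨_, (hfg x hx).symm⟩⟩
  refine eq_of_sector_subset (p := u • (u₁⁻¹ • (c - t₁)) + t) (q := q) (A := A) fun y hy => ?_
  have hy' : y = u • (u⁻¹ • (y - t)) + t := by simp
  rw [hy'] at hy ⊢
  have hx := affine_mem_sector.1 hy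
  have h1 := hfg _ hx
  rw [hu _ ⟨_, h1.symm⟩] at h1
  rw [hB.inj g hg h1]
  have hz := sector_subset (A := A) hc2 (hrange _ hx)
  set z := u₁ • u⁻¹ • (y - t) + t₁
  have : z = u₂ • (u₂⁻¹ • (z - t₂)) + t₂ := by simp
  rw [this, ← hu₂] at hz
  exact affine_mem_sector.1 hz

lemma has_unique {S : Set X} (hS : IsSector A 𝒜 S) {f : V → X} (hf : f ∈ 𝒜) {w v : G}
    (h : Has A f w S) (h' : Has A f v S) : w = v := by
  obtain ⟨u, t, -, huv, hu, p, -⟩ := hB.has_has hS hf hf h h'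
  have key : ∀ x, x = u • x + t := fun x => hB.inj f hf (hu x ⟨x, rfl⟩)
  have ht : t = 0 := by simpa using (key 0).symm
  have h1 : u • w • A.o = w • A.o := by simpa [ht] using (key (w • A.o)).symm
  rw [← huv, A.eq_one_of_fix h1, one_mul]

/-- Two charts with a common end can be matched along it. -/
lemma exists_agree {S : Set X} (hS : IsSector A 𝒜 S) {f g : V → X} (hf : f ∈ 𝒜) (hg : g ∈ 𝒜)
    {w v : G} (hfS : Has A f w S) (hgS : Has A g v S) :
    ∃ u : G, ∃ t ∈ T, u * w = v ∧ Agree A f (fun x => g (u • x + t)) w := by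
  obtain ⟨u, t, ht, huv, hu, p, hp⟩ := hB.has_has hS hf hg hfS hgS
  exact ⟨u, t, ht, huv, p, fun x hx => hu x (hp x hx)⟩

/-- Two charts with two common ends which agree along one of them also agree along the other. -/
lemma agree_of_has {S : Set X} (hS : IsSector A 𝒜 S) {f g : V → X} (hf : f ∈ 𝒜) (hg : g ∈ 𝒜)
    {w v z : G} (hfS : Has A f w S) (hgS : Has A g v S) (h : Agree A f g z) :
    Agree A f g w := by
  obtain ⟨u, t, ht, huv, hu, p, hp⟩ := hB.has_has hS hf hg hfS hgS
  exact ⟨p, fun x hx => hB.agree_eq hf hg h (hp x hx)⟩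

end Building
end GenAffineBuilding

/-! ### The Weyl distance between ends -/

namespace GenAffineBuilding

set_option linter.unusedSectionVars false

open Set

variable {G ι V Λ X : Type*} [Group G] [AddCommGroup V] [DistribMulAction G V]
    [AddCommGroup Λ] [LinearOrder Λ] [Fintype ι] [IsOrderedAddMonoid Λ]
    {A : ApartmentModel G ι V Λ} {T : AddSubgroup V} {𝒜 : Set (V → X)} {d : X → X → Λ}

/-- The Weyl-group-valued distance between the ends of two sectors is `w`. -/
def Rel (A : ApartmentModel G ι V Λ) (𝒜 : Set (V → X)) (S S' : Set X) (w : G) : Prop :=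
  ∃ f ∈ 𝒜, Has A f 1 S ∧ Has A f w S'

namespace Building

variable (hB : Building A T 𝒜 d)
include hB

lemma rel_of {f : V → X} (hf : f ∈ 𝒜) {v w : G} {S S' : Set X} (h : Has A f v S)
    (h' : Has A f w S') : Rel A 𝒜 S S' (v⁻¹ * w) := by
  refine ⟨_, hB.comp f hf v 0 T.zero_mem, ?_, ?_⟩
  · rw [has_comp_iff, mul_one]; exact h
  · rw [has_comp_iff, mul_inv_cancel_left]; exact h'

lemma rel_of' {f : V → X} (hf : f ∈ 𝒜) {v w z : G} {S S' : Set X} (h : Has A f v S)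
    (h' : Has A f w S') (hz : v⁻¹ * w = z) : Rel A 𝒜 S S' z := hz ▸ hB.rel_of hf h h'

lemma rel_symm {S S' : Set X} {w : G} (h : Rel A 𝒜 S S' w) : Rel A 𝒜 S' S w⁻¹ := by
  obtain ⟨f, hf, h1, h2⟩ := h
  simpa using hB.rel_of hf h2 h1

lemma rel_extend {S S' : Set X} (hS : IsSector A 𝒜 S) {w v : G} (h : Rel A 𝒜 S S' w)
    {f : V → X} (hf : f ∈ 𝒜) (hfS : Has A f v S) :
    ∃ g ∈ 𝒜, Agree A f g v ∧ Has A g (v * w) S' := by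
  obtain ⟨g, hg, h1, h2⟩ := h
  obtain ⟨u, t, ht, huv, hag⟩ := hB.exists_agree hS hf hg hfS h1
  refine ⟨_, hB.comp g hg u t ht, hag, ?_⟩
  rwa [has_comp_iff, ← mul_assoc, huv, one_mul]

lemma eq_of_agree {S : Set X} (hS : IsSector A 𝒜 S) {f g : V → X} (hf : f ∈ 𝒜) (hg : g ∈ 𝒜)
    {w v z : G} (hfS : Has A f w S) (hgS : Has A g v S) (h : Agree A f g z) : w = v := by
  obtain ⟨u, t, ht, huv, hu, p, hp⟩ := hB.has_has hS hf hg hfS hgS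
  have hag : Agree A f g w := ⟨p, fun x hx => hB.agree_eq hf hg h (hp x hx)⟩
  exact hB.has_unique hS hg (hag.has_iff.1 hfS) hgS

/-- A second chart can be moved so that it agrees with the first along `S`; then both see `S'` in
the same direction. -/
lemma rel_unique {S S' : Set X} (hS : IsSector A 𝒜 S) (hS' : IsSector A 𝒜 S') {w v : G}
    (h : Rel A 𝒜 S S' w) (h' : Rel A 𝒜 S S' v) : w = v := by
  obtain ⟨f, hf, h1, h2⟩ := h
  obtain ⟨g, hg, hag, h3⟩ := hB.rel_extend hS h' hf h1
  rw [one_mul] at h3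
  exact hB.eq_of_agree hS' hf hg h2 h3 hag

lemma has_of_rel_one {S S' : Set X} (hS : IsSector A 𝒜 S) (h : Rel A 𝒜 S S' 1)
    {f : V → X} (hf : f ∈ 𝒜) {v : G} (hfS : Has A f v S) : Has A f v S' := by
  obtain ⟨g, hg, hag, h1⟩ := hB.rel_extend hS h hf hfS
  rw [mul_one] at h1
  exact hag.has_iff.2 h1

lemma rel_congr_left {S₁ S₂ S : Set X} (hS₁ : IsSector A 𝒜 S₁) {g : V → X} (hg : g ∈ 𝒜) {v w : G}
    (h₁ : Has A g v S₁) (h₂ : Has A g v S₂) (h : Rel A 𝒜 S₁ S w) : Rel A 𝒜 S₂ S w := by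
  obtain ⟨g', hg', hag, h3⟩ := hB.rel_extend hS₁ h hg h₁
  simpa using hB.rel_of hg' (hag.has_iff.1 h₂) h3

lemma exists_rel {S S' : Set X} (hS : IsSector A 𝒜 S) (hS' : IsSector A 𝒜 S') :
    ∃ w, Rel A 𝒜 S S' w := by
  obtain ⟨f, hf, p, w, rfl⟩ := hS
  obtain ⟨g, hg, q, v, rfl⟩ := hS'
  obtain ⟨h, hh, p', w', q', v', h1, h2⟩ := hB.exists_chart_sectors f hf g hg p q w v
  exact ⟨_, hB.rel_of hh (v := w') (w := v') ⟨p', fun x hx => h1 ⟨x, hx, rfl⟩⟩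
    ⟨q', fun x hx => h2 ⟨x, hx, rfl⟩⟩⟩

/-- The distances from two adjacent ends to a third one differ by at most the simple reflection. -/
lemma rel_step {S₁ S₂ S : Set X} (hS₁ : IsSector A 𝒜 S₁) (hS₂ : IsSector A 𝒜 S₂)
    (hS : IsSector A 𝒜 S) {e : ι} (he : A.IsSimple e) {w₁ w₂ : G}
    (h₁₂ : Rel A 𝒜 S₁ S₂ (A.r e)) (h₁ : Rel A 𝒜 S₁ S w₁) (h₂ : Rel A 𝒜 S₂ S w₂) :
    w₂ = w₁ ∨ w₂ = A.r e * w₁ := by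
  obtain ⟨f, hf, hf1, hf2⟩ := h₁₂
  obtain ⟨g₁, hg₁, hag₁, hgS₁⟩ := hB.rel_extend hS₁ h₁ hf hf1
  obtain ⟨g₂, hg₂, hag₂, hgS₂⟩ := hB.rel_extend hS₂ h₂ hf hf2
  rw [one_mul] at hgS₁
  obtain ⟨u, t, ht, huw, hu, p, hp⟩ := hB.has_has hS hg₁ hg₂ hgS₁ hgS₂
  obtain ⟨k₁, hk₁⟩ := hag₁
  obtain ⟨k₂, hk₂⟩ := hag₂
  -- Up to constants, the distance to a far point of `S` is `-A.rho w₁ v` when measured in `g₁` from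
  -- `f (v + k₁)`, and `-A.rho (u * w₁) v` when measured in `g₂` from `f (v + k₂)`. For `v` in the
  -- panel these two points stay at the fixed distance `A.D (k₂ - k₁)`, so the triangle inequality
  -- bounds the difference of the two functions.
  have key : u * w₁ = w₁ ∨ u * w₁ = A.r e * w₁ := by
    refine A.panel e he.1 he.2 w₁ (u * w₁)
      ⟨A.D (k₂ - k₁) + |A.rho w₁ k₁ - A.rho w₁ (u⁻¹ • (k₂ - t))|, fun v hv hv' => ?_⟩
    change |A.rho (u * w₁) v - A.rho w₁ v| ≤ _
    -- The point `η` is far enough out to lie in the overlap of `g₁` and `g₂`, and ahead of both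
    -- points in direction `w₁`, where `A.D` coincides with the linear function `A.rho w₁`.
    obtain ⟨η, h1, h2, h3⟩ := A.exists_ge₃ w₁ p (v + k₁) (u⁻¹ • (v + k₂ - t))
    have hg1 : f (v + k₁) = g₁ (v + k₁) := hk₁ _ (by
      rw [mem_sector, add_sub_cancel_right]
      intro i hi; rw [one_smul] at hi; exact hv i hi)
    have hg2 : f (v + k₂) = g₂ (v + k₂) := hk₂ _ (by
      rw [mem_sector, add_sub_cancel_right]; exact hv')
    have hη : g₁ η = g₂ (u • η + t) := hu _ (hp _ h1)
    have d0 : d (f (v + k₁)) (f (v + k₂)) = A.D (k₂ - k₁) := by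
      rw [hB.dist f hf]; congr 1; abel
    have d0' : d (f (v + k₂)) (f (v + k₁)) = A.D (k₂ - k₁) := by
      rw [hB.dist f hf, A.D_sub_comm]; congr 1; abel
    have d1 : d (f (v + k₁)) (g₁ η) = A.rho w₁ η - A.rho w₁ v - A.rho w₁ k₁ := by
      rw [hg1, hB.dist g₁ hg₁, A.D_eq_rho h2, A.rho_sub, A.rho_add]; abel
    have d2 : d (f (v + k₂)) (g₁ η) =
        A.rho w₁ η - A.rho (u * w₁) v - A.rho w₁ (u⁻¹ • (k₂ - t)) := by
      have : u • η + t - (v + k₂) = u • (η - u⁻¹ • (v + k₂ - t)) := by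
        rw [smul_sub, smul_inv_smul]; abel
      rw [hg2, hη, hB.dist g₂ hg₂, this, A.D_smul, A.D_eq_rho h3, A.rho_sub]
      have h4 : u⁻¹ • (v + k₂ - t) = u⁻¹ • v + u⁻¹ • (k₂ - t) := by
        rw [← smul_add, add_sub_assoc]
      have h5 : A.rho (u * w₁) v = A.rho w₁ (u⁻¹ • v) := by
        rw [← A.rho_smul u w₁ (u⁻¹ • v), smul_inv_smul]
      rw [h4, A.rho_add, h5]; abel
    have t1 := hB.triangle (f (v + k₁)) (f (v + k₂)) (g₁ η)
    have t2 := hB.triangle (f (v + k₂)) (f (v + k₁)) (g₁ η)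
    rw [d0, d1, d2] at t1
    rw [d0', d1, d2] at t2
    have e1 : A.rho (u * w₁) v - A.rho w₁ v + (A.rho w₁ (u⁻¹ • (k₂ - t)) - A.rho w₁ k₁) ≤
        A.D (k₂ - k₁) := by
      rw [← sub_le_iff_le_add] at t1
      refine le_trans (le_of_eq ?_) t1; abel
    have e2 : -(A.D (k₂ - k₁)) ≤
        A.rho (u * w₁) v - A.rho w₁ v + (A.rho w₁ (u⁻¹ • (k₂ - t)) - A.rho w₁ k₁) := by
      rw [← sub_le_iff_le_add, ← neg_le_neg_iff] at t2
      refine le_trans t2 (le_of_eq ?_); abel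
    have e3 := abs_le.2 ⟨e2, e1⟩
    calc |A.rho (u * w₁) v - A.rho w₁ v|
        = |(A.rho (u * w₁) v - A.rho w₁ v + (A.rho w₁ (u⁻¹ • (k₂ - t)) - A.rho w₁ k₁)) +
            (A.rho w₁ k₁ - A.rho w₁ (u⁻¹ • (k₂ - t)))| := by congr 1; abel
      _ ≤ _ := (abs_add_le _ _).trans (add_le_add_left e3 _)
  rw [huw] at key
  rcases key with h | h
  · right; rw [← h, ← mul_assoc, A.refl_sq, one_mul]
  · left; exact mul_left_cancel h

section Adjacent

variable {f : V → X} (hf : f ∈ 𝒜) {E : G} {e : ι} (he : A.IsSimple e) {S : Set X}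
  (hS : IsSector A 𝒜 S) (hrel : Rel A 𝒜 (sectorOf A f E) S (A.r e))
include hf he hS hrel

lemma rel_dichotomy (D : G) {x : G} (h : Rel A 𝒜 (sectorOf A f D) S x) :
    x = D⁻¹ * E ∨ x = D⁻¹ * (E * A.r e) := by
  have h1 := hB.rel_of hf (has_sectorOf (A := A) f E) (has_sectorOf (A := A) f D)
  rcases hB.rel_step (hB.isSector_sectorOf hf E) hS (hB.isSector_sectorOf hf D) he hrel h1
    (hB.rel_symm h) with h2 | h2
  · left; rw [← inv_inj, h2]; group
  · right; rw [← inv_inj, h2]; simp [mul_assoc, A.refl_inv]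

variable (hn : ¬ Has A f (E * A.r e) S)
include hn

/-- The ends `E` and `E * A.r e` of `f`, and `S`, are three different chambers on one panel, so the
first two play symmetric roles. -/
lemma adjacent_symm : Rel A 𝒜 (sectorOf A f (E * A.r e)) S (A.r e) ∧
    ¬ Has A f (E * A.r e * A.r e) S := by
  constructor
  · obtain ⟨x, hx⟩ := hB.exists_rel (hB.isSector_sectorOf hf (E * A.r e)) hS
    rcases hB.rel_dichotomy hf he hS hrel _ hx with h | h
    · have : (E * A.r e)⁻¹ * E = A.r e := by rw [mul_inv_rev, A.refl_inv]; group
      rwa [h, this] at hx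
    · rw [inv_mul_cancel] at h
      rw [h] at hx
      exact absurd (hB.has_of_rel_one (hB.isSector_sectorOf hf _) hx hf (has_sectorOf f _)) hn
  · intro h
    rw [mul_assoc, A.refl_sq, mul_one] at h
    have h1 := hB.rel_of hf (has_sectorOf (A := A) f E) h
    rw [inv_mul_cancel] at h1
    exact A.refl_ne_one e (hB.rel_unique (hB.isSector_sectorOf hf E) hS hrel h1)

/-- On its side of the wall, `E` is the chamber of the panel nearest to `D`, and all others look
alike from `D`; so `S` appears where `E * A.r e` would. The proof walks along a gallery from `E` to
`D`. -/
lemma rel_of_same_side (D : G) (hD : 0 < A.α e ((E⁻¹ * D) • A.o)) :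
    Rel A 𝒜 (sectorOf A f D) S (D⁻¹ * (E * A.r e)) := by
  have key : ∀ w : G, 0 < A.α e (w⁻¹ • A.o) →
      Rel A 𝒜 (sectorOf A f (E * w⁻¹)) S (w * A.r e) := by
    intro w
    refine A.gallery_induction w (Q := fun w => 0 < A.α e (w⁻¹ • A.o) →
      Rel A 𝒜 (sectorOf A f (E * w⁻¹)) S (w * A.r e)) ?_ ?_
    · intro _
      rw [inv_one, mul_one, one_mul]; exact hrel
    · intro w k hk hkw ih hpos
      have hst : 0 < A.α e ((w⁻¹ * A.r k) • A.o) :=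
        A.cross_stays (d := 1) hk hpos (by rw [one_smul]; exact he.1) (by simpa using hkw)
      have hinv : (A.r k * w)⁻¹ = w⁻¹ * A.r k := by rw [mul_inv_rev, A.refl_inv]
      rw [hinv] at ih
      have ih' := ih hst
      obtain ⟨x, hx⟩ := hB.exists_rel (hB.isSector_sectorOf hf (E * w⁻¹)) hS
      have hadj : Rel A 𝒜 (sectorOf A f (E * (w⁻¹ * A.r k))) (sectorOf A f (E * w⁻¹)) (A.r k) :=
        hB.rel_of' hf (has_sectorOf f _) (has_sectorOf f _) (by simp [mul_assoc, A.refl_inv])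
      rcases hB.rel_dichotomy hf he hS hrel _ hx with h | h
      -- The distance `w` is excluded: by `rel_step` from the previous end of the gallery, it would
      -- mean either that this step crosses the wall of the panel, which `hst` forbids, or that `A.r
      -- e = 1`.
      · have hxw : x = w := by rw [h]; group
        exfalso
        rcases hB.rel_step (hB.isSector_sectorOf hf _) (hB.isSector_sectorOf hf _) hS hk hadj ih' hx
          with h2 | h2
        · rw [hxw] at h2
          have h3 : w⁻¹ * A.r k = A.r e * w⁻¹ := by
            rw [eq_mul_inv_iff_mul_eq, mul_assoc, inv_mul_eq_iff_eq_mul]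
            calc A.r k * w = A.r k * w * A.r e * A.r e := by rw [mul_assoc, A.refl_sq, mul_one]
              _ = w * A.r e := by rw [← h2]
          rw [h3, mul_smul, A.refl_neg] at hst
          exact lt_asymm hpos (neg_pos.1 hst)
        · rw [hxw, mul_assoc, ← mul_assoc, A.refl_sq, one_mul] at h2
          exact A.refl_ne_one e (by simpa using h2.symm)
      · have hxw : x = w * A.r e := by rw [h]; group
        rwa [hxw] at hx
  have h1 := key (D⁻¹ * E) (by simpa using hD)
  have h2 : E * (D⁻¹ * E)⁻¹ = D := by group
  rwa [h2, mul_assoc] at h1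

lemma rel_of_other_side (D : G) (hD : A.α e ((E⁻¹ * D) • A.o) < 0) :
    Rel A 𝒜 (sectorOf A f D) S (D⁻¹ * E) := by
  obtain ⟨h1, h2⟩ := hB.adjacent_symm hf he hS hrel hn
  have h3 := hB.rel_of_same_side hf he hS h1 h2 D (by
    rw [mul_inv_rev, A.refl_inv, mul_assoc, mul_smul, A.refl_neg]; exact neg_pos.2 hD)
  rwa [mul_assoc E, A.refl_sq, mul_one] at h3

end Adjacent

end Building
end GenAffineBuilding

/-! ### Half-apartments and sundials -/

namespace GenAffineBuilding

set_option linter.unusedSectionVars false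

open Set

variable {G ι V Λ X : Type*} [Group G] [AddCommGroup V] [DistribMulAction G V]
    [AddCommGroup Λ] [LinearOrder Λ] [Fintype ι] [IsOrderedAddMonoid Λ]
    {A : ApartmentModel G ι V Λ} {T : AddSubgroup V} {𝒜 : Set (V → X)} {d : X → X → Λ}

namespace ApartmentModel

variable (A)

lemma parallel' {w : G} {i j : ι} (hr : A.r i = A.r j) (hi : 0 < A.α i (w • A.o))
    (hj : 0 < A.α j (w • A.o)) : ∃ e : Λ ≃+o Λ, ∀ v, A.α j v = e (A.α i v) := by
  obtain ⟨i', hi', hri⟩ := A.perm' w i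
  obtain ⟨j', hj', hrj⟩ := A.perm' w j
  obtain ⟨e, he⟩ := A.parallel i' j' (by rw [hri, hrj, hr]) (by rwa [hi']) (by rwa [hj'])
  refine ⟨e, fun v => ?_⟩
  have h1 := hi' (w⁻¹ • v)
  have h2 := hj' (w⁻¹ • v)
  rw [smul_inv_smul] at h1 h2
  rw [← h1, ← h2, he]

lemma exists_sector_subset_halfSpace {w : G} {i : ι} (h : 0 < A.α i (w • A.o)) (k : Λ) :
    ∃ p, ∀ x ∈ A.sector p w, k ≤ A.α i x := by
  obtain ⟨v, -, hv⟩ := A.exists_deep w k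
  refine ⟨v, fun x hx => ?_⟩
  have := hx i h
  rw [map_sub, sub_nonneg] at this
  exact (hv i h).le.trans this

/-- A finite intersection of half-spaces which contains sectors in all directions on one side of
a wall is a half-space bounded by a parallel wall. -/
lemma halfSpace_of_sectors {i : ι} {s : Set (ι × Λ)} (hs : s.Finite) (hne : s.Nonempty) {E : G}
    (hE : 0 < A.α i (E • A.o))
    (h : ∀ D : G, 0 < A.α i (D • A.o) →
      ∃ q, ∀ x ∈ A.sector q D, ∀ p ∈ s, p.2 ≤ A.α p.1 x) :
    ∃ k, ∀ x, (∀ p ∈ s, p.2 ≤ A.α p.1 x) ↔ k ≤ A.α i x := by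
  have hpos : ∀ p ∈ s, ∀ D : G, 0 < A.α i (D • A.o) → 0 < A.α p.1 (D • A.o) := by
    intro p hp D hD
    obtain ⟨q, hq⟩ := h D hD
    exact A.pos_of_cone_subset (p := q) (k := p.2) fun x hx => hq x hx p hp
  have hpar : ∀ p ∈ s, ∃ k, ∀ x, p.2 ≤ A.α p.1 x ↔ k ≤ A.α i x := by
    intro p hp
    have hr : A.r i = A.r p.1 := by
      by_contra hr
      -- If the walls were not parallel, a chamber containing this `v` would give a direction on the
      -- positive side of `i` that leaves the half-space `p`.
      obtain ⟨v, hv1, hv2⟩ := A.nonparallel i p.1 hr (A.α i (E • A.o))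
      obtain ⟨D, hD⟩ := A.exists_mem_C v
      have h1 : 0 < A.α i (D • A.o) := by
        by_contra h1
        exact absurd (A.nonpos_of_mem_C hD h1) (not_le.2 (hE.trans_le hv1))
      have h2 := hD p.1 (hpos p hp D h1)
      exact absurd (h2.trans hv2) (not_le.2 (neg_neg_of_pos hE))
    obtain ⟨e, he⟩ := A.parallel' hr hE (hpos p hp E hE)
    refine ⟨e.symm p.2, fun x => ?_⟩
    rw [he]
    constructor
    · intro h3
      have := (map_le_map_iff e.symm).2 h3
      simpa using this
    · intro h3
      have := (map_le_map_iff e).2 h3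
      simpa using this
  choose! κ hκ using hpar
  obtain ⟨m, hm, hmax⟩ := s.exists_max_image κ hs hne
  refine ⟨κ m, fun x => ⟨fun hx => (hκ m hm x).1 (hx m hm), fun hx p hp => ?_⟩⟩
  exact (hκ p hp x).2 ((hmax p hp).trans hx)

end ApartmentModel

lemma agree_of_halfSpace {f g : V → X} {i : ι} {k : Λ} (h : ∀ x, k ≤ A.α i x → f x = g x)
    {w : G} (hw : 0 < A.α i (w • A.o)) : Agree A f g w := by
  obtain ⟨p, hp⟩ := A.exists_sector_subset_halfSpace hw k
  exact ⟨p, fun x hx => h x (hp x hx)⟩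

namespace Building

variable (hB : Building A T 𝒜 d)
include hB

/-- If `S` is an end adjacent to but not in the apartment of `f`, then there is an apartment with
the end `S` which meets the apartment of `f` in a half-apartment. -/
lemma exists_half {f : V → X} (hf : f ∈ 𝒜) {E : G} {e : ι} (he : A.IsSimple e) {S : Set X}
    (hS : IsSector A 𝒜 S) (hrel : Rel A 𝒜 (sectorOf A f E) S (A.r e))
    (hn : ¬ Has A f (E * A.r e) S) {i : ι} (hi : ∀ v, A.α i v = A.α e (E⁻¹ • v)) :
    ∃ g ∈ 𝒜, Has A g (E * A.r e) S ∧ ∃ k, (∀ x, f x ∈ range g ↔ k ≤ A.α i x) ∧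
      ∀ x, k ≤ A.α i x → f x = g x := by
  set F := E * A.r e with hF
  set c := F * A.w₀ with hc
  have hαi : ∀ D : G, A.α i (D • A.o) = A.α e ((E⁻¹ * D) • A.o) := fun D => by
    rw [hi, mul_smul]
  have hEpos : 0 < A.α i (E • A.o) := by
    rw [hαi, inv_mul_cancel, one_smul]; exact he.1
  have hFneg : A.α i (F • A.o) < 0 := by
    rw [hαi, hF, inv_mul_cancel_left, A.refl_neg]; exact neg_neg_of_pos he.1
  have hcpos : 0 < A.α i (c • A.o) := (A.pos_mul_w₀ _ _).2 hFneg
  have hsame : ∀ D : G, 0 < A.α i (D • A.o) → Rel A 𝒜 (sectorOf A f D) S (D⁻¹ * F) := fun D hD =>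
    hB.rel_of_same_side hf he hS hrel hn D (by rwa [← hαi])
  -- The end `c` of `f` is opposite to `F`, and `S` is seen from `c` at the distance of `F`. So this
  -- chart keeps `c` and has `S` in place of `F`.
  obtain ⟨g, hg, hag, hgS⟩ := hB.rel_extend (hB.isSector_sectorOf hf c) (hsame c hcpos) hf
    (has_sectorOf f c)
  rw [mul_inv_cancel_left] at hgS
  -- All ends of `f` on the side of `c` are ends of `g`. If a gallery from `c` first left `g` at
  -- `D`, then `D` would be adjacent to the apartment of `g`, and its distance from `S` computed by
  -- `rel_of_other_side` in `g` would differ by `A.r k` from the distance known through `f`.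
  have key : ∀ u : G, 0 < A.α i ((c * u⁻¹) • A.o) →
      Has A g (c * u⁻¹) (sectorOf A f (c * u⁻¹)) := by
    intro u
    refine A.gallery_induction u (Q := fun u => 0 < A.α i ((c * u⁻¹) • A.o) →
      Has A g (c * u⁻¹) (sectorOf A f (c * u⁻¹))) ?_ ?_
    · intro _
      rw [inv_one, mul_one]
      exact hag.has_iff.1 (has_sectorOf f c)
    · intro u k hk hku ih hpos
      set D := c * u⁻¹ with hD
      have hDc : D⁻¹ * c = u := by rw [hD]; group
      have hinv : c * (A.r k * u)⁻¹ = D * A.r k := by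
        rw [hD, mul_inv_rev, A.refl_inv]; group
      rw [hinv] at ih
      have hst : 0 < A.α i ((D * A.r k) • A.o) :=
        A.cross_stays (d := c) hk hpos hcpos (by rwa [hDc])
      have hgD' := ih hst
      by_contra hgD
      have hDk : (D * A.r k)⁻¹ * D = A.r k := by rw [mul_inv_rev, A.refl_inv]; group
      have hadj : Rel A 𝒜 (sectorOf A g (D * A.r k)) (sectorOf A f D) (A.r k) :=
        hB.rel_congr_left (hB.isSector_sectorOf hf _) hg hgD' (has_sectorOf g _)
          (hB.rel_of' hf (has_sectorOf f _) (has_sectorOf f _) hDk)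
      have hnot : ¬ Has A g (D * A.r k * A.r k) (sectorOf A f D) := by
        rwa [mul_assoc, A.refl_sq, mul_one]
      have hside : A.α k (((D * A.r k)⁻¹ * F) • A.o) < 0 := by
        rw [mul_inv_rev, A.refl_inv, mul_assoc, mul_smul, A.refl_neg]
        have h1 : ¬ 0 < A.α k ((D⁻¹ * F * A.w₀) • A.o) := by
          rw [mul_assoc, ← hc, hDc]; exact not_lt.2 hku.le
        rw [A.pos_mul_w₀] at h1
        exact neg_neg_of_pos (lt_of_le_of_ne (not_lt.1 h1) (A.ne' _ _).symm)
      have r1 := hB.rel_of_other_side hg hk (hB.isSector_sectorOf hf D) hadj hnot F hside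
      have r2 := hB.rel_congr_left hS hg hgS (has_sectorOf g F) (hB.rel_symm (hsame D hpos))
      have h2 := hB.rel_unique (hB.isSector_sectorOf hg F) (hB.isSector_sectorOf hf D) r1 r2
      rw [mul_inv_rev (D⁻¹), inv_inv] at h2
      exact A.refl_ne_one k (by simpa using mul_left_cancel h2)
  have hagree : ∀ D : G, 0 < A.α i (D • A.o) → Agree A f g D := by
    intro D hD
    have h1 : c * (D⁻¹ * c)⁻¹ = D := by group
    have h2 := key (D⁻¹ * c)
    rw [h1] at h2
    exact hB.agree_of_has (hB.isSector_sectorOf hf D) hf hg (has_sectorOf f D) (h2 hD) hag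
  obtain ⟨q, hq⟩ := hagree c hcpos
  obtain ⟨s, hs, hconv⟩ := hB.convex hf hg ⟨q, (hq q (self_mem_sector q c)).symm⟩
  have hne : s.Nonempty := by
    rw [Set.nonempty_iff_ne_empty]
    rintro rfl
    have h1 : ∀ x, f x = g x := fun x => hB.agree_eq hf hg hag ((hconv x).2 (by simp))
    rw [← funext h1] at hgS
    exact hn hgS
  obtain ⟨k, hk⟩ := A.halfSpace_of_sectors hs hne hEpos fun D hD => by
    obtain ⟨q, hq⟩ := hagree D hD
    exact ⟨q, fun x hx => (hconv x).1 ⟨x, (hq x hx).symm⟩⟩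
  have hk' : ∀ x, f x ∈ range g ↔ k ≤ A.α i x := fun x => (hconv x).trans (hk x)
  exact ⟨g, hg, hgS, k, hk', fun x hx => hB.agree_eq hf hg hag ((hk' x).2 hx)⟩

/-- Two charts which agree along opposite ends are equal. -/
lemma eq_of_agree_opposite {f g : V → X} (hf : f ∈ 𝒜) (hg : g ∈ 𝒜) {w : G} (h : Agree A f g w)
    (h' : Agree A f g (w * A.w₀)) : f = g := by
  obtain ⟨q, hq⟩ := id h
  obtain ⟨q', hq'⟩ := h'
  obtain ⟨s, hs, hconv⟩ := hB.convex hf hg ⟨q, (hq q (self_mem_sector q w)).symm⟩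
  funext x
  refine hB.agree_eq hf hg h ((hconv x).2 fun p hp => ?_)
  -- No half-space contains sectors in two opposite directions, so no condition cuts out the
  -- overlap.
  have h1 : 0 < A.α p.1 (w • A.o) := A.pos_of_cone_subset (p := q) (k := p.2) fun y hy =>
    (hconv y).1 ⟨y, (hq y hy).symm⟩ p hp
  have h2 : 0 < A.α p.1 ((w * A.w₀) • A.o) := A.pos_of_cone_subset (p := q') (k := p.2) fun y hy =>
    (hconv y).1 ⟨y, (hq' y hy).symm⟩ p hp
  exact absurd ((A.pos_mul_w₀ _ _).1 h2) (lt_asymm h1)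

lemma range_eq_of_opposite {f g : V → X} (hf : f ∈ 𝒜) (hg : g ∈ 𝒜) {S S' : Set X}
    (hS : IsSector A 𝒜 S) (hS' : IsSector A 𝒜 S') {w v : G} (h₁ : Has A f w S)
    (h₂ : Has A f (w * A.w₀) S') (h₃ : Has A g v S) (h₄ : Has A g (v * A.w₀) S') :
    range f = range g := by
  obtain ⟨u, t, ht, huv, hag⟩ := hB.exists_agree hS hf hg h₁ h₃
  have hg' := hB.comp g hg u t ht
  have h5 : Has A (fun x => g (u • x + t)) (w * A.w₀) S' := by
    rw [has_comp_iff, ← mul_assoc, huv]; exact h₄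
  have h6 := hB.agree_of_has hS' hf hg' h₂ h5 hag
  rw [hB.eq_of_agree_opposite hf hg' hag h6, range_comp_affine]

/-- If `S` is an end adjacent to but not in the apartment of `f`, then the apartment of `f` is
covered by two apartments with the end `S`. -/
lemma sundial {f : V → X} (hf : f ∈ 𝒜) {E : G} {e : ι} (he : A.IsSimple e) {S : Set X}
    (hS : IsSector A 𝒜 S) (hrel : Rel A 𝒜 (sectorOf A f E) S (A.r e))
    (hn : ¬ Has A f (E * A.r e) S) {i : ι} (hi : ∀ v, A.α i v = A.α e (E⁻¹ • v)) :
    ∃ g ∈ 𝒜, ∃ h ∈ 𝒜, ∃ k, Has A g (E * A.r e) S ∧ Has A h E S ∧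
      (∀ x, k ≤ A.α i x → f x = g x) ∧ (∀ x, A.α i x ≤ k → f x = h x) := by
  set s := A.r e with hs
  obtain ⟨i', hi', -⟩ := A.perm' (E * s)⁻¹ e
  have hi'i : ∀ v, A.α i' v = -A.α i v := by
    intro v
    rw [hi', hi, mul_inv_rev, A.refl_inv, mul_smul, A.refl_neg]
  have hEpos : 0 < A.α i (E • A.o) := by rw [hi, inv_smul_smul]; exact he.1
  obtain ⟨hrel', hn'⟩ := hB.adjacent_symm hf he hS hrel hn
  obtain ⟨g, hg, hgS, k₁, hk₁, hfg⟩ := hB.exists_half hf he hS hrel hn hi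
  obtain ⟨h, hh, hhS, k₂, hk₂, hfh⟩ := hB.exists_half hf he hS hrel' hn' hi'
  rw [mul_assoc, A.refl_sq, mul_one] at hhS
  -- the end of `f` opposite to `E`
  obtain ⟨e', he', hre'⟩ := A.exists_simple_conj he
  set S' := sectorOf A f (E * A.w₀) with hS'def
  have hS' : IsSector A 𝒜 S' := hB.isSector_sectorOf hf _
  have hdd : E * s * A.w₀ * A.r e' = E * A.w₀ := by
    rw [hre']
    simp only [mul_assoc]
    rw [← mul_assoc A.w₀ A.w₀, A.w₀_sq, one_mul, ← mul_assoc s, A.refl_sq, one_mul]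
  have hdd' : E * A.w₀ * A.r e' = E * s * A.w₀ := by
    rw [← hdd, mul_assoc, A.refl_sq, mul_one]
  have hneg : A.α i ((E * s) • A.o) < 0 := by
    rw [hi, mul_smul, inv_smul_smul, A.refl_neg]; exact neg_neg_of_pos he.1
  have hpos' : 0 < A.α i ((E * s * A.w₀) • A.o) := (A.pos_mul_w₀ _ _).2 hneg
  have hag' : Agree A f g (E * s * A.w₀) := agree_of_halfSpace hfg hpos'
  -- (A6) requires `g` and `h` to meet in a half-apartment. To see this, `exists_half` is applied to
  -- `g` and the end `S'`; the resulting chart `q` has the opposite ends `S` and `S'`, as has `h`,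
  -- so both have the same apartment.
  have hadj : Rel A 𝒜 (sectorOf A g (E * s * A.w₀)) S' (A.r e') :=
    hB.rel_congr_left (hB.isSector_sectorOf hf (E * s * A.w₀)) hg
      (hag'.has_iff.1 (has_sectorOf f _)) (has_sectorOf g _)
      (hB.rel_of' hf (has_sectorOf f _) (has_sectorOf f _) (by rw [← hdd]; group))
  have hnot : ¬ Has A g (E * s * A.w₀ * A.r e') S' := by
    rw [hdd]
    intro hc
    obtain ⟨q, hq⟩ := hB.agree_of_has hS' hf hg (has_sectorOf f _) hc hag'
    have h1 : 0 < A.α i ((E * A.w₀) • A.o) := A.pos_of_cone_subset (p := q) (k := k₁)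
      fun y hy => (hk₁ y).1 ⟨y, (hq y hy).symm⟩
    exact lt_asymm hEpos ((A.pos_mul_w₀ _ _).1 h1)
  obtain ⟨hadj₂, hnot₂⟩ := hB.adjacent_symm hg he' hS' hadj hnot
  rw [hdd] at hadj₂ hnot₂
  obtain ⟨l, hl, -⟩ := A.perm' (E * A.w₀)⁻¹ e'
  obtain ⟨q, hq, hqS', k₃, hk₃, hgq⟩ := hB.exists_half hg he' hS' hadj₂ hnot₂ hl
  rw [hdd'] at hqS'
  have hlpos : 0 < A.α l ((E * s) • A.o) := by
    have h1 : E * s = E * A.w₀ * A.r e' * A.w₀ := by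
      rw [hdd', mul_assoc (E * s), A.w₀_sq, mul_one]
    rw [h1, A.pos_mul_w₀, hl, mul_smul, inv_smul_smul, A.refl_neg]
    exact neg_neg_of_pos he'.1
  have hqS : Has A q (E * s) S := (agree_of_halfSpace hgq hlpos).has_iff.1 hgS
  have hhS' : Has A h (E * A.w₀) S' := by
    refine (agree_of_halfSpace hfh ?_).has_iff.1 (has_sectorOf f _)
    rw [hi'i]
    have : ¬ 0 < A.α i ((E * A.w₀) • A.o) := by rw [A.pos_mul_w₀]; exact lt_asymm hEpos
    exact neg_pos.2 (A.pos_or_of_ne_pos this)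
  have hrange := hB.range_eq_of_opposite hq hh hS hS' hqS hqS' hhS hhS'
  -- A point common to the three apartments lies in both half-apartments of `f`, so these leave no
  -- gap between them and one threshold `k₁` serves both.
  obtain ⟨_, ⟨⟨x, rfl⟩, hx₁⟩, hx₂⟩ := hB.inter f hf g hg h hh i l i' k₁ k₃ k₂
    (Set.ext hk₁) (by rw [← hrange]; exact Set.ext hk₃) (Set.ext hk₂)
  have h1 := (hk₁ x).1 hx₁
  have h2 := (hk₂ x).1 hx₂
  refine ⟨g, hg, h, hh, k₁, hgS, hhS, hfg, fun y hy => hfh y ?_⟩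
  rw [hi'i] at h2 ⊢
  exact h2.trans (neg_le_neg (hy.trans h1))

end Building
end GenAffineBuilding

/-! ### Opposite ends, finite covers and segments -/

namespace GenAffineBuilding

set_option linter.unusedSectionVars false

open Set

variable {G ι V Λ X : Type*} [Group G] [AddCommGroup V] [DistribMulAction G V]
    [AddCommGroup Λ] [LinearOrder Λ] [Fintype ι] [IsOrderedAddMonoid Λ]
    {A : ApartmentModel G ι V Λ} {T : AddSubgroup V} {𝒜 : Set (V → X)} {d : X → X → Λ}

namespace ApartmentModel

variable (A)

lemma exists_small (w : G) {ε : Λ} (hε : 0 < ε) :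
    ∃ v, (∀ i, 0 < A.α i (w • A.o) → 0 < A.α i v) ∧ A.D v < ε := by
  obtain ⟨v, hv, hvε⟩ := A.small ε hε
  refine ⟨w • v, fun i hi => ?_, by rw [A.D_smul]; exact hvε⟩
  obtain ⟨j, hj, -⟩ := A.perm' w i
  rw [← hj] at hi ⊢
  exact hv j hi

lemma neg_of_interior {w : G} {v : V} (hv : ∀ i, 0 < A.α i (w • A.o) → 0 < A.α i v) {i : ι}
    (hi : ¬ 0 < A.α i (w • A.o)) : A.α i v < 0 := by
  obtain ⟨j, hj, hj'⟩ := A.exists_neg_pos hi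
  have := hv j hj'
  rw [hj] at this
  exact neg_pos.1 this

/-- If a coroot positive on the direction were negative at `x`, its values at `x` and `v` would have
opposite signs, and the triangle inequality would be strict in that summand. -/
lemma mem_C_of_D_add {w : G} {x v : V} (hv : ∀ i, 0 < A.α i (w • A.o) → 0 < A.α i v)
    (h : A.D x + A.D v ≤ A.D (x + v)) : x ∈ A.C w := by
  intro i hi
  by_contra hx
  have h1 : A.D (x + v) < A.D x + A.D v := by
    unfold D
    rw [← Finset.sum_add_distrib]
    refine Finset.sum_lt_sum (fun j _ => by rw [map_add]; exact abs_add_le _ _)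
      ⟨i, Finset.mem_univ i, ?_⟩
    rw [map_add]
    have h2 := hv i hi
    rw [not_le] at hx
    rw [abs_of_neg hx, abs_of_pos h2, abs_lt]
    constructor
    · rw [neg_add, neg_neg]; exact add_lt_add_right ((neg_neg_of_pos h2).trans h2) _
    · exact add_lt_add_left (hx.trans (neg_pos.2 hx)) _
  exact absurd h (not_le.2 h1)

end ApartmentModel

lemma exists_pos_le {α : Type*} {s : Set α} (hs : s.Finite) {φ : α → Λ} (h : ∀ x ∈ s, 0 < φ x)
    {ε₀ : Λ} (hε₀ : 0 < ε₀) : ∃ ε, 0 < ε ∧ ∀ x ∈ s, ε ≤ φ x := by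
  rcases s.eq_empty_or_nonempty with rfl | hne
  · exact ⟨ε₀, hε₀, by simp⟩
  · obtain ⟨m, hm, hmin⟩ := s.exists_min_image φ hs hne
    exact ⟨φ m, h m hm, hmin⟩

namespace Building

variable (hB : Building A T 𝒜 d)
include hB

/-- The inductive step of `opposite_cover`, from `c` to the adjacent end `c'`. The apartment of `g`
is first bent, keeping the point `f p`, so that it contains the end `D * A.r e'` of `f` besides `D`.
The new apartment has an end `c₂` on the panel of `c` and `c'`. Either `c'` is already an end of it,
or a second sundial splits it, and the half containing the point decides which of the two ends of
`f` is opposite to `c'`. -/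
lemma opposite_cover_step {f : V → X} (hf : f ∈ 𝒜) {p : V} {c c' : Set X} (hc : IsSector A 𝒜 c)
    (hc' : IsSector A 𝒜 c') {e : ι} (he : A.IsSimple e) (hcc' : Rel A 𝒜 c c' (A.r e))
    (h : ∃ g ∈ 𝒜, ∃ D, Has A g (D * A.w₀) c ∧ Agree A f g D ∧ f p ∈ range g) :
    ∃ g ∈ 𝒜, ∃ D, Has A g (D * A.w₀) c' ∧ Agree A f g D ∧ f p ∈ range g := by
  obtain ⟨g, hg, D, hgc, hfg, hp⟩ := h
  obtain ⟨e', he', hre'⟩ := A.exists_simple_conj he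
  have hs1 : A.w₀ * A.r e = A.r e' * A.w₀ := by
    rw [hre', mul_assoc, A.w₀_sq, mul_one]
  have hDs : D * A.w₀ * A.r e = D * A.r e' * A.w₀ := by
    rw [mul_assoc, hs1, mul_assoc]
  have hfgp : f p = g p := hB.agree_eq hf hg hfg hp
  set S := sectorOf A f (D * A.r e') with hSdef
  have hS : IsSector A 𝒜 S := hB.isSector_sectorOf hf _
  -- a chart through `p` with the ends `D`, `D * r e'` of `f` and an end adjacent to `c`
  obtain ⟨b, hb, hbD, hbS, hbg, hbp⟩ : ∃ b ∈ 𝒜, Agree A f b D ∧ Has A b (D * A.r e') S ∧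
      Agree A g b (D * A.r e' * A.w₀) ∧ f p ∈ range b := by
    by_cases hn : Has A g (D * A.r e') S
    · exact ⟨g, hg, hfg, hn, Agree.refl g _, hp⟩
    obtain ⟨i, hi, -⟩ := A.perm' D⁻¹ e'
    have hrel : Rel A 𝒜 (sectorOf A g D) S (A.r e') :=
      hB.rel_congr_left (hB.isSector_sectorOf hf D) hg (hfg.has_iff.1 (has_sectorOf f _))
        (has_sectorOf g _) (hB.rel_of' hf (has_sectorOf f _) (has_sectorOf f _) (by group))
    obtain ⟨b, hb, h, hh, k, hbS, hhS, hgb, hgh⟩ := hB.sundial hg he' hS hrel hn hi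
    have hDpos : 0 < A.α i (D • A.o) := by rw [hi, inv_smul_smul]; exact he'.1
    have hDneg : A.α i ((D * A.r e') • A.o) < 0 := by
      rw [hi, mul_smul, inv_smul_smul, A.refl_neg]; exact neg_neg_of_pos he'.1
    by_cases hkp : k ≤ A.α i p
    · exact ⟨b, hb, hfg.trans (agree_of_halfSpace hgb hDpos), hbS,
        agree_of_halfSpace hgb ((A.pos_mul_w₀ _ _).2 hDneg), p, by rw [hfgp, hgb p hkp]⟩
    -- Beyond the wall, `h` has `S` in direction `D`. A vector `y` in direction `D`, small enough
    -- not to cross the wall, gives the same point in `h`, `g` and `f`; but `f` has `S` in direction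
    -- `D * A.r e'`, so the sector from `f p` to `S` would point in two directions of `f`.
    exfalso
    rw [not_le] at hkp
    have hhp : f p = h p := hfgp.trans (hgh p hkp.le)
    obtain ⟨u, t, -, hu, hut, q, hq⟩ := hB.has_has hS hf hh (has_sectorOf f _) hhS
    have hsec := hB.sector_subset_range hf hh ⟨p, hhp.symm⟩ hq
    have hup : u • p + t = p := by
      have := hut p ⟨p, hhp.symm⟩
      rw [hhp] at this
      exact (hB.inj h hh this).symm
    obtain ⟨y, hy, hyk⟩ := A.exists_small D (sub_pos.2 hkp)
    have hyC : y ∈ A.C D := fun i hi => (hy i hi).le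
    have hxC : p + u⁻¹ • y ∈ A.sector p (D * A.r e') := by
      rw [mem_sector, add_sub_cancel_left, ← A.smul_mem_C u, hu, smul_inv_smul]
      exact hyC
    have h1 := hut _ (hsec _ hxC)
    have h2 : u • (p + u⁻¹ • y) + t = p + y := by
      rw [smul_add, smul_inv_smul, add_right_comm, hup]
    rw [h2, ← hgh (p + y), ← hB.agree_eq_sector hf hg hfg hp (p + y)] at h1
    · have h3 := add_left_cancel (hB.inj f hf h1)
      have h4 := inv_eq_one.1 (A.eq_one_of_fix' hy h3)
      rw [h4, one_mul] at hu
      exact A.refl_ne_one e' (by simpa using hu)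
    · rw [mem_sector, add_sub_cancel_left]; exact hyC
    · rw [map_add]
      have := (A.le_D i y).trans hyk.le
      rwa [le_sub_iff_add_le'] at this
  have hfbS : Agree A f b (D * A.r e') :=
    hB.agree_of_has hS hf hb (has_sectorOf f _) hbS hbD
  set c₂ := sectorOf A b (D * A.r e' * A.w₀) with hc₂def
  have hc₂ : IsSector A 𝒜 c₂ := hB.isSector_sectorOf hb _
  have hcc₂ : Rel A 𝒜 c c₂ (A.r e) :=
    hB.rel_of' hg hgc (hbg.has_iff.2 (has_sectorOf b _)) (by rw [← hDs]; group)
  obtain ⟨w, hw⟩ := hB.exists_rel hc₂ hc'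
  have hback : D * A.r e' * A.w₀ * A.r e = D * A.w₀ := by
    rw [← hDs, mul_assoc, A.refl_sq, mul_one]
  rcases hB.rel_step hc hc₂ hc' he hcc₂ hcc' hw with rfl | rfl
  · by_cases hn : Has A b (D * A.w₀) c'
    · exact ⟨b, hb, D, hn, hbD, hbp⟩
    rw [← hback] at hn
    obtain ⟨i, hi, -⟩ := A.perm' (D * A.r e' * A.w₀)⁻¹ e
    obtain ⟨b₁, hb₁, b₂, hb₂, k, hbc₁, hbc₂, h₁, h₂⟩ := hB.sundial hb he hc' hw hn hi
    have hfbp := hB.agree_eq hf hb hbD hbp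
    have hpos : 0 < A.α i ((D * A.r e' * A.w₀) • A.o) := by
      rw [hi, inv_smul_smul]; exact he.1
    have hneg : A.α i ((D * A.r e') • A.o) < 0 := (A.pos_mul_w₀ _ _).1 hpos
    have hneg' : A.α i ((D * A.w₀) • A.o) < 0 := by
      rw [← hback, hi, mul_smul _ (A.r e), inv_smul_smul, A.refl_neg]; exact neg_neg_of_pos he.1
    rcases le_total k (A.α i p) with hk | hk
    · rw [hback] at hbc₁
      have hDpos : 0 < A.α i (D • A.o) := by
        by_contra h3
        exact lt_asymm hneg' ((A.pos_mul_w₀ _ _).2 (A.pos_or_of_ne_pos h3))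
      exact ⟨b₁, hb₁, D, hbc₁, hbD.trans (agree_of_halfSpace h₁ hDpos), p,
        by rw [hfbp, h₁ p hk]⟩
    · obtain ⟨j, hj, -⟩ := A.neg i
      refine ⟨b₂, hb₂, D * A.r e', hbc₂, hfbS.trans (agree_of_halfSpace (i := j) (k := -k)
        (fun x hx => h₂ x ?_) ?_), p, by rw [hfbp, h₂ p hk]⟩
      · rw [hj] at hx; exact neg_le_neg_iff.1 hx
      · rw [hj]; exact neg_pos.2 hneg
  · rw [A.refl_sq] at hw
    exact ⟨b, hb, D * A.r e', hB.has_of_rel_one hc₂ hw hb (has_sectorOf b _), hfbS, hbp⟩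

/-- Every point of an apartment lies in an apartment which joins a given end to an opposite
end of the given apartment. -/
lemma opposite_cover {f : V → X} (hf : f ∈ 𝒜) (p : V) {S : Set X} (hS : IsSector A 𝒜 S) :
    ∃ g ∈ 𝒜, ∃ D, Has A g (D * A.w₀) S ∧ Agree A f g D ∧ f p ∈ range g := by
  have key : ∀ w : G, ∀ S, IsSector A 𝒜 S → Rel A 𝒜 (sectorOf A f 1) S w⁻¹ →
      ∃ g ∈ 𝒜, ∃ D, Has A g (D * A.w₀) S ∧ Agree A f g D ∧ f p ∈ range g := by
    intro w
    refine A.gallery_induction w (Q := fun w => ∀ S, IsSector A 𝒜 S →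
      Rel A 𝒜 (sectorOf A f 1) S w⁻¹ →
      ∃ g ∈ 𝒜, ∃ D, Has A g (D * A.w₀) S ∧ Agree A f g D ∧ f p ∈ range g) ?_ ?_
    · intro S hS h
      rw [inv_one] at h
      refine ⟨f, hf, A.w₀, ?_, Agree.refl f _, p, rfl⟩
      rw [A.w₀_sq]
      exact hB.has_of_rel_one (hB.isSector_sectorOf hf 1) h hf (has_sectorOf f 1)
    · intro w k hk _ ih S hS h
      obtain ⟨a, ha, h1, h2⟩ := h
      refine hB.opposite_cover_step hf (hB.isSector_sectorOf ha (w⁻¹ * A.r k)) hS hk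
        (hB.rel_of' ha (has_sectorOf a _) h2 ?_) (ih _ (hB.isSector_sectorOf ha (w⁻¹ * A.r k)) ?_)
      · rw [mul_inv_rev, A.refl_inv]; group
      · refine hB.rel_of' ha h1 (has_sectorOf a _) ?_
        rw [mul_inv_rev, A.refl_inv]; group
  obtain ⟨w, hw⟩ := hB.exists_rel (hB.isSector_sectorOf hf 1) hS
  exact key w⁻¹ S hS (by rwa [inv_inv])

lemma exists_chart_has (x : X) {S : Set X} (hS : IsSector A 𝒜 S) :
    ∃ f ∈ 𝒜, ∃ w, Has A f w S ∧ x ∈ range f := by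
  obtain ⟨f, hf, ⟨p, rfl⟩, -⟩ := hB.exists_chart x x
  obtain ⟨g, hg, D, h1, -, h2⟩ := hB.opposite_cover hf p hS
  exact ⟨g, hg, _, h1, h2⟩

/-- For each `D` at most one chart agrees with `f` along `D` and has `S` as the opposite end, so one
choice per direction captures all the apartments given by `opposite_cover`. -/
lemma exists_finite_cover [Finite G] {f : V → X} (hf : f ∈ 𝒜) {S : Set X}
    (hS : IsSector A 𝒜 S) : ∃ 𝒢 : Set (V → X), 𝒢.Finite ∧
      (∀ g ∈ 𝒢, g ∈ 𝒜 ∧ ∃ w, Has A g w S) ∧ ∀ p, ∃ g ∈ 𝒢, f p ∈ range g := by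
  classical
  let 𝒢 : Set (V → X) := {g | ∃ (D : G) (h : ∃ g ∈ 𝒜, Has A g (D * A.w₀) S ∧ Agree A f g D),
    g = h.choose}
  refine ⟨𝒢, ?_, ?_, fun p => ?_⟩
  · refine (Set.finite_range fun D : G =>
      if h : ∃ g ∈ 𝒜, Has A g (D * A.w₀) S ∧ Agree A f g D then h.choose else f).subset ?_
    rintro g ⟨D, h, rfl⟩
    exact ⟨D, by simp only [h, dif_pos]⟩
  · rintro g ⟨D, h, rfl⟩
    exact ⟨h.choose_spec.1, _, h.choose_spec.2.1⟩
  · obtain ⟨g, hg, D, h1, h2, h3⟩ := hB.opposite_cover hf p hS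
    have h : ∃ g ∈ 𝒜, Has A g (D * A.w₀) S ∧ Agree A f g D := ⟨g, hg, h1, h2⟩
    refine ⟨h.choose, ⟨D, h, rfl⟩, ?_⟩
    have h4 : Agree A g h.choose D := h2.symm.trans h.choose_spec.2.2
    have h5 := hB.agree_of_has hS hg h.choose_spec.1 h1 h.choose_spec.2.1 h4
    rwa [← hB.eq_of_agree_opposite hg h.choose_spec.1 h4 h5]

/-- The sector with a given base point and end is unique. -/
lemma sector_eq {S : Set X} (hS : IsSector A 𝒜 S) {h g : V → X} (hh : h ∈ 𝒜) (hg : g ∈ 𝒜)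
    {q q' : V} (hq : h q = g q') {w v : G} (hhS : Has A h w S) (hgS : Has A g v S) :
    h '' A.sector q w = g '' A.sector q' v := by
  have key : ∀ {h g : V → X} {q q' : V} {w v : G}, h ∈ 𝒜 → g ∈ 𝒜 → h q = g q' → Has A h w S →
      Has A g v S → h '' A.sector q w ⊆ g '' A.sector q' v := by
    rintro h g q q' w v hh hg hq hhS hgS _ ⟨x, hx, rfl⟩
    obtain ⟨u, t, -, hu, hut, p, hp⟩ := hB.has_has hS hh hg hhS hgS
    have h1 := hB.sector_subset_range hh hg ⟨q', hq.symm⟩ hp x hx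
    have h2 : q' = u • q + t := by
      have := hut q ⟨q', hq.symm⟩
      rw [hq] at this
      exact hB.inj g hg this
    refine ⟨u • x + t, ?_, (hut x h1).symm⟩
    rw [h2, ← hu]
    exact affine_mem_sector.2 hx
  exact Subset.antisymm (key hh hg hq hhS hgS) (key hg hh hq.symm hgS hhS)

/-- The family consists of one sector from `z` towards each end of `f`. A sector from `f p` through
`z` is continued backwards, by `opposite_cover`, to an end `D` of `f`; so `f p` lies on the sector
from `z` to `D`. -/
lemma exists_finite_sector_cover [Finite G] {f : V → X} (hf : f ∈ 𝒜) (z : X) :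
    ∃ 𝒢 : Set (Set X), 𝒢.Finite ∧
      (∀ S ∈ 𝒢, ∃ g ∈ 𝒜, ∃ q w, g q = z ∧ S = g '' A.sector q w) ∧
      ∀ p, ∃ S ∈ 𝒢, f p ∈ S := by
  have h := fun D : G => hB.exists_chart_has z (hB.isSector_sectorOf hf D)
  choose g hg w hw hz using h
  choose q hq using hz
  refine ⟨range fun D => g D '' A.sector (q D) (w D), Set.finite_range _, ?_, fun p => ?_⟩
  · rintro _ ⟨D, rfl⟩
    exact ⟨g D, hg D, q D, w D, hq D, rfl⟩
  · obtain ⟨a, ha, ⟨p', hp'⟩, ⟨z', hz'⟩⟩ := hB.exists_chart (f p) z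
    obtain ⟨v, hv⟩ := A.exists_mem_C (z' - p')
    have hS : IsSector A 𝒜 (a '' A.sector p' v) := ⟨a, ha, p', v, rfl⟩
    obtain ⟨k, hk, D, h1, h2, h3⟩ := hB.opposite_cover hf p hS
    have hfk := hB.agree_eq hf hk h2 h3
    have h4 := hB.sector_eq hS ha hk (hp'.trans hfk) ⟨p', fun x hx => ⟨x, hx, rfl⟩⟩ h1
    have h5 : z ∈ k '' A.sector p (D * A.w₀) := by
      rw [← h4]; exact ⟨z', hv, hz'⟩
    obtain ⟨y, hy, hyz⟩ := h5
    have h6 := hB.sector_eq (hB.isSector_sectorOf hf D) hk (hg D) (hyz.trans (hq D).symm)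
      (h2.has_iff.1 (has_sectorOf f D)) (hw D)
    refine ⟨_, ⟨D, rfl⟩, ?_⟩
    change f p ∈ g D '' A.sector (q D) (w D)
    rw [← h6, hfk]
    refine ⟨p, ?_, rfl⟩
    rw [mem_sector, ← A.neg_mem_C_mul_w₀, neg_sub]
    exact hy

/-- Only finitely many half-spaces cut out the overlap, and each decides the matter near `p`: it
contains the germ if `p` is strictly inside, or on its wall with the sector pointing inward;
otherwise it excludes all small interior vectors. -/
lemma germ_dichotomy {f g : V → X} (hf : f ∈ 𝒜) (hg : g ∈ 𝒜) (p : V) (D : G) {ε₀ : Λ}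
    (hε₀ : 0 < ε₀) : ∃ ε, 0 < ε ∧
      ((f p ∈ range g ∧ ∀ x ∈ A.sector p D, A.D (x - p) < ε → f x ∈ range g) ∨
      ∀ v, (∀ i, 0 < A.α i (D • A.o) → 0 < A.α i v) → A.D v < ε → f (p + v) ∉ range g) := by
  by_cases hne : ∃ x, f x ∈ range g
  swap
  · exact ⟨ε₀, hε₀, Or.inr fun v _ _ h => hne ⟨_, h⟩⟩
  obtain ⟨x₀, hx₀⟩ := hne
  obtain ⟨s, hs, hconv⟩ := hB.convex hf hg hx₀
  by_cases hgood : ∀ e ∈ s, e.2 ≤ A.α e.1 p ∧ (e.2 = A.α e.1 p → 0 < A.α e.1 (D • A.o))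
  · obtain ⟨ε, hε, hεs⟩ := exists_pos_le (φ := fun e : ι × Λ =>
      if e.2 < A.α e.1 p then A.α e.1 p - e.2 else ε₀) hs (fun e _ => by
        split_ifs with h
        · exact sub_pos.2 h
        · exact hε₀) hε₀
    refine ⟨ε, hε, Or.inl ⟨(hconv p).2 fun e he => (hgood e he).1, fun x hx hxε => ?_⟩⟩
    refine (hconv x).2 fun e he => ?_
    rcases (hgood e he).1.lt_or_eq with h | h
    · have h1 := hεs e he
      simp only [h, if_true] at h1
      have h2 : -A.α e.1 (x - p) < A.α e.1 p - e.2 :=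
        ((neg_le_abs _).trans (A.abs_le_D e.1 (x - p))).trans_lt (hxε.trans_le h1)
      rw [map_sub, neg_sub] at h2
      exact (sub_lt_sub_iff_left _).1 h2 |>.le
    · have h1 := hx e.1 ((hgood e he).2 h)
      rw [map_sub, sub_nonneg] at h1
      exact h.le.trans h1
  · push Not at hgood
    obtain ⟨e, he, hbad⟩ := hgood
    by_cases h : e.2 ≤ A.α e.1 p
    · obtain ⟨h1, h2⟩ := hbad h
      refine ⟨ε₀, hε₀, Or.inr fun v hv _ hr => ?_⟩
      have h3 := (hconv _).1 hr e he
      rw [map_add, h1] at h3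
      exact absurd h3 (not_le.2 (add_lt_of_neg_right _ (A.neg_of_interior hv (not_lt.2 h2))))
    · rw [not_le] at h
      refine ⟨e.2 - A.α e.1 p, sub_pos.2 h, Or.inr fun v _ hv hr => ?_⟩
      have h3 := (hconv _).1 hr e he
      rw [map_add] at h3
      have h4 := (A.le_D e.1 v).trans_lt hv
      rw [lt_sub_iff_add_lt'] at h4
      exact absurd h3 (not_le.2 h4)

/-- A sector and the germ of another sector based at the same point lie in a common apartment. -/
lemma exists_chart_germ [Finite G] {f : V → X} (hf : f ∈ 𝒜) (p : V) (D : G) {S : Set X}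
    (hS : IsSector A 𝒜 S) {ε₀ : Λ} (hε₀ : 0 < ε₀) :
    ∃ g ∈ 𝒜, ∃ w, Has A g w S ∧ f p ∈ range g ∧
      ∃ ε, 0 < ε ∧ ∀ x ∈ A.sector p D, A.D (x - p) < ε → f x ∈ range g := by
  obtain ⟨𝒢, hfin, h𝒢, hcov⟩ := hB.exists_finite_cover hf hS
  by_contra hcon
  have h : ∀ g ∈ 𝒢, ∃ ε, 0 < ε ∧ ∀ v, (∀ i, 0 < A.α i (D • A.o) → 0 < A.α i v) →
      A.D v < ε → f (p + v) ∉ range g := by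
    intro g hg
    obtain ⟨hg𝒜, w, hw⟩ := h𝒢 g hg
    obtain ⟨ε, hε, h | h⟩ := hB.germ_dichotomy hf hg𝒜 p D hε₀
    · exact absurd ⟨g, hg𝒜, w, hw, h.1, ε, hε, h.2⟩ hcon
    · exact ⟨ε, hε, h⟩
  -- An interior vector below all these thresholds would lie outside every apartment of a finite
  -- family that covers the apartment of `f`.
  choose! φ hφ hφ' using h
  obtain ⟨ε, hε, hεφ⟩ := exists_pos_le hfin hφ hε₀
  obtain ⟨v, hv, hvε⟩ := A.exists_small D hε
  obtain ⟨g, hg, hgr⟩ := hcov (p + v)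
  exact hφ' g hg v hv (hvε.trans_le (hεφ g hg)) hgr

/-- Segments lie in every apartment containing their end points. -/
lemma seg_subset_range [Finite G] {f : V → X} (hf : f ∈ 𝒜) {a b : V} {P : X}
    (hP : d (f a) (f b) = d (f a) P + d P (f b)) {ε₀ : Λ} (hε₀ : 0 < ε₀) : P ∈ range f := by
  -- The aim is that, seen from `P`, the point `f a` and the end `S` lie in opposite directions.
  -- Then `P` lies on the sector from `f a` to `S`, which is contained in the apartment of `f`.
  obtain ⟨D, hD⟩ := A.exists_mem_C (b - a)
  have hS := hB.isSector_sectorOf hf D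
  obtain ⟨q, hq, ⟨x', hx'⟩, ⟨p', hp'⟩⟩ := hB.exists_chart (f a) P
  obtain ⟨w, hw⟩ := A.exists_mem_C (x' - p')
  have hQ : IsSector A 𝒜 (q '' A.sector p' w) := ⟨q, hq, p', w, rfl⟩
  -- a chart through `P` which agrees with `f` in direction `D`
  obtain ⟨h, hh, hfh, p, rfl⟩ : ∃ h ∈ 𝒜, Agree A f h D ∧ ∃ p, h p = P := by
    obtain ⟨h₀, hh₀, w₀, h1, h2⟩ := hB.exists_chart_has P hS
    obtain ⟨u, t, ht, -, hag⟩ := hB.exists_agree hS hf hh₀ (has_sectorOf f D) h1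
    exact ⟨_, hB.comp h₀ hh₀ u t ht, hag, by rwa [← range_comp_affine h₀ u t] at h2⟩
  obtain ⟨g₀, hg₀, w₁, hg₀Q, hpg₀, ε, hε, hgerm⟩ := hB.exists_chart_germ hh p D hQ hε₀
  obtain ⟨g, hg, w₂, hgQ, hhg⟩ : ∃ g ∈ 𝒜, ∃ w₂, Has A g w₂ (q '' A.sector p' w) ∧
      ∀ x, h x ∈ range g₀ → h x = g x := by
    obtain ⟨-, u, t, ht, hu⟩ := hB.compat h hh g₀ hg₀ ⟨h p, ⟨p, rfl⟩, hpg₀⟩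
    exact ⟨_, hB.comp g₀ hg₀ u t ht, u⁻¹ * w₁,
      by rw [has_comp_iff, mul_inv_cancel_left]; exact hg₀Q, hu⟩
  have hhgp := hhg p hpg₀
  obtain ⟨ξ, -, hξ⟩ : f a ∈ g '' A.sector p w₂ := by
    rw [← hB.sector_eq hQ hq hg (hp'.trans hhgp) ⟨p', fun x hx => ⟨x, hx, rfl⟩⟩ hgQ]
    exact ⟨x', hw, hx'⟩
  obtain ⟨v, hv, hvε⟩ := A.exists_small D hε
  have hvC : v ∈ A.C D := fun i hi => (hv i hi).le
  have hpv : p + v ∈ A.sector p D := by rw [mem_sector, add_sub_cancel_left]; exact hvC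
  have hhgv : h (p + v) = g (p + v) :=
    hhg _ (hgerm _ hpv (by rwa [add_sub_cancel_left]))
  obtain ⟨g₂, hg₂, e, hg₂S, hgg₂, hpg₂⟩ := hB.opposite_cover hg p hS
  have hgg₂p := hB.agree_eq hg hg₂ hgg₂ hpg₂
  -- The charts `h`, `g` and `g₂` share the germ at `P` of the sector towards `S`; since its
  -- interior vectors are regular, the two directions in which `h` and `g₂` see `S` must coincide.
  have hDe : D = e * A.w₀ := by
    obtain ⟨u, t, -, hu, hut, r, hr⟩ :=
      hB.has_has hS hh hg₂ (hfh.has_iff.1 (has_sectorOf f D)) hg₂S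
    have hpr : h p ∈ range g₂ := by rw [hhgp]; exact hpg₂
    have h1 := hut _ (hB.sector_subset_range hh hg₂ hpr hr _ hpv)
    have h2 : u • p + t = p := by
      have := hut p hpr
      rw [hhgp, hgg₂p] at this
      exact (hB.inj g₂ hg₂ this).symm
    have h3 : u • (p + v) + t = p + u • v := by rw [smul_add, add_right_comm, h2]
    rw [h3, hhgv] at h1
    rw [hB.agree_eq hg hg₂ hgg₂ ⟨_, h1.symm⟩] at h1
    have h4 := add_left_cancel (hB.inj g₂ hg₂ h1)
    rw [A.eq_one_of_fix' hv h4.symm, one_mul] at hu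
    exact hu
  -- comparison of distances to a point far out in direction `D`
  have hadd : A.D (p - ξ) + A.D v ≤ A.D (p - ξ + v) := by
    obtain ⟨r, hr⟩ := id hfh
    obtain ⟨η, h1, h2, h3⟩ := A.exists_ge₃ D r b (p + v)
    have hη : f η = h η := hr η h1
    have e1 : d (f a) (f η) = d (f a) (f b) + d (f b) (f η) := by
      rw [hB.dist f hf, hB.dist f hf, hB.dist f hf, ← A.D_add_of_mem_C hD h2]
      congr 1; abel
    have e2 : d (h p) (f η) = A.D v + d (h (p + v)) (f η) := by
      rw [hη, hB.dist h hh, hB.dist h hh, ← A.D_add_of_mem_C hvC h3]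
      congr 1; abel
    have e3 : d (f a) (h p) = A.D (p - ξ) := by rw [hhgp, ← hξ, hB.dist g hg]
    have e4 : d (f a) (h (p + v)) = A.D (p - ξ + v) := by
      rw [hhgv, ← hξ, hB.dist g hg]; congr 1; abel
    have t1 := hB.triangle (f a) (h (p + v)) (f η)
    have t2 := hB.triangle (h p) (f b) (f η)
    rw [e1, hP, e3, e4] at t1
    rw [e2] at t2
    have t3 := (add_le_add_right t2 (A.D (p - ξ))).trans
      ((le_of_eq (add_assoc _ _ _).symm).trans t1)
    rw [← add_assoc] at t3
    exact le_of_add_le_add_right t3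
  have hmem : p - ξ ∈ A.C D := A.mem_C_of_D_add hv hadd
  have hξe : ξ ∈ A.sector p e := by
    have : e = D * A.w₀ := by rw [hDe, mul_assoc, A.w₀_sq, mul_one]
    rw [mem_sector, this, ← neg_sub, A.neg_mem_C_mul_w₀]
    exact hmem
  have hgξ := hB.agree_eq_sector hg hg₂ hgg₂ hpg₂ ξ hξe
  have hfin := hB.sector_eq hS hg₂ hf (hgξ.symm.trans hξ) (w := D) (by rwa [← hDe] at hg₂S)
    (has_sectorOf f D)
  have hPmem : h p ∈ g₂ '' A.sector ξ D := ⟨p, hmem, by rw [hhgp, hgg₂p]⟩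
  rw [hfin] at hPmem
  obtain ⟨y, -, hy⟩ := hPmem
  exact ⟨y, hy⟩

end Building
end GenAffineBuilding

/-! ### Root systems: Weyl group, heights and dominant vectors -/

namespace GenAffineBuilding

noncomputable section

set_option linter.unusedSectionVars false

section Roots

variable {ι : Type*} [Fintype ι] {F : Subfield ℝ} {M N : Type*}
  [AddCommGroup M] [Module F M] [AddCommGroup N] [Module F N]

/-- The spherical Weyl group, acting on the root space. -/
def weyl (P : RootPairing ι F M N) : Subgroup (M ≃ₗ[F] M) :=
  Subgroup.closure (Set.range P.reflection)

/-- The reflection in the `i`-th root as an element of the Weyl group. -/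
def weylRefl (P : RootPairing ι F M N) (i : ι) : weyl P :=
  ⟨P.reflection i, Subgroup.subset_closure ⟨i, rfl⟩⟩

variable (P : RootPairing ι F M N)

lemma weylRefl_smul (i : ι) (m : M) : weylRefl P i • m = P.reflection i m := rfl

lemma weylRefl_inj {i j : ι} : weylRefl P i = weylRefl P j ↔ P.reflection i = P.reflection j :=
  Subtype.ext_iff

lemma weylRefl_sq (i : ι) : weylRefl P i * weylRefl P i = 1 := by
  refine Subtype.ext ?_
  have := P.reflection_sq i
  rwa [sq] at this

lemma exists_weyl_perm (w : weyl P) : ∃ σ : Equiv.Perm ι, ∀ i, P.root (σ i) = w • P.root i ∧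
    (∀ m, P.coroot' (σ i) (w • m) = P.coroot' i m) ∧
    weylRefl P (σ i) = w * weylRefl P i * w⁻¹ := by
  obtain ⟨w, hw⟩ := w
  suffices h : ∃ σ : Equiv.Perm ι, ∀ i, P.root (σ i) = w (P.root i) ∧
      (∀ m, P.coroot' (σ i) (w m) = P.coroot' i m) ∧
      P.reflection (σ i) = w * P.reflection i * w⁻¹ by
    obtain ⟨σ, hσ⟩ := h
    exact ⟨σ, fun i => ⟨(hσ i).1, (hσ i).2.1, Subtype.ext (hσ i).2.2⟩⟩
  induction hw using Subgroup.closure_induction with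
  | mem x hx =>
    obtain ⟨j, rfl⟩ := hx
    refine ⟨P.reflectionPerm j, fun i => ⟨P.root_reflectionPerm j i, fun m => ?_, ?_⟩⟩
    · rw [P.coroot'_reflection, P.reflectionPerm_self]
    · rw [P.reflection_reflectionPerm, P.reflection_inv]
  | one => exact ⟨1, fun i => ⟨rfl, fun m => rfl, by simp⟩⟩
  | mul x y _ _ hx hy =>
    obtain ⟨σ, hσ⟩ := hx
    obtain ⟨τ, hτ⟩ := hy
    refine ⟨σ * τ, fun i => ⟨?_, fun m => ?_, ?_⟩⟩
    · rw [Equiv.Perm.mul_apply, (hσ _).1, (hτ _).1]; rfl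
    · rw [Equiv.Perm.mul_apply, LinearEquiv.mul_apply, (hσ _).2.1, (hτ _).2.1]
    · rw [Equiv.Perm.mul_apply, (hσ _).2.2, (hτ _).2.2]; group
  | inv x _ hx =>
    obtain ⟨σ, hσ⟩ := hx
    have hxx : ∀ m, x (x⁻¹ m) = m := fun m => x.apply_symm_apply m
    refine ⟨σ.symm, fun i => ⟨?_, fun m => ?_, ?_⟩⟩
    · have := (hσ (σ.symm i)).1
      rw [Equiv.apply_symm_apply] at this
      apply x.injective
      rw [hxx, this]
    · have := (hσ (σ.symm i)).2.1 (x⁻¹ m)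
      rw [Equiv.apply_symm_apply, hxx] at this
      exact this.symm
    · have := (hσ (σ.symm i)).2.2
      rw [Equiv.apply_symm_apply] at this
      rw [this]; group

instance finite_weyl [P.IsRootSystem] : Finite (weyl P) := by
  choose σ hσ using exists_weyl_perm P
  refine Finite.of_injective σ fun w w' h => ?_
  refine Subtype.ext (LinearEquiv.toLinearMap_injective ?_)
  refine LinearMap.ext_on (RootPairing.IsRootSystem.span_root_eq_top (P := P)) ?_
  rintro _ ⟨i, rfl⟩
  have h1 := (hσ w i).1
  have h2 := (hσ w' i).1
  rw [h] at h1
  exact h1.symm.trans h2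

lemma rootForm_root_pos (i : ι) : 0 < P.RootForm (P.root i) (P.root i) := by
  rw [P.rootForm_root_self]
  refine Finset.sum_pos' (fun j _ => mul_self_nonneg _) ⟨i, Finset.mem_univ i, ?_⟩
  rw [P.pairing_same]
  norm_num

lemma rootForm_mul_coroot' (i : ι) (x : M) :
    P.RootForm (P.root i) (P.root i) * P.coroot' i x = 2 * P.RootForm (P.root i) x := by
  have h := congrArg (P.toLinearMap x) (P.rootForm_self_smul_coroot i)
  rw [map_smul, map_nsmul, P.toLinearMap_apply_apply_Polarization] at h
  simpa using h

lemma coroot'_of_root_eq_smul {i j : ι} {c : F} (hc : c ≠ 0) (h : P.root j = c • P.root i) (x : M) :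
    P.coroot' j x = c⁻¹ * P.coroot' i x := by
  have h1 := rootForm_mul_coroot' P i x
  have h2 := rootForm_mul_coroot' P j x
  have h3 := (rootForm_root_pos P i).ne'
  rw [h] at h2
  simp only [map_smul, LinearMap.smul_apply, smul_eq_mul] at h2
  have h4 : c * (c * (P.RootForm (P.root i) (P.root i) * P.coroot' j x)) =
      c * (P.RootForm (P.root i) (P.root i) * P.coroot' i x) := by
    rw [h1]; linear_combination h2
  have h5 := mul_left_cancel₀ hc h4
  rw [eq_inv_mul_iff_mul_eq₀ hc]
  apply mul_left_cancel₀ h3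
  linear_combination h5

lemma reflection_eq_of_root_eq_smul {i j : ι} {c : F} (h : P.root j = c • P.root i) :
    P.reflection j = P.reflection i := by
  have hc : c ≠ 0 := by
    rintro rfl
    exact P.ne_zero j (by rw [h, zero_smul])
  ext x
  rw [P.reflection_apply, P.reflection_apply, coroot'_of_root_eq_smul P hc h, h, smul_smul]
  congr 2
  field_simp

lemma root_eq_smul_of_reflection_eq {i j : ι} (h : P.reflection j = P.reflection i) :
    P.root j = (P.coroot' i (P.root j) / 2) • P.root i := by
  have h1 := P.reflection_apply_self j
  rw [h, P.reflection_apply] at h1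
  have h2 : (2 : F) • P.root j = P.coroot' i (P.root j) • P.root i := by
    rw [two_smul]
    exact eq_neg_add_iff_add_eq.1 (sub_eq_iff_eq_add.1 h1)
  rw [div_eq_inv_mul, mul_smul, ← h2, smul_smul]
  norm_num

variable {P} (B : RootBasis P)

namespace RootBasis

lemma exists_height : ∃ φ : M →ₗ[F] F, ∀ k ∈ B.support, φ (P.root k) = 1 := by
  have hli : LinearIndependent F fun k : (B.support : Set ι) => P.root k := B.linearIndepOn_root
  obtain ⟨g, hg⟩ := LinearMap.exists_extend
    ((Module.Basis.span hli).constr F (fun _ => (1 : F)))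
  refine ⟨g, fun k hk => ?_⟩
  have h1 := Module.Basis.constr_basis (Module.Basis.span hli) F (fun _ => (1 : F)) ⟨k, hk⟩
  rw [← hg] at h1
  rwa [LinearMap.comp_apply, Submodule.subtype_apply, Module.Basis.span_apply] at h1

/-- A linear function with value `1` at the simple roots. -/
def height : M →ₗ[F] F := B.exists_height.choose

lemma height_simple {k : ι} (hk : k ∈ B.support) : B.height (P.root k) = 1 :=
  B.exists_height.choose_spec k hk

lemma height_pos {i : ι} (h : B.IsPos i) : 0 < B.height (P.root i) := by
  obtain ⟨c, hc, hi⟩ := h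
  have h1 : B.height (P.root i) = ∑ j ∈ B.support, c j := by
    rw [hi, map_sum]
    exact Finset.sum_congr rfl fun j hj => by rw [map_smul, B.height_simple hj, smul_eq_mul, mul_one]
  rw [h1]
  refine lt_of_le_of_ne (Finset.sum_nonneg fun j _ => hc j) fun h0 => ?_
  rw [eq_comm, Finset.sum_eq_zero_iff_of_nonneg fun j _ => hc j] at h0
  exact P.ne_zero i (by rw [hi]; exact Finset.sum_eq_zero fun j hj => by rw [h0 j hj, zero_smul])

lemma height_neg {i : ι} (h : ¬ B.IsPos i) : B.height (P.root i) < 0 := by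
  obtain ⟨c, hc, hi⟩ := (B.nonneg_or_nonpos i).resolve_left h
  have h1 : B.height (P.root i) = ∑ j ∈ B.support, c j := by
    rw [hi, map_sum]
    exact Finset.sum_congr rfl fun j hj => by rw [map_smul, B.height_simple hj, smul_eq_mul, mul_one]
  rw [h1]
  refine lt_of_le_of_ne (Finset.sum_nonpos fun j _ => hc j) fun h0 => ?_
  rw [Finset.sum_eq_zero_iff_of_nonpos fun j _ => hc j] at h0
  exact P.ne_zero i (by rw [hi]; exact Finset.sum_eq_zero fun j hj => by rw [h0 j hj, zero_smul])

lemma isPos_iff {i : ι} : B.IsPos i ↔ 0 < B.height (P.root i) :=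
  ⟨B.height_pos, fun h => by
    by_contra h'
    exact lt_asymm h (B.height_neg h')⟩

lemma isPos_simple {k : ι} (hk : k ∈ B.support) : B.IsPos k := by
  rw [isPos_iff, B.height_simple hk]; exact one_pos

lemma isPos_neg {i : ι} : B.IsPos (P.reflectionPerm i i) ↔ ¬ B.IsPos i := by
  have h1 : B.height (P.root (P.reflectionPerm i i)) = -B.height (P.root i) := by
    rw [P.root_reflectionPerm, P.reflection_apply_self, map_neg]
  constructor
  · intro h h'
    have := B.height_pos h
    rw [h1] at this
    exact lt_asymm (B.height_pos h') (neg_pos.1 this)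
  · intro h
    rw [isPos_iff, h1]
    exact neg_pos.2 (B.height_neg h)

lemma coroot'_neg (i : ι) (x : M) : P.coroot' (P.reflectionPerm i i) x = -P.coroot' i x := by
  rw [P.coroot'_reflectionPerm, LinearMap.comp_apply, LinearEquiv.coe_coe, P.reflection_apply,
    map_sub, map_smul, P.root_coroot'_eq_pairing, P.pairing_same, smul_eq_mul]
  ring

/-- Crossing the wall of a simple root keeps all other positive roots positive. -/
lemma isPos_reflectionPerm {k j : ι} (hk : k ∈ B.support) (hj : B.IsPos j)
    (hjk : P.reflection j ≠ P.reflection k) : B.IsPos (P.reflectionPerm k j) := by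
  classical
  obtain ⟨c, hc, hcj⟩ := hj
  have hex : ∃ l ∈ B.support, l ≠ k ∧ 0 < c l := by
    by_contra hcon
    push Not at hcon
    apply hjk
    refine reflection_eq_of_root_eq_smul P (c := c k) ?_
    rw [hcj]
    refine Finset.sum_eq_single_of_mem k hk fun l hl hlk => ?_
    rw [le_antisymm (hcon l hl hlk) (hc l), zero_smul]
  obtain ⟨l, hl, hlk, hcl⟩ := hex
  refine (B.nonneg_or_nonpos _).resolve_right ?_
  rintro ⟨d, hd, hdj⟩
  -- The reflection changes only the coefficient of `k`, so the positive coefficient at `l ≠ k`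
  -- survives and contradicts `d l ≤ 0`.
  have h1 : ∑ m ∈ B.support, (c m - d m - if m = k then P.pairing j k else 0) • P.root m = 0 := by
    simp only [sub_smul, Finset.sum_sub_distrib, ite_smul, zero_smul, Finset.sum_ite_eq',
      hk, if_true]
    rw [← hcj, ← hdj, P.root_reflectionPerm, P.reflection_apply, P.root_coroot'_eq_pairing]
    abel
  have h2 := linearIndepOn_finset_iff.1 B.linearIndepOn_root _ h1 l hl
  rw [if_neg hlk, sub_zero, sub_eq_zero] at h2
  exact absurd (hd l) (not_le.2 (h2 ▸ hcl))

/-- Coroots are not linear in the roots, but each is a positive multiple of `P.RootForm` paired with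
its root. Positivity is therefore transferred to the form, expanded over the simple roots, and
transferred back. -/
lemma coroot'_pos_of_simple {x : M} (h : ∀ k ∈ B.support, 0 < P.coroot' k x) {i : ι}
    (hi : B.IsPos i) : 0 < P.coroot' i x := by
  have hform : ∀ k ∈ B.support, 0 < P.RootForm (P.root k) x := fun k hk => by
    have h1 := rootForm_mul_coroot' P k x
    have h2 := mul_pos (rootForm_root_pos P k) (h k hk)
    rw [h1] at h2
    exact pos_of_mul_pos_right h2 zero_le_two
  obtain ⟨c, hc, hci⟩ := id hi
  have h3 : P.RootForm (P.root i) x = ∑ k ∈ B.support, c k * P.RootForm (P.root k) x := by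
    rw [hci, map_sum, LinearMap.sum_apply]
    exact Finset.sum_congr rfl fun k _ => by rw [map_smul, LinearMap.smul_apply, smul_eq_mul]
  have h4 : 0 < P.RootForm (P.root i) x := by
    rw [h3]
    refine lt_of_le_of_ne (Finset.sum_nonneg fun k hk => mul_nonneg (hc k) (hform k hk).le)
      fun h0 => ?_
    rw [eq_comm, Finset.sum_eq_zero_iff_of_nonneg fun k hk => mul_nonneg (hc k) (hform k hk).le]
      at h0
    refine P.ne_zero i ?_
    rw [hci]
    refine Finset.sum_eq_zero fun k hk => ?_
    rw [(mul_eq_zero.1 (h0 k hk)).resolve_right (hform k hk).ne', zero_smul]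
  have h5 := rootForm_mul_coroot' P i x
  have h6 : 0 < P.RootForm (P.root i) (P.root i) * P.coroot' i x := by
    rw [h5]; exact mul_pos two_pos h4
  exact pos_of_mul_pos_right h6 (rootForm_root_pos P i).le

variable [P.IsRootSystem]

/-- The vector dual to the height under the nondegenerate root form pairs to `1` with every simple
root. -/
lemma exists_dominant : ∃ m : M, ∀ k ∈ B.support, 0 < P.coroot' k m := by
  have : Module.Finite F M := by
    refine ⟨⟨(Set.finite_range P.root).toFinset, ?_⟩⟩
    rw [Set.Finite.coe_toFinset]
    exact RootPairing.IsRootSystem.span_root_eq_top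
  obtain ⟨m, hm⟩ := (LinearMap.BilinForm.toDual P.RootForm P.rootForm_nondegenerate).surjective
    B.height
  refine ⟨m, fun k hk => ?_⟩
  have h1 : P.RootForm m (P.root k) = 1 := by
    rw [← LinearMap.BilinForm.toDual_def (B := P.RootForm) P.rootForm_nondegenerate, hm,
      B.height_simple hk]
  have h2 : P.RootForm (P.root k) m = 1 := by
    rw [← h1, P.rootForm_apply_apply, P.rootForm_apply_apply]
    exact Finset.sum_congr rfl fun i _ => mul_comm _ _
  have h3 := rootForm_mul_coroot' P k m
  rw [h2, mul_one] at h3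
  exact pos_of_mul_pos_right (h3 ▸ two_pos) (rootForm_root_pos P k).le

/-- A regular dominant vector. -/
def dominant : M := B.exists_dominant.choose

lemma dominant_pos {i : ι} (h : B.IsPos i) : 0 < P.coroot' i B.dominant :=
  B.coroot'_pos_of_simple B.exists_dominant.choose_spec h

lemma isPos_iff_dominant {i : ι} : B.IsPos i ↔ 0 < P.coroot' i B.dominant := by
  refine ⟨B.dominant_pos, fun h => ?_⟩
  by_contra h'
  have := B.dominant_pos (B.isPos_neg.2 h')
  rw [coroot'_neg] at this
  exact lt_asymm h (neg_pos.1 this)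

lemma dominant_ne (i : ι) : P.coroot' i B.dominant ≠ 0 := by
  by_cases h : B.IsPos i
  · exact (B.dominant_pos h).ne'
  · have := B.dominant_pos (B.isPos_neg.2 h)
    rw [coroot'_neg] at this
    exact (neg_pos.1 this).ne

end RootBasis

end Roots

end

end GenAffineBuilding

/-! ### Free action of the Weyl group and recognition of adjacent chambers -/

namespace GenAffineBuilding

noncomputable section

set_option linter.unusedSectionVars false

section Transitivity

variable {ι : Type*} [Fintype ι] {F : Subfield ℝ} {M N : Type*}
  [AddCommGroup M] [Module F M] [AddCommGroup N] [Module F N]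
  {P : RootPairing ι F M N} (B : RootBasis P)

lemma exists_eq_root_of_smul (w : weyl P) (i : ι) : ∃ j, P.root j = w • P.root i ∧
    (∀ m, P.coroot' j m = P.coroot' i (w⁻¹ • m)) ∧ weylRefl P j = w * weylRefl P i * w⁻¹ := by
  obtain ⟨σ, hσ⟩ := exists_weyl_perm P w
  refine ⟨σ i, (hσ i).1, fun m => ?_, (hσ i).2.2⟩
  have := (hσ i).2.1 (w⁻¹ • m)
  rwa [smul_inv_smul] at this

namespace RootBasis

/-- The elements of the Weyl group that are products of simple reflections. -/
def simpleGroup : Subgroup (weyl P) where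
  carrier := {w | ∃ l : List ι, (∀ k ∈ l, k ∈ B.support) ∧ (l.map (weylRefl P)).prod = w}
  one_mem' := ⟨[], by simp, rfl⟩
  mul_mem' := by
    rintro _ _ ⟨l, hl, rfl⟩ ⟨l', hl', rfl⟩
    refine ⟨l ++ l', fun k hk => ?_, by simp⟩
    exact (List.mem_append.1 hk).elim (hl k) (hl' k)
  inv_mem' := by
    rintro _ ⟨l, hl, rfl⟩
    refine ⟨l.reverse, fun k hk => hl k (List.mem_reverse.1 hk), ?_⟩
    have : (fun k => (weylRefl P k)⁻¹) = weylRefl P :=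
      funext fun k => inv_eq_of_mul_eq_one_left (weylRefl_sq P k)
    rw [List.prod_inv_reverse, List.map_reverse, List.map_map]
    change _ = (List.map (fun k => (weylRefl P k)⁻¹) l).reverse.prod
    rw [this]

lemma weylRefl_mem_simpleGroup {k : ι} (hk : k ∈ B.support) : weylRefl P k ∈ B.simpleGroup :=
  ⟨[k], by simpa using hk, by simp⟩

lemma exists_pos_reflection_eq (i : ι) : ∃ j, B.IsPos j ∧ weylRefl P j = weylRefl P i := by
  by_cases h : B.IsPos i
  · exact ⟨i, h, rfl⟩
  · refine ⟨_, B.isPos_neg.2 h, ?_⟩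
    rw [weylRefl_inj]
    refine reflection_eq_of_root_eq_smul P (c := -1) ?_
    rw [P.root_reflectionPerm, P.reflection_apply_self, neg_smul, one_smul]

/-- Among the positive roots whose reflection is conjugate to the given one under `B.simpleGroup`,
take one of least height. Were its wall not simple, no simple reflection could lower its height, so
it would have nonpositive product with all simple roots and hence with itself. -/
lemma weylRefl_mem_simpleGroup' (i : ι) : weylRefl P i ∈ B.simpleGroup := by
  obtain ⟨i₀, hi₀, hi₀r⟩ := B.exists_pos_reflection_eq i
  let s : Set ι := {j | B.IsPos j ∧ ∃ h ∈ B.simpleGroup, weylRefl P j = h * weylRefl P i * h⁻¹}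
  obtain ⟨j, ⟨hj, h, hh, hjh⟩, hmin⟩ := Set.exists_min_image s (fun j => B.height (P.root j))
    (Set.toFinite s) ⟨i₀, hi₀, 1, one_mem _, by simpa using hi₀r⟩
  have hi : weylRefl P i = h⁻¹ * weylRefl P j * h := by rw [hjh]; group
  suffices hs : ∃ k ∈ B.support, weylRefl P j = weylRefl P k by
    obtain ⟨k, hk, hjk⟩ := hs
    rw [hi, hjk]
    exact mul_mem (mul_mem (inv_mem hh) (B.weylRefl_mem_simpleGroup hk)) hh
  by_contra hcon
  push Not at hcon
  have hle : ∀ k ∈ B.support, P.RootForm (P.root k) (P.root j) ≤ 0 := by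
    intro k hk
    have hpos := B.isPos_reflectionPerm hk hj fun e => hcon k hk ((weylRefl_inj P).2 e)
    have h1 := hmin (P.reflectionPerm k j) ⟨hpos, weylRefl P k * h,
      mul_mem (B.weylRefl_mem_simpleGroup hk) hh, by
        have : weylRefl P (P.reflectionPerm k j) =
            weylRefl P k * weylRefl P j * (weylRefl P k)⁻¹ := by
          refine Subtype.ext ?_
          exact (P.reflection_reflectionPerm).trans (by rw [← P.reflection_inv k]; rfl)
        rw [this, hjh]; group⟩
    rw [P.root_reflectionPerm, P.reflection_apply, map_sub, map_smul, B.height_simple hk,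
      smul_eq_mul, mul_one] at h1
    have h2 : P.coroot' k (P.root j) ≤ 0 := by linarith
    have h3 := rootForm_mul_coroot' P k (P.root j)
    have h4 := mul_nonpos_of_nonneg_of_nonpos (rootForm_root_pos P k).le h2
    rw [h3] at h4
    linarith
  obtain ⟨c, hc, hcj⟩ := id hj
  have h5 : P.RootForm (P.root j) (P.root j) ≤ 0 := by
    have h6 := congrArg (fun x => P.RootForm x (P.root j)) hcj
    simp only [map_sum, LinearMap.sum_apply] at h6
    rw [h6]
    refine Finset.sum_nonpos fun k hk => ?_
    rw [map_smul, LinearMap.smul_apply, smul_eq_mul]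
    exact mul_nonpos_of_nonneg_of_nonpos (hc k) (hle k hk)
  exact absurd (rootForm_root_pos P j) (not_lt.2 h5)

lemma exists_list_prod_eq (w : weyl P) :
    ∃ l : List ι, (∀ k ∈ l, k ∈ B.support) ∧ (l.map (weylRefl P)).prod = w := by
  have h : weyl P ≤ B.simpleGroup.map (weyl P).subtype := by
    refine (Subgroup.closure_le _).2 ?_
    rintro _ ⟨i, rfl⟩
    exact ⟨weylRefl P i, B.weylRefl_mem_simpleGroup' i, rfl⟩
  obtain ⟨w', hw', e⟩ := h w.2
  rwa [Subtype.ext e] at hw'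

/-- Apply the word to the simple root from the right. The letter that first makes it negative must
be the reflection in the root reached so far, and multiplying by `weylRefl P k` cancels that letter.
-/
lemma exchange {l : List ι} (hl : ∀ a ∈ l, a ∈ B.support) {k : ι} (hk : k ∈ B.support)
    (hneg : B.height ((l.map (weylRefl P)).prod • P.root k) < 0) :
    ∃ l' : List ι, (∀ a ∈ l', a ∈ B.support) ∧ l'.length + 1 = l.length ∧
      (l.map (weylRefl P)).prod * weylRefl P k = (l'.map (weylRefl P)).prod := by
  induction l with
  | nil =>
    rw [List.map_nil, List.prod_nil, one_smul, B.height_simple hk] at hneg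
    exact absurd hneg (not_lt.2 zero_le_one)
  | cons a l ih =>
    have hl' : ∀ a ∈ l, a ∈ B.support := fun b hb => hl b (List.mem_cons_of_mem _ hb)
    have ha : a ∈ B.support := hl a List.mem_cons_self
    obtain ⟨j, hj, -, hjr⟩ := exists_eq_root_of_smul (l.map (weylRefl P)).prod k
    by_cases hpos : B.IsPos j
    · refine ⟨l, hl', rfl, ?_⟩
      have hja : weylRefl P j = weylRefl P a := by
        by_contra hne
        have := B.height_pos
          (B.isPos_reflectionPerm ha hpos fun e => hne ((weylRefl_inj P).2 e))
        rw [P.root_reflectionPerm, hj] at this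
        rw [List.map_cons, List.prod_cons, mul_smul, weylRefl_smul] at hneg
        exact lt_asymm hneg this
      rw [List.map_cons, List.prod_cons, ← hja, hjr]
      simp only [mul_assoc, inv_mul_cancel_left, weylRefl_sq, mul_one]
    · obtain ⟨l', h1, h2, h3⟩ := ih hl' (by rw [← hj]; exact B.height_neg hpos)
      refine ⟨a :: l', ?_, by simp [h2], ?_⟩
      · intro b hb
        rcases List.mem_cons.1 hb with rfl | hb
        exacts [ha, h1 b hb]
      · rw [List.map_cons, List.prod_cons, mul_assoc, h3, List.map_cons, List.prod_cons]

/-- In a nonempty word, the part before the last letter `k` sends the root of `k` to a negative one;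
`exchange` then yields an equal word with two letters fewer. -/
lemma prod_eq_one (n : ℕ) : ∀ l : List ι, l.length = n → (∀ a ∈ l, a ∈ B.support) →
    (∀ k ∈ B.support, 0 < B.height ((l.map (weylRefl P)).prod • P.root k)) →
    (l.map (weylRefl P)).prod = 1 := by
  induction n using Nat.strong_induction_on with
  | _ n ih =>
    intro l hn hl hpos
    rcases List.eq_nil_or_concat' l with rfl | ⟨l₀, k, rfl⟩
    · rfl
    · have hk : k ∈ B.support := hl k (by simp)
      have hl₀ : ∀ a ∈ l₀, a ∈ B.support := fun a ha => hl a (by simp [ha])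
      have e : ((l₀ ++ [k]).map (weylRefl P)).prod =
          (l₀.map (weylRefl P)).prod * weylRefl P k := by simp
      have hneg : B.height ((l₀.map (weylRefl P)).prod • P.root k) < 0 := by
        have := hpos k hk
        rw [e, mul_smul, weylRefl_smul, P.reflection_apply_self, smul_neg, map_neg] at this
        exact neg_pos.1 this
      obtain ⟨l', h1, h2, h3⟩ := B.exchange hl₀ hk hneg
      rw [e, h3]
      rw [e, h3] at hpos
      refine ih l'.length ?_ l' rfl h1 hpos
      rw [← hn, List.length_append, ← h2]
      simp

variable [P.IsRootSystem]

/-- The Weyl group acts freely on its chambers. -/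
lemma eq_one_of_dominant {w : weyl P}
    (h : ∀ i, B.IsPos i → 0 < P.coroot' i (w • B.dominant)) : w = 1 := by
  obtain ⟨l, hl, hlw⟩ := B.exists_list_prod_eq w⁻¹
  rw [← inv_eq_one, ← hlw]
  refine B.prod_eq_one _ l rfl hl fun k hk => ?_
  obtain ⟨j, hj, hj', -⟩ := exists_eq_root_of_smul w⁻¹ k
  rw [hlw, ← hj, ← isPos_iff, isPos_iff_dominant, hj', inv_inv]
  exact h k (B.isPos_simple hk)

lemma exists_simple_neg {w : weyl P} (hw : w ≠ 1) :
    ∃ k ∈ B.support, P.coroot' k (w • B.dominant) < 0 := by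
  by_contra hcon
  push Not at hcon
  refine hw (B.eq_one_of_dominant fun i hi => B.coroot'_pos_of_simple (fun k hk => ?_) hi)
  refine lt_of_le_of_ne (hcon k hk) fun h0 => ?_
  obtain ⟨j, -, hj', -⟩ := exists_eq_root_of_smul w⁻¹ k
  have := hj' B.dominant
  rw [inv_inv, ← h0] at this
  exact B.dominant_ne j this

lemma coroot'_weyl_dominant_ne (w : weyl P) (i : ι) : P.coroot' i (w • B.dominant) ≠ 0 := by
  obtain ⟨j, -, hj', -⟩ := exists_eq_root_of_smul w⁻¹ i
  have := hj' B.dominant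
  rw [inv_inv] at this
  rw [← this]
  exact B.dominant_ne j

/-- The linear function which agrees with the sum of all `|⟨x, αᵢ^∨⟩|` on the chamber in
direction `w`. -/
def sumAbs (w : weyl P) : M →ₗ[F] F :=
  ∑ j, if 0 < P.coroot' j (w • B.dominant) then P.coroot' j else -P.coroot' j

lemma sumAbs_apply (w : weyl P) (m : M) : B.sumAbs w m =
    ∑ j, if 0 < P.coroot' j (w • B.dominant) then P.coroot' j m else -P.coroot' j m := by
  rw [sumAbs, LinearMap.sum_apply]
  refine Finset.sum_congr rfl fun j _ => ?_
  split_ifs <;> rfl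

lemma sumAbs_le (w : weyl P) (m : M) : B.sumAbs w m ≤ ∑ j, |P.coroot' j m| := by
  rw [sumAbs_apply]
  refine Finset.sum_le_sum fun j _ => ?_
  split_ifs
  exacts [le_abs_self _, neg_le_abs _]

lemma sumAbs_dominant (w : weyl P) :
    B.sumAbs w (w • B.dominant) = ∑ j, |P.coroot' j (w • B.dominant)| := by
  rw [sumAbs_apply]
  refine Finset.sum_congr rfl fun j _ => ?_
  split_ifs with h
  exacts [(abs_of_pos h).symm, (abs_of_nonpos (not_lt.1 h)).symm]

lemma sumAbs_mul (u w : weyl P) (m : M) : B.sumAbs (u * w) (u • m) = B.sumAbs w m := by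
  obtain ⟨σ, hσ⟩ := exists_weyl_perm P u
  rw [sumAbs_apply, sumAbs_apply, ← Equiv.sum_comp σ]
  refine Finset.sum_congr rfl fun j _ => ?_
  rw [mul_smul, (hσ j).2.1, (hσ j).2.1]

/-- Termwise, `B.sumAbs w` is at most the sum of absolute values, which `B.sumAbs w'` attains at `w'
• B.dominant`. Equality there forces all signs to agree, and the action is free. -/
lemma eq_of_sumAbs_eq {w w' : weyl P}
    (h : B.sumAbs w (w' • B.dominant) = B.sumAbs w' (w' • B.dominant)) : w = w' := by
  rw [sumAbs_dominant, sumAbs_apply, Finset.sum_eq_sum_iff_of_le] at h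
  · rw [← mul_right_inj w⁻¹, inv_mul_cancel, eq_comm]
    refine B.eq_one_of_dominant fun i hi => ?_
    obtain ⟨σ, hσ⟩ := exists_weyl_perm P w
    have h1 := h (σ i) (Finset.mem_univ _)
    rw [(hσ i).2.1, if_pos (B.dominant_pos hi)] at h1
    rw [mul_smul, ← (hσ i).2.1, smul_inv_smul, h1]
    exact abs_pos.2 (B.coroot'_weyl_dominant_ne w' _)
  · intro j _
    split_ifs
    exacts [le_abs_self _, neg_le_abs _]

/-- The difference of the two functions is a multiple of the coroot of `i`. By maximality it is
nonpositive at `w • B.dominant` and nonnegative at `w' • B.dominant`; as the coroot has the same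
sign at both points, the difference is zero. -/
lemma eq_of_sumAbs_eq_of_ker {w w' : weyl P} {i : ι}
    (hs : 0 < P.coroot' i (w • B.dominant) * P.coroot' i (w' • B.dominant))
    (h : ∀ m, P.coroot' i m = 0 → B.sumAbs w' m = B.sumAbs w m) : w = w' := by
  set Δ := B.sumAbs w' - B.sumAbs w with hΔ
  have hΔm : ∀ m, Δ m = P.coroot' i m * (Δ (P.root i) / 2) := by
    intro m
    have h1 := h (m - (P.coroot' i m / 2) • P.root i) (by
      rw [map_sub, map_smul, P.root_coroot'_eq_pairing, P.pairing_same, smul_eq_mul]; ring)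
    have h2 : Δ (m - (P.coroot' i m / 2) • P.root i) = 0 := by
      rw [hΔ, LinearMap.sub_apply, h1, sub_self]
    rw [map_sub, map_smul, smul_eq_mul] at h2
    linear_combination h2
  have h1 : Δ (w • B.dominant) ≤ 0 := by
    rw [hΔ, LinearMap.sub_apply, sub_nonpos, B.sumAbs_dominant w]
    exact B.sumAbs_le w' _
  have h2 : 0 ≤ Δ (w' • B.dominant) := by
    rw [hΔ, LinearMap.sub_apply, sub_nonneg, B.sumAbs_dominant w']
    exact B.sumAbs_le w _
  have h3 : Δ (w' • B.dominant) = 0 := by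
    refine le_antisymm ?_ h2
    by_contra hlt
    rw [not_le] at hlt
    rw [hΔm] at h1 hlt
    have h4 := mul_nonpos_of_nonpos_of_nonneg h1 hlt.le
    have h5 : 0 < Δ (P.root i) / 2 * (Δ (P.root i) / 2) := by
      refine mul_self_pos.2 fun h0 => ?_
      rw [h0, mul_zero] at hlt
      exact lt_irrefl _ hlt
    have h6 := mul_pos hs h5
    refine absurd h6 (not_lt.2 (le_of_eq_of_le ?_ h4))
    ring
  refine B.eq_of_sumAbs_eq ?_
  rw [hΔ, LinearMap.sub_apply, sub_eq_zero] at h3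
  exact h3.symm

/-- Functions `sumAbs` agreeing on a panel of a simple root belong to adjacent chambers. -/
lemma eq_or_eq_of_sumAbs_eq {i : ι}
    (hi : ∀ j, B.IsPos j → weylRefl P j ≠ weylRefl P i →
      0 < P.coroot' j (weylRefl P i • B.dominant)) {w w' : weyl P}
    (h : ∀ m, (∀ j, B.IsPos j → 0 ≤ P.coroot' j m) →
      (∀ j, 0 < P.coroot' j (weylRefl P i • B.dominant) → 0 ≤ P.coroot' j m) →
      B.sumAbs w' m = B.sumAbs w m) : w' = w ∨ w' = weylRefl P i * w := by
  have hprop : ∀ j, weylRefl P j = weylRefl P i → ∀ m, P.coroot' i m = 0 →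
      P.coroot' j m = 0 := by
    intro j hj m hm
    have h1 := root_eq_smul_of_reflection_eq P ((weylRefl_inj P).1 hj)
    have hc : P.coroot' i (P.root j) / 2 ≠ 0 := fun h0 => P.ne_zero j (by rw [h1, h0, zero_smul])
    rw [coroot'_of_root_eq_smul P hc h1, hm, mul_zero]
  have hrefl : ∀ m, P.coroot' i (weylRefl P i • m) = -P.coroot' i m := by
    intro m
    rw [weylRefl_smul, P.reflection_apply, map_sub, map_smul, P.root_coroot'_eq_pairing,
      P.pairing_same, smul_eq_mul]
    ring
  have hi' : ∀ j, 0 < P.coroot' j (weylRefl P i • B.dominant) → weylRefl P j ≠ weylRefl P i →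
      B.IsPos j := by
    intro j hj hjr
    by_contra hneg
    have hr : weylRefl P (P.reflectionPerm j j) = weylRefl P j := by
      rw [weylRefl_inj]
      refine reflection_eq_of_root_eq_smul P (c := -1) ?_
      rw [P.root_reflectionPerm, P.reflection_apply_self, neg_smul, one_smul]
    have := hi _ (B.isPos_neg.2 hneg) (by rwa [hr])
    rw [coroot'_neg] at this
    exact lt_asymm hj (neg_pos.1 this)
  set m₁ := B.dominant + weylRefl P i • B.dominant with hm₁
  have hm₁i : P.coroot' i m₁ = 0 := by rw [hm₁, map_add, hrefl, add_neg_cancel]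
  have hker : ∀ m, P.coroot' i m = 0 → B.sumAbs w' m = B.sumAbs w m := by
    intro m hm
    -- The vector `m₁` is in the relative interior of the panel, so a large multiple of it carries
    -- any vector of the wall into the panel. Hence equality on the panel extends to the whole wall.
    obtain ⟨t, ht, htm⟩ : ∃ t : F, 0 ≤ t ∧ ∀ j, B.IsPos j → weylRefl P j ≠ weylRefl P i →
        0 ≤ P.coroot' j (t • m₁ + m) := by
      refine ⟨∑ j, |P.coroot' j m / P.coroot' j m₁|, Finset.sum_nonneg fun _ _ => abs_nonneg _,
        fun j hj hjr => ?_⟩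
      have hpos : 0 < P.coroot' j m₁ := by
        rw [hm₁, map_add]; exact add_pos (B.dominant_pos hj) (hi j hj hjr)
      have h1 : |P.coroot' j m / P.coroot' j m₁| ≤ ∑ j, |P.coroot' j m / P.coroot' j m₁| :=
        Finset.single_le_sum (f := fun j => |P.coroot' j m / P.coroot' j m₁|)
          (fun _ _ => abs_nonneg _) (Finset.mem_univ j)
      have h2 := mul_le_mul_of_nonneg_right ((neg_le_abs _).trans h1) hpos.le
      rw [neg_mul, div_mul_cancel₀ _ hpos.ne'] at h2
      rw [map_add, map_smul, smul_eq_mul]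
      linarith
    have key : ∀ m', P.coroot' i m' = 0 → (∀ j, B.IsPos j → weylRefl P j ≠ weylRefl P i →
        0 ≤ P.coroot' j m') → B.sumAbs w' m' = B.sumAbs w m' := by
      intro m' h0 hm'
      refine h m' (fun j hj => ?_) fun j hj => ?_
      · by_cases hr : weylRefl P j = weylRefl P i
        exacts [(hprop j hr m' h0).ge, hm' j hj hr]
      · by_cases hr : weylRefl P j = weylRefl P i
        exacts [(hprop j hr m' h0).ge, hm' j (hi' j hj hr) hr]
    have h1 := key (t • m₁ + m) (by rw [map_add, map_smul, hm₁i, hm, smul_zero, add_zero]) htm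
    have h2 := key m₁ hm₁i fun j hj hjr => by
      rw [hm₁, map_add]; exact (add_pos (B.dominant_pos hj) (hi j hj hjr)).le
    rw [map_add, map_add, map_smul, map_smul, h2] at h1
    exact add_left_cancel h1
  rcases lt_or_gt_of_ne (mul_ne_zero (B.coroot'_weyl_dominant_ne w i)
    (B.coroot'_weyl_dominant_ne w' i)) with hs | hs
  · right
    refine (B.eq_of_sumAbs_eq_of_ker (i := i) ?_ fun m hm => ?_).symm
    · rw [mul_smul, hrefl, neg_mul]
      exact neg_pos.2 hs
    · have hfix : weylRefl P i • m = m := by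
        rw [weylRefl_smul, P.reflection_apply, hm, zero_smul, sub_zero]
      have := B.sumAbs_mul (weylRefl P i) w m
      rw [hfix] at this
      rw [this]
      exact hker m hm
  · left
    exact (B.eq_of_sumAbs_eq_of_ker hs hker).symm

end RootBasis

end Transitivity

end

end GenAffineBuilding

/-! ### The model space as an abstract apartment -/

namespace GenAffineBuilding

noncomputable section

set_option linter.unusedSectionVars false

section OrderedModule

variable {F : Subfield ℝ} {Λ : Type*} [AddCommGroup Λ] [LinearOrder Λ] [IsOrderedAddMonoid Λ]
  [Module F Λ] [IsOrderedModule F Λ]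

instance posSMulStrictMono_of_isOrderedModule : PosSMulStrictMono F Λ where
  smul_lt_smul_of_pos_left c hc a b hab := by
    have h1 : 0 ≤ c • (b - a) := smul_nonneg hc.le (sub_nonneg.2 hab.le)
    have h2 : c • (b - a) ≠ 0 := smul_ne_zero hc.ne' (sub_ne_zero.2 hab.ne')
    have h3 := lt_of_le_of_ne h1 h2.symm
    rwa [smul_sub, sub_pos] at h3

lemma pos_smul_iff {c : F} {l : Λ} (hl : 0 < l) : 0 < c • l ↔ 0 < c := by
  refine ⟨fun h => ?_, fun h => smul_pos h hl⟩
  by_contra hc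
  have := smul_nonneg (neg_nonneg.2 (not_lt.1 hc)) hl.le
  rw [neg_smul, neg_nonneg] at this
  exact not_lt.2 this h

end OrderedModule

section Model

variable {ι : Type*} [Fintype ι] {F : Subfield ℝ} {M N Λ : Type*}
  [AddCommGroup M] [Module F M] [AddCommGroup N] [Module F N]
  [AddCommGroup Λ] [Module F Λ] {P : RootPairing ι F M N}

instance weylDistribMulAction : DistribMulAction (weyl P) (M ⊗[F] Λ) :=
  TensorProduct.leftDistribMulAction

instance weylMulAction : MulAction (weyl P) (M ⊗[F] Λ) :=
  weylDistribMulAction.toMulAction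

lemma coev_tmul (i : ι) (m : M) (l : Λ) : coev P Λ i (m ⊗ₜ l) = P.coroot' i m • l := by
  simp [coev]

lemma coev_smul_of {i j : ι} {w : weyl P} (h : ∀ m, P.coroot' j (w • m) = P.coroot' i m)
    (v : M ⊗[F] Λ) : coev P Λ j (w • v) = coev P Λ i v := by
  induction v with
  | zero => rw [smul_zero, map_zero, map_zero]
  | tmul m l => rw [TensorProduct.smul_tmul', coev_tmul, coev_tmul, h]
  | add x y hx hy => rw [smul_add, map_add, map_add, hx, hy]

lemma weylRefl_smul_eq (i : ι) (v : M ⊗[F] Λ) :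
    weylRefl P i • v = v - P.root i ⊗ₜ coev P Λ i v := by
  induction v with
  | zero => simp
  | tmul m l =>
    rw [TensorProduct.smul_tmul', weylRefl_smul, P.reflection_apply, TensorProduct.sub_tmul,
      coev_tmul, TensorProduct.smul_tmul]
  | add x y hx hy => rw [smul_add, map_add, TensorProduct.tmul_add, hx, hy]; abel

lemma coev_weylRefl_smul (i : ι) (v : M ⊗[F] Λ) :
    coev P Λ i (weylRefl P i • v) = -coev P Λ i v := by
  rw [weylRefl_smul_eq, map_sub, coev_tmul, P.root_coroot'_eq_pairing, P.pairing_same, two_smul]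
  abel

lemma coev_of_root_eq_smul {i j : ι} {c : F} (hc : c ≠ 0) (h : P.root j = c • P.root i)
    (v : M ⊗[F] Λ) : coev P Λ j v = c⁻¹ • coev P Λ i v := by
  induction v with
  | zero => simp
  | tmul m l => rw [coev_tmul, coev_tmul, coroot'_of_root_eq_smul P hc h, mul_smul]
  | add x y hx hy => rw [map_add, map_add, smul_add, hx, hy]

/-- If the kernel of the first coroot were contained in that of the second, the coroots would be
proportional, hence also the roots by nondegeneracy of the form, and the reflections would coincide.
So some `m₀` in the first kernel allows the second value to be adjusted freely. -/
lemma exists_coroot'_eq [P.IsRootSystem] {i j : ι} (h : P.reflection i ≠ P.reflection j) :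
    ∃ m, P.coroot' i m = 1 ∧ P.coroot' j m = -1 := by
  obtain ⟨m₀, h₀, h₀'⟩ : ∃ m, P.coroot' i m = 0 ∧ P.coroot' j m ≠ 0 := by
    by_contra hcon
    push Not at hcon
    apply h
    have h1 : ∀ m, P.coroot' j m = P.coroot' i m * (P.coroot' j (P.root i) / 2) := by
      intro m
      have := hcon (m - (P.coroot' i m / 2) • P.root i) (by
        rw [map_sub, map_smul, P.root_coroot'_eq_pairing, P.pairing_same, smul_eq_mul]; ring)
      rw [map_sub, map_smul, smul_eq_mul] at this
      linear_combination this
    have hi := (rootForm_root_pos P i).ne'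
    set d := P.RootForm (P.root j) (P.root j) * (P.coroot' j (P.root i) / 2) /
      P.RootForm (P.root i) (P.root i) with hd
    refine (reflection_eq_of_root_eq_smul P (c := d) ?_).symm
    rw [← sub_eq_zero]
    refine P.rootForm_nondegenerate.1 _ fun m => ?_
    have h2 := rootForm_mul_coroot' P i m
    have h3 := rootForm_mul_coroot' P j m
    rw [h1] at h3
    rw [map_sub, map_smul, LinearMap.sub_apply, LinearMap.smul_apply, smul_eq_mul]
    have h4 : d * P.RootForm (P.root i) (P.root i) =
        P.RootForm (P.root j) (P.root j) * (P.coroot' j (P.root i) / 2) := div_mul_cancel₀ _ hi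
    have h5 : (2 : F) * (P.RootForm (P.root j) m - d * P.RootForm (P.root i) m) = 0 := by
      linear_combination (-1 : F) * h3 + d * h2 - P.coroot' i m * h4
    exact (mul_eq_zero.1 h5).resolve_left two_ne_zero
  refine ⟨(2⁻¹ : F) • P.root i + ((-1 - 2⁻¹ * P.coroot' j (P.root i)) / P.coroot' j m₀) • m₀,
    ?_, ?_⟩
  · rw [map_add, map_smul, map_smul, h₀, P.root_coroot'_eq_pairing, P.pairing_same, smul_eq_mul,
      smul_zero, add_zero, inv_mul_cancel₀ two_ne_zero]
  · rw [map_add, map_smul, map_smul, smul_eq_mul, smul_eq_mul, div_mul_cancel₀ _ h₀']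
    ring

lemma exists_weyl_of_mem_sphericalWeyl {g : M ⊗[F] Λ ≃ₗ[F] M ⊗[F] Λ}
    (hg : g ∈ sphericalWeyl P Λ) : ∃ w : weyl P, ∀ x, g x = w • x := by
  induction hg using Subgroup.closure_induction with
  | mem g hg =>
    obtain ⟨i, rfl⟩ := hg
    refine ⟨weylRefl P i, fun x => ?_⟩
    induction x with
    | zero => simp
    | tmul m l => rfl
    | add x y hx hy => rw [map_add, smul_add, hx, hy]
  | one => exact ⟨1, fun x => (one_smul _ x).symm⟩
  | mul g h _ _ hg hh =>
    obtain ⟨w, hw⟩ := hg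
    obtain ⟨w', hw'⟩ := hh
    exact ⟨w * w', fun x => by rw [LinearEquiv.mul_apply, hw', hw, mul_smul]⟩
  | inv g _ hg =>
    obtain ⟨w, hw⟩ := hg
    refine ⟨w⁻¹, fun x => ?_⟩
    have h1 : g (g⁻¹ x) = x := g.apply_symm_apply x
    rw [hw] at h1
    rw [eq_inv_smul_iff, h1]

lemma exists_mem_sphericalWeyl (w : weyl P) :
    ∃ g ∈ sphericalWeyl P Λ, ∀ x : M ⊗[F] Λ, g x = w • x := by
  let H : Subgroup (weyl P) :=
    { carrier := {w | ∃ g ∈ sphericalWeyl P Λ, ∀ x : M ⊗[F] Λ, g x = w • x}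
      one_mem' := ⟨1, one_mem _, fun x => (one_smul _ x).symm⟩
      mul_mem' := by
        rintro w w' ⟨g, hg, h⟩ ⟨g', hg', h'⟩
        exact ⟨g * g', mul_mem hg hg', fun x => by rw [LinearEquiv.mul_apply, h', h, mul_smul]⟩
      inv_mem' := by
        rintro w ⟨g, hg, h⟩
        refine ⟨g⁻¹, inv_mem hg, fun x => ?_⟩
        have h1 : g (g⁻¹ x) = x := g.apply_symm_apply x
        rw [h] at h1
        rw [eq_inv_smul_iff, h1] }
  have h : weyl P ≤ H.map (weyl P).subtype := by
    refine (Subgroup.closure_le _).2 ?_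
    rintro _ ⟨i, rfl⟩
    refine ⟨weylRefl P i, ⟨wallRefl P Λ i, Subgroup.subset_closure ⟨i, rfl⟩, fun x => ?_⟩, rfl⟩
    induction x with
    | zero => simp
    | tmul m l => rfl
    | add x y hx hy => rw [map_add, smul_add, hx, hy]
  obtain ⟨w', hw', e⟩ := h w.2
  rwa [Subtype.ext e] at hw'

variable [LinearOrder Λ] [IsOrderedAddMonoid Λ] [IsOrderedModule F Λ] [P.IsRootSystem]
  (B : RootBasis P)

lemma coev_smul_dominant (w : weyl P) (i : ι) (l : Λ) :
    coev P Λ i (w • (B.dominant ⊗ₜ[F] l)) = P.coroot' i (w • B.dominant) • l := by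
  rw [TensorProduct.smul_tmul', coev_tmul]

lemma coev_smul_dominant_pos {l : Λ} (hl : 0 < l) (w : weyl P) (i : ι) :
    0 < coev P Λ i (w • (B.dominant ⊗ₜ[F] l)) ↔ 0 < P.coroot' i (w • B.dominant) := by
  rw [coev_smul_dominant, pos_smul_iff hl]

lemma coev_dominant_pos {l : Λ} (hl : 0 < l) (i : ι) :
    0 < coev P Λ i (B.dominant ⊗ₜ[F] l) ↔ B.IsPos i := by
  rw [coev_tmul, pos_smul_iff hl, B.isPos_iff_dominant]

/-- Choose `w` so that `w • v` has the greatest `Λ`-valued height in the finite orbit: reflecting in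
a positive root whose coroot is negative there would increase it. -/
lemma exists_weyl_smul_dominant (v : M ⊗[F] Λ) :
    ∃ w : weyl P, ∀ i, B.IsPos i → 0 ≤ coev P Λ i (w • v) := by
  let ht : M ⊗[F] Λ →ₗ[F] Λ := (TensorProduct.lid F Λ).toLinearMap ∘ₗ B.height.rTensor Λ
  obtain ⟨w, hw⟩ := Finite.exists_max fun w : weyl P => ht (w • v)
  refine ⟨w, fun i hi => ?_⟩
  have h1 := hw (weylRefl P i * w)
  rw [mul_smul, weylRefl_smul_eq, map_sub, sub_le_self_iff] at h1
  have h2 : ht (P.root i ⊗ₜ coev P Λ i (w • v)) =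
      B.height (P.root i) • coev P Λ i (w • v) := by simp [ht]
  rw [h2] at h1
  by_contra h3
  rw [not_le] at h3
  have h4 := smul_pos (B.height_pos hi) (neg_pos.2 h3)
  rw [smul_neg, neg_pos] at h4
  exact not_lt.2 h1 h4

/-- The model space of a root system as an abstract apartment. -/
def model {l : Λ} (hl : 0 < l) : ApartmentModel (weyl P) ι (M ⊗[F] Λ) Λ where
  α i := (coev P Λ i).toAddMonoidHom
  r := weylRefl P
  o := B.dominant ⊗ₜ l
  ne i := by
    change coev P Λ i (B.dominant ⊗ₜ l) ≠ 0
    rw [coev_tmul]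
    exact smul_ne_zero (B.dominant_ne i) hl.ne'
  perm w := by
    obtain ⟨σ, hσ⟩ := exists_weyl_perm P w
    exact ⟨σ, fun i => ⟨fun v => coev_smul_of (hσ i).2.1 v, (hσ i).2.2⟩⟩
  cover v := by
    obtain ⟨w, hw⟩ := exists_weyl_smul_dominant B v
    exact ⟨w, fun i hi => hw i ((coev_dominant_pos B hl i).1 hi)⟩
  free w h := B.eq_one_of_dominant fun i hi =>
    (coev_smul_dominant_pos B hl w i).1 (h i ((coev_dominant_pos B hl i).2 hi))
  deep κ := by
    refine ⟨((∑ j, |(P.coroot' j B.dominant)⁻¹|) • B.dominant) ⊗ₜ |κ|, fun i hi => ?_⟩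
    have hpos := B.dominant_pos ((coev_dominant_pos B hl i).1 hi)
    change κ ≤ coev P Λ i (((∑ j, |(P.coroot' j B.dominant)⁻¹|) • B.dominant) ⊗ₜ |κ|)
    rw [coev_tmul, map_smul, smul_eq_mul]
    refine (le_abs_self κ).trans ?_
    have h1 : |(P.coroot' i B.dominant)⁻¹| ≤ ∑ j, |(P.coroot' j B.dominant)⁻¹| :=
      Finset.single_le_sum (f := fun j => |(P.coroot' j B.dominant)⁻¹|)
        (fun _ _ => abs_nonneg _) (Finset.mem_univ i)
    have h2 := mul_le_mul_of_nonneg_right ((le_abs_self _).trans h1) hpos.le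
    rw [inv_mul_cancel₀ hpos.ne'] at h2
    have h3 := smul_le_smul_of_nonneg_right h2 (abs_nonneg κ)
    rwa [one_smul] at h3
  small ε hε := by
    -- With `s` the sum of absolute values at the dominant vector, scaling by `1 / (1 + s)` gives
    -- total size `s / (1 + s) • ε`, strictly less than `ε`.
    have hs : 0 < 1 + ∑ j, |P.coroot' j B.dominant| :=
      add_pos_of_pos_of_nonneg one_pos (Finset.sum_nonneg fun _ _ => abs_nonneg _)
    refine ⟨((1 + ∑ j, |P.coroot' j B.dominant|)⁻¹ • B.dominant) ⊗ₜ ε, fun i hi => ?_, ?_⟩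
    · change 0 < coev P Λ i (((1 + ∑ j, |P.coroot' j B.dominant|)⁻¹ • B.dominant) ⊗ₜ ε)
      rw [coev_tmul, map_smul, smul_eq_mul]
      exact smul_pos (mul_pos (inv_pos.2 hs)
        (B.dominant_pos ((coev_dominant_pos B hl i).1 hi))) hε
    · have h1 : ∀ i, |coev P Λ i
          (((1 + ∑ j, |P.coroot' j B.dominant|)⁻¹ • B.dominant) ⊗ₜ ε)| =
          ((1 + ∑ j, |P.coroot' j B.dominant|)⁻¹ * |P.coroot' i B.dominant|) • ε := by
        intro i
        rw [coev_tmul, map_smul, smul_eq_mul]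
        rcases le_total 0 (P.coroot' i B.dominant) with h | h
        · rw [abs_of_nonneg h,
            abs_of_nonneg (smul_nonneg (mul_nonneg (inv_pos.2 hs).le h) hε.le)]
        · have h0 := smul_nonneg (mul_nonneg (inv_pos.2 hs).le (neg_nonneg.2 h)) hε.le
          rw [abs_of_nonpos h, mul_neg, neg_smul]
          rw [mul_neg, neg_smul] at h0
          exact abs_of_nonpos (neg_nonneg.1 h0)
      change ∑ i, |coev P Λ i
        (((1 + ∑ j, |P.coroot' j B.dominant|)⁻¹ • B.dominant) ⊗ₜ ε)| < ε
      rw [Finset.sum_congr rfl fun i _ => h1 i, ← Finset.sum_smul, ← Finset.mul_sum]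
      have h2 : 0 < (1 - (1 + ∑ j, |P.coroot' j B.dominant|)⁻¹ *
          ∑ j, |P.coroot' j B.dominant|) • ε := by
        refine smul_pos ?_ hε
        rw [sub_pos, inv_mul_lt_iff₀ hs, mul_one]
        exact lt_one_add _
      rwa [sub_smul, one_smul, sub_pos] at h2
  simple w hw := by
    obtain ⟨k, hk, hneg⟩ := B.exists_simple_neg hw
    refine ⟨k, (coev_dominant_pos B hl k).2 (B.isPos_simple hk), fun j hj hjk => ?_, ?_⟩
    · refine (coev_smul_dominant_pos B hl _ j).2 ?_
      rw [weylRefl_smul]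
      have h1 := B.dominant_pos (B.isPos_reflectionPerm hk ((coev_dominant_pos B hl j).1 hj)
        fun e => hjk ((weylRefl_inj P).2 e))
      rwa [P.coroot'_reflectionPerm] at h1
    · change coev P Λ k (w • (B.dominant ⊗ₜ[F] l)) < 0
      rw [coev_smul_dominant]
      have := smul_pos (neg_pos.2 hneg) hl
      rwa [neg_smul, neg_pos] at this
  refl_sq := weylRefl_sq P
  refl_neg i v := coev_weylRefl_smul i v
  parallel i j hij hi hj := by
    have h1 := root_eq_smul_of_reflection_eq P ((weylRefl_inj P).1 hij.symm)
    set c := P.coroot' i (P.root j) / 2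
    have hc : 0 < c := by
      have h2 := B.height_pos ((coev_dominant_pos B hl j).1 hj)
      rw [h1, map_smul, smul_eq_mul] at h2
      exact pos_of_mul_pos_left h2 (B.height_pos ((coev_dominant_pos B hl i).1 hi)).le
    have hc' := inv_pos.2 hc
    refine ⟨⟨(LinearEquiv.smulOfNeZero F Λ c⁻¹ hc'.ne').toAddEquiv, ?_⟩, fun v => ?_⟩
    · intro a b
      exact smul_le_smul_iff_of_pos_left (α := F) hc'
    · exact coev_of_root_eq_smul hc.ne' h1 v
  nonparallel i j hij κ := by
    obtain ⟨m, hi, hj⟩ := exists_coroot'_eq fun e => hij ((weylRefl_inj P).2 e)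
    refine ⟨m ⊗ₜ κ, ?_, ?_⟩
    · change κ ≤ coev P Λ i (m ⊗ₜ κ)
      rw [coev_tmul, hi, one_smul]
    · change coev P Λ j (m ⊗ₜ κ) ≤ -κ
      rw [coev_tmul, hj, neg_smul, one_smul]
  panel i hi hs w w' := by
    rintro ⟨K, hK⟩
    have hs' : ∀ j, B.IsPos j → weylRefl P j ≠ weylRefl P i →
        0 < P.coroot' j (weylRefl P i • B.dominant) := fun j hj hji =>
      (coev_smul_dominant_pos B hl _ j).1 (hs j ((coev_dominant_pos B hl j).2 hj) hji)
    refine B.eq_or_eq_of_sumAbs_eq hs' fun m h1 h2 => ?_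
    -- A nonzero difference `Δ` in `F` can be scaled to `±1` in the factor `M`. Tensoring with `κ`,
    -- which is larger than `K`, then violates the bound; no archimedean property of `Λ` is needed.
    by_contra hne
    have hne' := sub_ne_zero.2 hne
    set Δ := B.sumAbs w' m - B.sumAbs w m with hΔ
    set κ := |K| + l
    have hκ : 0 < κ := add_pos_of_nonneg_of_pos (abs_nonneg K) hl
    have hsum : ∀ u : weyl P, ∀ v : M ⊗[F] Λ, v = (|Δ|⁻¹ • m) ⊗ₜ κ →
        (∑ j, if 0 < coev P Λ j (u • (B.dominant ⊗ₜ[F] l)) then coev P Λ j v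
          else -coev P Λ j v) = (|Δ|⁻¹ * B.sumAbs u m) • κ := by
      rintro u v rfl
      rw [B.sumAbs_apply, Finset.mul_sum, Finset.sum_smul]
      refine Finset.sum_congr rfl fun j _ => ?_
      rw [coev_tmul j (|Δ|⁻¹ • m) κ, map_smul (P.coroot' j), smul_eq_mul]
      by_cases hj : 0 < P.coroot' j (u • B.dominant)
      · rw [if_pos ((coev_smul_dominant_pos B hl u j).2 hj), if_pos hj]
      · rw [if_neg fun h => hj ((coev_smul_dominant_pos B hl u j).1 h), if_neg hj, mul_neg,
          neg_smul]
    have hdir : ∀ j, 0 ≤ P.coroot' j m → 0 ≤ coev P Λ j ((|Δ|⁻¹ • m) ⊗ₜ κ) := by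
      intro j hj
      rw [coev_tmul, map_smul, smul_eq_mul]
      exact smul_nonneg (mul_nonneg (inv_nonneg.2 (abs_nonneg _)) hj) hκ.le
    have h3 := hK ((|Δ|⁻¹ • m) ⊗ₜ κ)
      (fun j hj => hdir j (h1 j ((coev_dominant_pos B hl j).1 hj)))
      (fun j hj => hdir j (h2 j ((coev_smul_dominant_pos B hl _ j).1 hj)))
    have h4 := (congrArg₂ (fun a b => |a - b|) (hsum w' _ rfl) (hsum w _ rfl)).symm.trans_le h3
    rw [← sub_smul, ← mul_sub, ← hΔ] at h4
    have h5 : |(|Δ|⁻¹ * Δ) • κ| = κ := by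
      rcases lt_or_gt_of_ne hne' with hneg | hpos
      · rw [abs_of_neg hneg, inv_neg, neg_mul, inv_mul_cancel₀ hne', neg_smul, one_smul, abs_neg,
          abs_of_pos hκ]
      · rw [abs_of_pos hpos, inv_mul_cancel₀ hne', one_smul, abs_of_pos hκ]
    rw [h5] at h4
    exact absurd h4 (not_le.2 (lt_of_le_of_lt (le_abs_self K) (lt_add_of_pos_right _ hl)))

end Model

end

end GenAffineBuilding

/-! ### From the axioms (A1)-(A6) to the abstract building, and the theorem -/

namespace GenAffineBuilding

set_option linter.unusedSectionVars false

open Set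

section Transfer

variable {ι : Type*} [Fintype ι] {F : Subfield ℝ} {M N Λ X : Type*}
  [AddCommGroup M] [Module F M] [AddCommGroup N] [Module F N]
  [AddCommGroup Λ] [LinearOrder Λ] [IsOrderedAddMonoid Λ] [Module F Λ] [IsOrderedModule F Λ]
  {P : RootPairing ι F M N} [P.IsRootSystem] {B : RootBasis P} {l : Λ} (hl : 0 < l)

/-- The norm `D` sums over all roots, and opposite roots contribute equally. This is the origin of
the factor `2` in the distances below. -/
lemma model_D_sub (x y : M ⊗[F] Λ) : (model B hl).D (y - x) = 2 • modelDist B x y := by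
  classical
  have hneg : ∀ i, P.reflectionPerm (P.reflectionPerm i i) (P.reflectionPerm i i) = i := by
    intro i
    apply P.root.injective
    rw [P.root_reflectionPerm, P.reflection_apply_self, P.root_reflectionPerm,
      P.reflection_apply_self, neg_neg]
  have habs : ∀ i v, |coev P Λ (P.reflectionPerm i i) v| = |coev P Λ i v| := by
    intro i v
    have : P.root (P.reflectionPerm i i) = (-1 : F) • P.root i := by
      rw [P.root_reflectionPerm, P.reflection_apply_self, neg_smul, one_smul]
    rw [coev_of_root_eq_smul (by norm_num) this, inv_neg, inv_one, neg_smul, one_smul, abs_neg]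
  have h1 : ∑ i with ¬ B.IsPos i, |coev P Λ i (y - x)| = ∑ i with B.IsPos i,
      |coev P Λ i (y - x)| := by
    refine Finset.sum_nbij' (fun i => P.reflectionPerm i i) (fun i => P.reflectionPerm i i)
      (fun i hi => ?_) (fun i hi => ?_) (fun i _ => hneg i) (fun i _ => hneg i)
      (fun i _ => (habs i _).symm)
    · rw [Finset.mem_filter] at hi ⊢
      exact ⟨Finset.mem_univ _, B.isPos_neg.2 hi.2⟩
    · rw [Finset.mem_filter] at hi ⊢
      exact ⟨Finset.mem_univ _, fun h => B.isPos_neg.1 h hi.2⟩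
  change ∑ i, |coev P Λ i (y - x)| = _
  rw [← Finset.sum_filter_add_sum_filter_not Finset.univ (fun i => B.IsPos i), h1, two_smul,
    modelDist]

lemma mem_affineWeyl_iff {T : AddSubgroup (M ⊗[F] Λ)} {g : M ⊗[F] Λ → M ⊗[F] Λ} :
    g ∈ affineWeyl P T ↔ ∃ w : weyl P, ∃ t ∈ T, ∀ x, g x = w • x + t := by
  constructor
  · rintro ⟨u, hu, t, ht, h⟩
    obtain ⟨w, hw⟩ := exists_weyl_of_mem_sphericalWeyl hu
    exact ⟨w, t, ht, fun x => by rw [h, hw]⟩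
  · rintro ⟨w, t, ht, h⟩
    obtain ⟨u, hu, hw⟩ := exists_mem_sphericalWeyl (Λ := Λ) w
    exact ⟨u, hu, t, ht, fun x => by rw [h, hw]⟩

lemma model_C_one : (model B hl).C 1 = fundChamber B Λ := by
  ext x
  refine forall_congr' fun i => ?_
  rw [one_smul]
  exact imp_congr_left (coev_dominant_pos B hl i)

lemma image_fundChamber (w : weyl P) (t : M ⊗[F] Λ) :
    (fun x => w • x + t) '' fundChamber B Λ = (model B hl).sector t w := by
  have key : ∀ x, w • x + t ∈ (model B hl).sector t w ↔ x ∈ fundChamber B Λ := fun x => by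
    rw [mem_sector, add_sub_cancel_right, ← model_C_one hl,
      ← (model B hl).smul_mem_C w 1, mul_one]
  ext x
  constructor
  · rintro ⟨y, hy, rfl⟩
    exact (key y).2 hy
  · intro hx
    have : w • (w⁻¹ • (x - t)) + t = x := by rw [smul_inv_smul, sub_add_cancel]
    exact ⟨w⁻¹ • (x - t), (key _).1 (by rwa [this]), this⟩

lemma isModelChamber_iff {C : Set (M ⊗[F] Λ)} {p : M ⊗[F] Λ} :
    IsModelChamber B C p ↔ ∃ w, C = (model B hl).sector p w := by
  constructor
  · rintro ⟨g, hg, rfl, rfl⟩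
    obtain ⟨w, t, -, h⟩ := mem_affineWeyl_iff.1 hg
    have h0 : g 0 = t := by rw [h, smul_zero, zero_add]
    exact ⟨w, by rw [h0, ← image_fundChamber hl, funext h]⟩
  · rintro ⟨w, rfl⟩
    refine ⟨fun x => w • x + p, mem_affineWeyl_iff.2 ⟨w, p, trivial, fun _ => rfl⟩,
      (image_fundChamber hl w p).symm, ?_⟩
    change p = w • (0 : M ⊗[F] Λ) + p
    rw [smul_zero, zero_add]

lemma isChamberAt_iff {𝒜 : Set (M ⊗[F] Λ → X)} {S : Set X} {x : X} :
    IsChamberAt B 𝒜 S x ↔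
      ∃ f ∈ 𝒜, ∃ p w, f p = x ∧ S = f '' (model B hl).sector p w := by
  constructor
  · rintro ⟨f, hf, C, p, hC, rfl, rfl⟩
    obtain ⟨w, rfl⟩ := (isModelChamber_iff hl).1 hC
    exact ⟨f, hf, p, w, rfl, rfl⟩
  · rintro ⟨f, hf, p, w, rfl, rfl⟩
    exact ⟨f, hf, _, p, (isModelChamber_iff hl).2 ⟨w, rfl⟩, rfl, rfl⟩

lemma isChamber_iff {𝒜 : Set (M ⊗[F] Λ → X)} {S : Set X} :
    IsChamber B 𝒜 S ↔ IsSector (model B hl) 𝒜 S := by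
  constructor
  · rintro ⟨x, hx⟩
    obtain ⟨f, hf, p, w, -, h⟩ := (isChamberAt_iff hl).1 hx
    exact ⟨f, hf, p, w, h⟩
  · rintro ⟨f, hf, p, w, h⟩
    exact ⟨f p, (isChamberAt_iff hl).2 ⟨f, hf, p, w, rfl, h⟩⟩

lemma image_sector_eq {g f : M ⊗[F] Λ → X} {p t : M ⊗[F] Λ} {w u : weyl P}
    (h : ∀ x, g x ∈ range f → g x = f (u • x + t))
    (hp : g '' (model B hl).sector p w ⊆ range f) :
    g '' (model B hl).sector p w = f '' (model B hl).sector (u • p + t) (u * w) := by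
  ext y
  constructor
  · rintro ⟨x, hx, rfl⟩
    exact ⟨u • x + t, affine_mem_sector.2 hx, (h x (hp ⟨x, hx, rfl⟩)).symm⟩
  · rintro ⟨x, hx, rfl⟩
    have e : u • (u⁻¹ • (x - t)) + t = x := by rw [smul_inv_smul, sub_add_cancel]
    rw [← e] at hx ⊢
    have hx' := affine_mem_sector.1 hx
    exact ⟨_, hx', h _ (hp ⟨_, hx', rfl⟩)⟩

variable {T : AddSubgroup (M ⊗[F] Λ)} {𝒜 : Set (M ⊗[F] Λ → X)} (hX : IsAffineBuilding B T 𝒜)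
include hX

lemma IsAffineBuilding.compatible' {f g : M ⊗[F] Λ → X} (hf : f ∈ 𝒜) (hg : g ∈ 𝒜)
    (h : (range f ∩ range g).Nonempty) :
    ∃ w : weyl P, ∃ t ∈ T, ∀ x, f x ∈ range g → f x = g (w • x + t) := by
  obtain ⟨-, u, hu, he⟩ := hX.compatible f hf g hg h
  obtain ⟨w, t, ht, hw⟩ := mem_affineWeyl_iff.1 hu
  exact ⟨w, t, ht, fun x hx => (he hx).trans (congrArg g (hw x))⟩

lemma IsAffineBuilding.two_nsmul_bdist {f : M ⊗[F] Λ → X} (hf : f ∈ 𝒜) (a b : M ⊗[F] Λ) :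
    2 • bdist B 𝒜 (f a) (f b) = (model B hl).D (b - a) := by
  have h : ∃ pq : (M ⊗[F] Λ) × (M ⊗[F] Λ), ∃ g ∈ 𝒜, g pq.1 = f a ∧ g pq.2 = f b :=
    ⟨(a, b), f, hf, rfl, rfl⟩
  obtain ⟨g, hg, h1, h2⟩ := h.choose_spec
  obtain ⟨w, t, -, hw⟩ := hX.compatible' hf hg ⟨f a, ⟨a, rfl⟩, _, h1⟩
  rw [bdist, dif_pos h, hX.injective g hg (h1.trans (hw a ⟨_, h1⟩)),
    hX.injective g hg (h2.trans (hw b ⟨_, h2⟩)), ← model_D_sub hl,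
    add_sub_add_right_eq_sub, ← smul_sub, (model B hl).D_smul]

lemma IsAffineBuilding.bdist_eq {f : M ⊗[F] Λ → X} (hf : f ∈ 𝒜) (a b : M ⊗[F] Λ) :
    bdist B 𝒜 (f a) (f b) = modelDist B a b := by
  rcases subsingleton_or_nontrivial Λ with h | h
  · exact Subsingleton.elim _ _
  · obtain ⟨l, hl⟩ := exists_ne (0 : Λ)
    have h1 := hX.two_nsmul_bdist (abs_pos.2 hl) hf a b
    rw [model_D_sub] at h1
    exact nsmul_right_injective two_ne_zero h1

/-- Retract `y` into an apartment containing `x` and `z`, as (A5) allows without increasing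
distances, and use the triangle inequality of the model space. -/
lemma IsAffineBuilding.triangle (x y z : X) :
    bdist B 𝒜 x z ≤ bdist B 𝒜 x y + bdist B 𝒜 y z := by
  obtain ⟨_, ⟨f, hf, rfl⟩, ⟨a, rfl⟩, ⟨c, rfl⟩⟩ := hX.exists_apartment x z
  obtain ⟨r, hr, hfix, hle, -⟩ := hX.exists_retraction _ ⟨f, hf, rfl⟩ (f a) ⟨a, rfl⟩
  obtain ⟨b, hb⟩ := hr y
  have h1 := hle (f a) y
  have h2 := hle y (f c)
  rw [hfix _ ⟨a, rfl⟩, ← hb, hX.bdist_eq hf] at h1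
  rw [hfix _ ⟨c, rfl⟩, ← hb, hX.bdist_eq hf] at h2
  refine le_trans ?_ (add_le_add h1 h2)
  rw [hX.bdist_eq hf, modelDist, modelDist, modelDist, ← Finset.sum_add_distrib]
  refine Finset.sum_le_sum fun i _ => ?_
  rw [← sub_add_sub_cancel' b a c, map_add]
  exact abs_add_le _ _

/-- A generalized affine building in the sense of the axioms (A1)-(A6) is a building over the
model space of its root system. -/
lemma IsAffineBuilding.building :
    Building (model B hl) T 𝒜 (fun x y => 2 • bdist B 𝒜 x y) where
  inj := hX.injective
  comp f hf w t ht := hX.comp_mem f hf _ (mem_affineWeyl_iff.2 ⟨w, t, ht, fun _ => rfl⟩)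
  compat f hf g hg hfg := by
    refine ⟨?_, hX.compatible' hf hg hfg⟩
    obtain ⟨⟨𝓗, hfin, h𝓗, he⟩, -⟩ := hX.compatible f hf g hg hfg
    choose i k h using h𝓗
    have := hfin.to_subtype
    refine ⟨range fun H : 𝓗 => (i H H.2, k H H.2), finite_range _, ?_⟩
    rw [he]
    ext x
    constructor
    · rintro hx _ ⟨⟨H, hH⟩, rfl⟩
      exact (h H hH).2.subset (hx H hH)
    · intro hx H hH
      exact (h H hH).2.superset (hx _ ⟨⟨H, hH⟩, rfl⟩)
  exists_chart x y := by
    obtain ⟨_, ⟨f, hf, rfl⟩, hx, hy⟩ := hX.exists_apartment x y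
    exact ⟨f, hf, hx, hy⟩
  exists_chart_sectors f hf g hg p q w v := by
    obtain ⟨S₁, S₂, h₁, h₂, hs₁, hs₂, h, hh, hsub⟩ := hX.exists_subchambers
      (f '' (model B hl).sector p w) (g '' (model B hl).sector q v)
      ((isChamber_iff hl).2 ⟨f, hf, p, w, rfl⟩) ((isChamber_iff hl).2 ⟨g, hg, q, v, rfl⟩)
    obtain ⟨hsub₁, hsub₂⟩ := union_subset_iff.1 hsub
    have key : ∀ {S : Set X}, IsChamber B 𝒜 S → S ⊆ range h →
        ∃ p' w', h '' (model B hl).sector p' w' = S := by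
      intro S hS hSh
      obtain ⟨f', hf', p', w', rfl⟩ := (isChamber_iff hl).1 hS
      obtain ⟨u, t, -, hu⟩ := hX.compatible' hf' hh
        ⟨f' p', ⟨p', rfl⟩, hSh ⟨p', self_mem_sector p' w', rfl⟩⟩
      exact ⟨_, _, (image_sector_eq hl hu hSh).symm⟩
    obtain ⟨p', w', e₁⟩ := key h₁ hsub₁
    obtain ⟨q', v', e₂⟩ := key h₂ hsub₂
    exact ⟨h, hh, p', w', q', v', e₁.subset.trans hs₁, e₂.subset.trans hs₂⟩
  dist f hf a b := hX.two_nsmul_bdist hl hf a b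
  triangle x y z := by
    rw [← nsmul_add]
    exact nsmul_le_nsmul_right (hX.triangle x y z) 2
  inter f hf g hg h hh i j m k₁ k₂ k₃ h₁ h₂ h₃ := by
    have key : ∀ {f g : M ⊗[F] Λ → X}, f ∈ 𝒜 → ∀ {i k},
        f ⁻¹' range g = {x | k ≤ (model B hl).α i x} →
        IsHalfApartment P 𝒜 (range f ∩ range g) := by
      intro f g hf i k h
      refine ⟨f, hf, halfSpace P i k, ⟨i, k, rfl⟩, ?_⟩
      have : halfSpace P i k = f ⁻¹' range g := h.symm
      rw [this, image_preimage_eq_range_inter]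
    exact hX.inter_nonempty f hf g hg h hh (key hf h₁) (key hg h₂) (key hf h₃)

/-- In the chart carrying `S` the two sectors are translates of one cone, so the constant
displacement bounds their distance. -/
lemma IsAffineBuilding.parallel_of_subset {S : Set X} (hS : IsSector (model B hl) 𝒜 S)
    {g : M ⊗[F] Λ → X} (hg : g ∈ 𝒜) {p : M ⊗[F] Λ} {w : weyl P}
    (h : g '' (model B hl).sector p w ⊆ S) :
    Parallel B 𝒜 S (g '' (model B hl).sector p w) := by
  obtain ⟨f, hf, a, θ, rfl⟩ := hS
  have hr : g '' (model B hl).sector p w ⊆ range f := h.trans (image_subset_range _ _)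
  obtain ⟨u, t, -, hu⟩ := hX.compatible' hg hf
    ⟨g p, ⟨p, rfl⟩, hr ⟨p, self_mem_sector p w, rfl⟩⟩
  rw [image_sector_eq hl hu hr] at h ⊢
  set b := u • p + t
  have hsub := (image_subset_image_iff (hX.injective f hf)).1 h
  have e := eq_of_sector_subset hsub
  rw [e] at hsub ⊢
  refine ⟨modelDist B a b, ?_, ?_⟩
  · rintro _ ⟨x, hx, rfl⟩
    refine ⟨f (x - a + b), ⟨x - a + b, ?_, rfl⟩, ?_⟩
    · rw [mem_sector, add_sub_cancel_right]
      exact hx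
    · rw [hX.bdist_eq hf, modelDist, modelDist]
      have : x - a + b - x = b - a := by abel
      rw [this]
  · rintro _ ⟨x, hx, rfl⟩
    refine ⟨f x, ⟨x, hsub hx, rfl⟩, ?_⟩
    rw [hX.bdist_eq hf, modelDist, modelDist, sub_self]
    refine Finset.sum_le_sum fun i _ => ?_
    rw [map_zero, abs_zero]
    exact abs_nonneg _

lemma IsAffineBuilding.seg_subset {f : M ⊗[F] Λ → X} (hf : f ∈ 𝒜) (a b : M ⊗[F] Λ)
    (hl : 0 < l) : seg B 𝒜 (f a) (f b) ⊆ range f := by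
  intro z hz
  refine (hX.building hl).seg_subset_range hf (a := a) (b := b) ?_ hl
  rw [← nsmul_add]
  exact congrArg (2 • ·) hz

/-- The finite cover of a segment by apartments containing a chamber at infinity. -/
lemma IsAffineBuilding.exists_cover_infinity (hl : 0 < l) (x y : X) {c : Set (Set X)}
    (hc : c ∈ chambersAtInfinity B 𝒜) :
    ∃ 𝒢 : Set (Set X), 𝒢.Finite ∧
      (∀ A ∈ 𝒢, IsApartment 𝒜 A ∧ ContainsAtInfinity A c) ∧ seg B 𝒜 x y ⊆ ⋃₀ 𝒢 := by
  obtain ⟨S, hS, rfl⟩ := hc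
  have hS' := (isChamber_iff hl).1 hS
  obtain ⟨_, ⟨f, hf, rfl⟩, ⟨a, rfl⟩, ⟨b, rfl⟩⟩ := hX.exists_apartment x y
  obtain ⟨𝒢, hfin, h𝒢, hcov⟩ := (hX.building hl).exists_finite_cover hf hS'
  refine ⟨range '' 𝒢, hfin.image _, ?_, fun z hz => ?_⟩
  · rintro _ ⟨g, hg, rfl⟩
    obtain ⟨hg𝒜, w, p, hp⟩ := h𝒢 g hg
    have hsub : g '' (model B hl).sector p w ⊆ S := image_subset_iff.2 hp
    exact ⟨⟨g, hg𝒜, rfl⟩, g '' (model B hl).sector p w,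
      ⟨(isChamber_iff hl).2 ⟨g, hg𝒜, p, w, rfl⟩, hX.parallel_of_subset hl hS' hg𝒜 hsub⟩,
      image_subset_range _ _⟩
  · obtain ⟨p, rfl⟩ := hX.seg_subset hf a b hl hz
    obtain ⟨g, hg, hpg⟩ := hcov p
    exact ⟨range g, ⟨g, hg, rfl⟩, hpg⟩

/-- The finite cover of a segment by Weyl chambers based at a given point. -/
lemma IsAffineBuilding.exists_cover_chambers (hl : 0 < l) (x y z : X) :
    ∃ 𝒢 : Set (Set X), 𝒢.Finite ∧ (∀ S ∈ 𝒢, IsChamberAt B 𝒜 S z) ∧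
      seg B 𝒜 x y ⊆ ⋃₀ 𝒢 := by
  obtain ⟨_, ⟨f, hf, rfl⟩, ⟨a, rfl⟩, ⟨b, rfl⟩⟩ := hX.exists_apartment x y
  obtain ⟨𝒢, hfin, h𝒢, hcov⟩ := (hX.building hl).exists_finite_sector_cover hf z
  refine ⟨𝒢, hfin, fun S hS => (isChamberAt_iff hl).2 (h𝒢 S hS), fun v hv => ?_⟩
  obtain ⟨p, rfl⟩ := hX.seg_subset hf a b hl hv
  exact hcov p

lemma IsAffineBuilding.exists_apartment_germ (hl : 0 < l) {z : X} {S Q : Set X}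
    (hS : IsChamberAt B 𝒜 S z) (hQ : IsChamberAt B 𝒜 Q z) :
    ∃ A, IsApartment 𝒜 A ∧ ContainsGerm B 𝒜 A S z ∧ Q ⊆ A := by
  obtain ⟨f, hf, p, D, rfl, rfl⟩ := (isChamberAt_iff hl).1 hS
  obtain ⟨g, hg, q, v, hq, rfl⟩ := (isChamberAt_iff hl).1 hQ
  have hQ' : IsSector (model B hl) 𝒜 (g '' (model B hl).sector q v) := ⟨g, hg, q, v, rfl⟩
  obtain ⟨h, hh, w, hw, ⟨q', hq'⟩, ε, hε, hgerm⟩ :=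
    (hX.building hl).exists_chart_germ hf p D hQ' hl
  -- The radius is halved because `hgerm` measures with `D`, which is twice the distance of the
  -- building.
  refine ⟨range h, ⟨h, hh, rfl⟩, ⟨(2⁻¹ : F) • ε, smul_pos (by norm_num) hε, ?_⟩, ?_⟩
  · rintro _ ⟨⟨x, hx, rfl⟩, hxε⟩
    refine hgerm x hx ?_
    rw [← hX.two_nsmul_bdist hl hf, two_nsmul]
    have h1 := add_lt_add hxε hxε
    rw [← add_smul, ← two_mul, mul_inv_cancel₀ two_ne_zero, one_smul] at h1
    exact h1
  · rw [← (hX.building hl).sector_eq hQ' hh hg (hq'.trans hq.symm) hw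
      ⟨q, fun x hx => ⟨x, hx, rfl⟩⟩]
    exact image_subset_range _ _

/-- The finite cover of a segment by apartments containing the germ of a Weyl chamber. -/
lemma IsAffineBuilding.exists_cover_germ (hl : 0 < l) (x y : X) {z : X} {S : Set X}
    (hS : IsChamberAt B 𝒜 S z) :
    ∃ 𝒢 : Set (Set X), 𝒢.Finite ∧
      (∀ A ∈ 𝒢, IsApartment 𝒜 A ∧ ContainsGerm B 𝒜 A S z) ∧ seg B 𝒜 x y ⊆ ⋃₀ 𝒢 := by
  obtain ⟨𝒢, hfin, h𝒢, hcov⟩ := hX.exists_cover_chambers hl x y z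
  choose! A hA using fun Q hQ => hX.exists_apartment_germ hl hS (h𝒢 Q hQ)
  refine ⟨A '' 𝒢, hfin.image _, ?_, fun v hv => ?_⟩
  · rintro _ ⟨Q, hQ, rfl⟩
    exact ⟨(hA Q hQ).1, (hA Q hQ).2.1⟩
  · obtain ⟨Q, hQ, hvQ⟩ := hcov hv
    exact ⟨A Q, ⟨Q, hQ, rfl⟩, (hA Q hQ).2.2 hvQ⟩

end Transfer

end GenAffineBuilding

theorem mainTheorem5 {ι : Type*} [Fintype ι] {F : Subfield ℝ} {M N Λ X : Type*}
    [AddCommGroup M] [Module F M] [AddCommGroup N] [Module F N]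
    [AddCommGroup Λ] [LinearOrder Λ] [IsOrderedAddMonoid Λ] [Module F Λ] [IsOrderedModule F Λ]
    (P : RootPairing ι F M N) [P.IsRootSystem] (B : GenAffineBuilding.RootBasis P)
    (T : AddSubgroup (M ⊗[F] Λ)) (hT : GenAffineBuilding.IsTranslationGroup P T)
    (𝒜 : Set (M ⊗[F] Λ → X)) (hX : GenAffineBuilding.IsAffineBuilding B T 𝒜) (x y : X) :
    (∀ c ∈ GenAffineBuilding.chambersAtInfinity B 𝒜,
      ∃ 𝒢 : Set (Set X), 𝒢.Finite ∧
        (∀ A ∈ 𝒢, GenAffineBuilding.IsApartment 𝒜 A ∧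
          GenAffineBuilding.ContainsAtInfinity A c) ∧
        GenAffineBuilding.seg B 𝒜 x y ⊆ ⋃₀ 𝒢) ∧
    (∀ z : X,
      (∃ 𝒢 : Set (Set X), 𝒢.Finite ∧
        (∀ S ∈ 𝒢, GenAffineBuilding.IsChamberAt B 𝒜 S z) ∧
        GenAffineBuilding.seg B 𝒜 x y ⊆ ⋃₀ 𝒢) ∧
      (∀ S : Set X, GenAffineBuilding.IsChamberAt B 𝒜 S z →
        ∃ 𝒢 : Set (Set X), 𝒢.Finite ∧
          (∀ A ∈ 𝒢, GenAffineBuilding.IsApartment 𝒜 A ∧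
            GenAffineBuilding.ContainsGerm B 𝒜 A S z) ∧
          GenAffineBuilding.seg B 𝒜 x y ⊆ ⋃₀ 𝒢)) := by
  -- The regular vector of `model` requires a positive element of `Λ`. One exists because the
  -- nonzero group `T` excludes `Λ = 0`.
  have : Nontrivial Λ := by
    by_contra h
    rw [not_nontrivial_iff_subsingleton] at h
    have h0 : ∀ t : M ⊗[F] Λ, t = 0 := by
      intro t
      induction t with
      | zero => rfl
      | tmul m l => rw [Subsingleton.elim l 0, TensorProduct.tmul_zero]
      | add x y hx hy => rw [hx, hy, add_zero]
    exact hT.nontrivial ((AddSubgroup.eq_bot_iff_forall T).2 fun t _ => h0 t)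
  obtain ⟨l, hl⟩ := exists_ne (0 : Λ)
  have hl' := abs_pos.2 hl
  exact ⟨fun c hc => hX.exists_cover_infinity hl' x y hc, fun z =>
    ⟨hX.exists_cover_chambers hl' x y z, fun S hS => hX.exists_cover_germ hl' x y hS⟩⟩
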